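/- **Setting.** Let $(X,\mathsf d_X)$ be a complete separable metric space with a Borel measure $\mathfrak m$ finite on bounded sets, and $(Y,\mathsf d_Y)$ a complete metric space. $L^0(\mathfrak m)$ is the ring of real measurable functions modulo $\mathfrak m$-a.e. equality with local convergence in measure. An $L^0(\mathfrak m)$-normed module is an $L^0(\mathfrak m)$-module $M$ with $|\cdot|:M\to L^0(\mathfrak m)$ such that, $\mathfrak m$-a.e., $|v|\ge 0$, $|v|=0\iff v=0$, $|v+w|\le|v|+|w|$, $|fv|=|f||v|$, and which is complete for the topology in which $v_n\to v$ iff $|v_n-v|\to0$ in $L^0(\mathfrak m)$; a subset generates $M$ if its $L^0(\mathfrak m)$-linear combinations are dense. Its dual $M^*$ is the module of $L^0(\mathfrak m)$-linear continuous maps $L:M\to L^0(\mathfrak m)$, with $|L|=\operatorname{ess\,sup}\{|L(v)|:|v|\le1\}$. For $E\subset X$ Borel and $M$ an $L^0(\mathfrak m|_E)$-normed module, $\mathrm{Ext}(M)$ is the set $M$ on which $f\in L^0(\mathfrak m)$ acts as $f|_E$, with pointwise norm $|v|$ extended by $0$ outside $E$; write $\mathrm{ext}(h)$ for the extension of $h\in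 L^0(\mathfrak m|_E)$ by $0$. For a metric space with a measure $\mathfrak n$ (below $(X,\mathfrak m)$ or $(Y,\mu)$), $S^2(\mathfrak n)$ is the set of $f\in L^0(\mathfrak n)$ for which there are $G\in L^2(\mathfrak n)$ and functions $f_n$, Lipschitz on bounded sets, with $f_n\to f$ in $L^0(\mathfrak n)$ and $\mathrm{lip}_a(f_n)\rightharpoonup G$ weakly in $L^2(\mathfrak n)$, where $\mathrm{lip}_a(f)(x)=\limsup_{y,z\to x}\frac{|f(y)-f(z)|}{\mathsf d(y,z)}$ ($0$ at isolated points); $|Df|$ is the a.e. least such $G$. A cotangent module is an $L^0(\mathfrak n)$-normed module $L^0_{\mathfrak n}(T^*)$ with a linear $\mathrm d_{\mathfrak n}:S^2(\mathfrak n)\to L^0_{\mathfrak n}(T^*)$ whose image generates it and with $|\mathrm d_{\mathfrak n}f|=|Df|$ a.e. (it is unique up to unique isomorphism); write $\mathrm d=\mathrm d_{\mathfrak m}$, and $L^0(TX)$ for the dual of $L^0(T^*X)=L^0_{\mathfrak m}(T^*X)$. Let $u\in S^2(X,Y)$, i.e. $u:X\to Y$ is Borel, maps the complement of an $\mathfrak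 m$-null set into a separable set, and there is $0\le G\in L^2(\mathfrak m)$ such that for every Lipschitz $f:Y\to\mathbb R$ one has $f\circ u\in S^2(X)$ and $|D(f\circ u)|\le \mathrm{Lip}(f)\,G$ a.e.; $|Du|$ is the a.e. least such $G$. Put $\mu:=u_*(|Du|^2\mathfrak m)$ and $\nu:=\mathfrak m|_{\{|Du|>0\}}$, so $u_*\nu\ll\mu$. A pullback of $L^0_\mu(T^*Y)$ is an $L^0(\nu)$-normed module $u^*L^0_\mu(T^*Y)$ with a linear continuous map $[u^*\cdot]$ from $L^0_\mu(T^*Y)$ to it whose image generates it and with $|[u^*\omega]|=|\omega|\circ u$ $\nu$-a.e. (it is unique up to unique isomorphism). For $f\in S^2(Y,\mathsf d_Y,\mu)$ say that $g\in S^2(X)$ represents $f\circ u$ if $g=f\circ u$ $\mathfrak m$-a.e. on $\{|Du|>0\}$ and $|Dg|\le|D f|\circ u\,|Du|$ $\mathfrak m$-a.e. **Proposition.** Cotangent modules of $(X,\mathfrak m)$ and of $(Y,\mu)$ and pullbacks $u^*L^0_\mu(T^*Y)$ exist, and for every choice of them: 1. (Well-posedness) If $g,g'\in S^2(X)$ both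 represent $f\circ u$ for the same $f\in S^2(Y,\mathsf d_Y,\mu)$, then $\mathrm dg=\mathrm dg'$. For every $v\in L^0(TX)$ there is exactly one $\mathrm du(v)\in \mathrm{Ext}\big((u^*L^0_\mu(T^*Y))^*\big)$ such that $$\mathrm{ext}\big(\mathrm du(v)([u^*\mathrm d_\mu f])\big)=v(\mathrm dg)\qquad\mathfrak m\text{-a.e.}$$ for every $f\in S^2(Y,\mathsf d_Y,\mu)$ and every $g\in S^2(X)$ representing $f\circ u$. 2. The map $\mathrm du:L^0(TX)\to\mathrm{Ext}\big((u^*L^0_\mu(T^*Y))^*\big)$ is $L^0(\mathfrak m)$-linear and continuous. 3. Its pointwise operator norm $|\mathrm du|:=\operatorname{ess\,sup}\{|\mathrm du(v)|: v\in L^0(TX),\ |v|\le1\ \mathfrak m\text{-a.e.}\}$ satisfies $|\mathrm du|=|Du|$ $\mathfrak m$-a.e. -/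

import Mathlib

open MeasureTheory Filter Topology
open scoped NNReal ENNReal

universe u v w w₁ w₂ w₃

noncomputable section

namespace MetricSobolev

/-! ## The ring `L⁰` and essential suprema -/

/-- `L⁰(m)`: real-valued measurable functions modulo `m`-a.e. equality, with its (a.e. pointwise)
ring structure and partial order. -/
abbrev L0 {X : Type u} [MeasurableSpace X] (m : Measure X) : Type u := X →ₘ[m] ℝ

instance L0.instCommRing {X : Type u} [MeasurableSpace X] (m : Measure X) : CommRing (L0 m) where
  __ := (inferInstance : AddCommGroup (X →ₘ[m] ℝ))
  __ := (inferInstance : CommMonoid (X →ₘ[m] ℝ))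
  left_distrib f g h := by
    induction f using AEEqFun.induction_on with | _ f hf
    induction g using AEEqFun.induction_on with | _ g hg
    induction h using AEEqFun.induction_on with | _ h hh
    simp only [AEEqFun.mk_add_mk, AEEqFun.mk_mul_mk, mul_add]
  right_distrib f g h := by
    induction f using AEEqFun.induction_on with | _ f hf
    induction g using AEEqFun.induction_on with | _ g hg
    induction h using AEEqFun.induction_on with | _ h hh
    simp only [AEEqFun.mk_add_mk, AEEqFun.mk_mul_mk, add_mul]
  zero_mul f := by
    induction f using AEEqFun.induction_on with | _ f hf
    simp only [AEEqFun.zero_def, AEEqFun.mk_mul_mk, Pi.mul_def, zero_mul]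
  mul_zero f := by
    induction f using AEEqFun.induction_on with | _ f hf
    simp only [AEEqFun.zero_def, AEEqFun.mk_mul_mk, Pi.mul_def, mul_zero]

/-- Convergence in `L⁰(m)`, i.e. convergence in measure on every set of finite measure. -/
def TendstoL0 {X : Type u} [MeasurableSpace X] (m : Measure X) (f : ℕ → X → ℝ) (g : X → ℝ) :
    Prop :=
  ∀ A : Set X, MeasurableSet A → m A < ∞ → TendstoInMeasure (m.restrict A) f atTop g

open Classical in
/-- The essential supremum of a family in `L⁰(m)`: its least upper bound for the a.e. order
(and `0` if there is none; for `m` σ-finite there is one for each nonempty family bounded above). -/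
def essSupOf {X : Type u} [MeasurableSpace X] {m : Measure X} (S : Set (L0 m)) : L0 m :=
  if h : ∃ g, IsLUB S g then h.choose else 0

theorem essSupOf_eq {X : Type u} [MeasurableSpace X] {m : Measure X} {S : Set (L0 m)} {g : L0 m}
    (hg : IsLUB S g) : essSupOf S = g := by
  have h : ∃ g, IsLUB S g := ⟨g, hg⟩
  rw [essSupOf, dif_pos h]
  exact h.choose_spec.unique hg

open Classical in
/-- The least element, in the a.e. sense, of a family in `L⁰(m)` (and `0` if there is none). -/
def leastOf {X : Type u} [MeasurableSpace X] {m : Measure X} (S : Set (L0 m)) : L0 m :=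
  if h : ∃ g, IsLeast S g then h.choose else 0

theorem leastOf_eq {X : Type u} [MeasurableSpace X] {m : Measure X} {S : Set (L0 m)} {g : L0 m}
    (hg : IsLeast S g) : leastOf S = g := by
  have h : ∃ g, IsLeast S g := ⟨g, hg⟩
  rw [leastOf, dif_pos h]
  exact h.choose_spec.unique hg

/-- Composition with a map `φ` such that `φ_* ν ≪ μ`, as a ring homomorphism
`L⁰(μ) → L⁰(ν)`, `f ↦ f ∘ φ`. -/
def compHom {X : Type u} {Y : Type v} [MeasurableSpace X] [MeasurableSpace Y]
    {ν : Measure X} {μ : Measure Y} {φ : X → Y} (hφ : Measure.QuasiMeasurePreserving φ ν μ) :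
    L0 μ →+* L0 ν where
  toFun f := f.compQuasiMeasurePreserving φ hφ
  map_one' := rfl
  map_zero' := rfl
  map_mul' f g := by
    induction f using AEEqFun.induction_on with | _ f hf
    induction g using AEEqFun.induction_on with | _ g hg
    rfl
  map_add' f g := by
    induction f using AEEqFun.induction_on with | _ f hf
    induction g using AEEqFun.induction_on with | _ g hg
    rfl

theorem quasiMeasurePreserving_id_restrict {X : Type u} [MeasurableSpace X] (m : Measure X)
    (E : Set X) : Measure.QuasiMeasurePreserving id (m.restrict E) m :=
  ⟨measurable_id, by
    rw [Measure.map_id]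
    exact Measure.absolutelyContinuous_of_le Measure.restrict_le_self⟩

/-- The restriction `proj : L⁰(m) → L⁰(m|_E)`. -/
def proj {X : Type u} [MeasurableSpace X] (m : Measure X) (E : Set X) :
    L0 m →+* L0 (m.restrict E) :=
  compHom (quasiMeasurePreserving_id_restrict m E)

/-- The extension by zero `ext : L⁰(m|_E) → L⁰(m)`. -/
def extL0 {X : Type u} [MeasurableSpace X] {m : Measure X} {E : Set X} (hE : MeasurableSet E)
    (f : L0 (m.restrict E)) : L0 m :=
  AEEqFun.mk (E.indicator f) ((aestronglyMeasurable_indicator_iff hE).2 f.aestronglyMeasurable)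

/-! ## `L⁰`-normed modules -/

/-- An `L⁰(m)`-module together with a map `|·|` into `L⁰(m)`. This is the data
of an `L⁰(m)`-normed module; the axioms are in `PNModule.IsL0Normed`. -/
structure PNModule {X : Type u} [MeasurableSpace X] (m : Measure X) where
  /-- the elements of the module -/
  carrier : Type w
  [grp : AddCommGroup carrier]
  [mod : Module (L0 m) carrier]
  /-- the pointwise norm -/
  pnorm : carrier → L0 m

namespace PNModule

instance {X : Type u} [MeasurableSpace X] {m : Measure X} :
    CoeSort (PNModule.{u, w} m) (Type w) := ⟨PNModule.carrier⟩

attribute [instance] PNModule.grp PNModule.mod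

/-- Convergence of a sequence in the topology of an `L⁰(m)`-normed module:
`|v n - v₀| → 0` in `L⁰(m)`. -/
def Converges {X : Type u} [MeasurableSpace X] {m : Measure X} (M : PNModule.{u, w} m)
    (v : ℕ → M) (v₀ : M) : Prop :=
  TendstoL0 m (fun n => M.pnorm (v n - v₀)) (fun _ => 0)

/-- Cauchy sequences of an `L⁰(m)`-normed module: `|v n - v k| → 0` in `L⁰(m)` as `n, k → ∞`. -/
def IsCauchy {X : Type u} [MeasurableSpace X] {m : Measure X} (M : PNModule.{u, w} m)
    (v : ℕ → M) : Prop :=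
  ∀ A : Set X, MeasurableSet A → m A < ∞ → ∀ ε : ℝ, 0 < ε →
    Tendsto (fun p : ℕ × ℕ => m.restrict A {x | ε ≤ M.pnorm (v p.1 - v p.2) x}) atTop (𝓝 0)

/-- The axioms of an `L⁰(m)`-normed module (completeness is sequential because for σ-finite `m`
the topology is metrizable). -/
structure IsL0Normed {X : Type u} [MeasurableSpace X] {m : Measure X} (M : PNModule.{u, w} m) :
    Prop where
  pnorm_nonneg : ∀ v : M, 0 ≤ M.pnorm v
  pnorm_eq_zero : ∀ v : M, M.pnorm v = 0 ↔ v = 0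
  pnorm_add_le : ∀ v v' : M, M.pnorm (v + v') ≤ M.pnorm v + M.pnorm v'
  pnorm_smul : ∀ (f : L0 m) (v : M), M.pnorm (f • v) = |f| * M.pnorm v
  complete : ∀ v : ℕ → M, M.IsCauchy v → ∃ v₀ : M, M.Converges v v₀

/-- `S` generates `M`: the `L⁰(m)`-linear combinations of elements of `S` are dense in `M`. -/
def Generates {X : Type u} [MeasurableSpace X] {m : Measure X} (M : PNModule.{u, w} m)
    (S : Set M) : Prop :=
  ∀ w₀ : M, ∃ s : ℕ → M, (∀ n, s n ∈ Submodule.span (L0 m) S) ∧ M.Converges s w₀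

/-- Continuity of a map between `L⁰`-normed modules, possibly over different spaces (sequential
continuity, the topologies being metrizable for σ-finite measures). -/
def ContinuousMap {X : Type u} {Y : Type v} [MeasurableSpace X] [MeasurableSpace Y]
    {m : Measure X} {μ : Measure Y} (M : PNModule.{u, w₁} m) (N : PNModule.{v, w₂} μ)
    (T : M → N) : Prop :=
  ∀ (v : ℕ → M) (v₀ : M), M.Converges v v₀ → N.Converges (fun n => T (v n)) (T v₀)

/-- The set `{|T v| : |v| ≤ 1}`, whose essential supremum is the pointwise operator norm `|T|`. -/
def unitBallValues {X : Type u} [MeasurableSpace X] {m : Measure X} (M : PNModule.{u, w₁} m)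
    (N : PNModule.{u, w₂} m) (T : M → N) : Set (L0 m) :=
  {h | ∃ v : M, M.pnorm v ≤ 1 ∧ h = N.pnorm (T v)}

/-- `L⁰(m)`-linear maps `L : M → L⁰(m)` with `|L v| ≤ g |v|` for some `g ∈ L⁰(m)`
(for `L⁰(m)`-linear maps on an `L⁰(m)`-normed module this is the same as continuity). -/
def dualSubmodule {X : Type u} [MeasurableSpace X] {m : Measure X} (M : PNModule.{u, w} m) :
    Submodule (L0 m) (M →ₗ[L0 m] L0 m) where
  carrier := {L | ∃ g : L0 m, ∀ v : M, |L v| ≤ g * M.pnorm v}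
  zero_mem' := ⟨0, fun v => by
    rw [LinearMap.zero_apply, zero_mul, abs, neg_zero, sup_idem]⟩
  add_mem' := by
    rintro L L' ⟨g, hg⟩ ⟨g', hg'⟩
    refine ⟨g + g', fun v => ?_⟩
    rw [LinearMap.add_apply]
    have h1 := hg v
    have h2 := hg' v
    rw [← AEEqFun.coeFn_le] at h1 h2 ⊢
    filter_upwards [h1, h2, AEEqFun.coeFn_abs (L v), AEEqFun.coeFn_abs (L' v),
      AEEqFun.coeFn_abs (L v + L' v), AEEqFun.coeFn_add (L v) (L' v), AEEqFun.coeFn_add g g',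
      AEEqFun.coeFn_mul g (M.pnorm v), AEEqFun.coeFn_mul g' (M.pnorm v),
      AEEqFun.coeFn_mul (g + g') (M.pnorm v)] with x a1 a2 a3 a4 a5 a6 a7 a8 a9 a10
    simp only [Pi.add_apply, Pi.mul_apply] at *
    rw [a5, a6, a10, a7, add_mul, ← a8, ← a9]
    rw [a3] at a1
    rw [a4] at a2
    exact (abs_add_le _ _).trans (add_le_add a1 a2)
  smul_mem' := by
    rintro f L ⟨g, hg⟩
    refine ⟨|f| * g, fun v => ?_⟩
    rw [LinearMap.smul_apply, smul_eq_mul]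
    have h1 := hg v
    rw [← AEEqFun.coeFn_le] at h1 ⊢
    filter_upwards [h1, AEEqFun.coeFn_abs (L v), AEEqFun.coeFn_abs f,
      AEEqFun.coeFn_abs (f * L v), AEEqFun.coeFn_mul f (L v), AEEqFun.coeFn_mul |f| g,
      AEEqFun.coeFn_mul g (M.pnorm v),
      AEEqFun.coeFn_mul (|f| * g) (M.pnorm v)] with x a1 a2 a3 a4 a5 a6 a7 a8
    simp only [Pi.mul_apply] at *
    rw [a4, a5, a8, a6, abs_mul, a3, mul_assoc, ← a7]
    rw [a2] at a1
    exact mul_le_mul_of_nonneg_left a1 (abs_nonneg _)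

/-- The dual `M*`, with pointwise norm `|L| = ess sup {|L v| : |v| ≤ 1}`. -/
def dual {X : Type u} [MeasurableSpace X] {m : Measure X} (M : PNModule.{u, w} m) :
    PNModule.{u, max u w} m where
  carrier := M.dualSubmodule
  pnorm L := essSupOf {h | ∃ v : M, M.pnorm v ≤ 1 ∧ h = |L.1 v|}

/-- The extension `Ext(M)` of an `L⁰(m|_E)`-normed module `M`: the same set, `f ∈ L⁰(m)` acting as
`proj f`, and with pointwise norm `ext(|v|)`. -/
def Ext {X : Type u} [MeasurableSpace X] {m : Measure X} {E : Set X} (hE : MeasurableSet E)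
    (M : PNModule.{u, w} (m.restrict E)) : PNModule.{u, w} m :=
  letI : Module (L0 m) M.carrier := Module.compHom M.carrier (proj m E)
  { carrier := M.carrier
    pnorm := fun v => extL0 hE (M.pnorm v) }

end PNModule

/-- A pullback `(φ^* N, [φ^*])` of an `L⁰(μ)`-normed module `N` along `φ` with `φ_* ν ≪ μ`. -/
structure PullbackModule {X : Type u} {Y : Type v} [MeasurableSpace X] [MeasurableSpace Y]
    {ν : Measure X} {μ : Measure Y} {φ : X → Y} (hφ : Measure.QuasiMeasurePreserving φ ν μ)
    (N : PNModule.{v, w₁} μ) where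
  /-- the module `φ^* N` -/
  M : PNModule.{u, w₂} ν
  isL0Normed : M.IsL0Normed
  /-- the pullback map `[φ^*]` -/
  map : N → M
  map_add : ∀ a b : N, map (a + b) = map a + map b
  map_smul : ∀ (c : ℝ) (a : N),
    map ((AEEqFun.const Y c : L0 μ) • a) = (AEEqFun.const X c : L0 ν) • map a
  continuous : PNModule.ContinuousMap N M map
  pnorm_map : ∀ a : N, M.pnorm (map a) = compHom hφ (N.pnorm a)
  generates : M.Generates (Set.range map)

/-! ## Real-valued Sobolev functions -/

section Sobolev

/-- The asymptotic Lipschitz constant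
`lip_a f (x) = limsup_{y, z → x} |f y - f z| / d(y, z)`. As `0 / 0 = 0` in `ℝ≥0∞`, pairs with
`y = z` do not contribute and the value at an isolated point is `0`. -/
def lipa {X : Type u} [MetricSpace X] (f : X → ℝ) (x : X) : ℝ≥0∞ :=
  limsup (fun p : X × X => edist (f p.1) (f p.2) / edist p.1 p.2) (𝓝 (x, x))

/-- Functions which are Lipschitz on bounded sets. -/
def LipBd {X : Type u} [MetricSpace X] (f : X → ℝ) : Prop :=
  ∀ B : Set X, Bornology.IsBounded B → ∃ K : ℝ≥0, LipschitzOnWith K f B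

/-- `G ∈ L²(m)` is the weak `L²`-limit of `lip_a (f n)` for some sequence of functions `f n`,
Lipschitz on bounded sets, converging to `f` in `L⁰(m)`. -/
def IsRelaxedGradient {X : Type u} [MetricSpace X] [MeasurableSpace X] {m : Measure X}
    (f G : L0 m) : Prop :=
  MemLp G 2 m ∧ ∃ fn : ℕ → X → ℝ, (∀ n, LipBd (fn n)) ∧ TendstoL0 m fn f ∧
    (∀ n, MemLp (fun x => (lipa (fn n) x).toReal) 2 m) ∧
    ∀ φ : X → ℝ, MemLp φ 2 m →
      Tendsto (fun n => ∫ x, (lipa (fn n) x).toReal * φ x ∂m) atTop (𝓝 (∫ x, G x * φ x ∂m))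

/-- The Sobolev class `S²(X, d, m)`. -/
def S2 {X : Type u} [MetricSpace X] [MeasurableSpace X] (m : Measure X) : Set (L0 m) :=
  {f | ∃ G : L0 m, IsRelaxedGradient f G}

/-- The minimal weak upper gradient `|Df|`. -/
def wug {X : Type u} [MetricSpace X] [MeasurableSpace X] {m : Measure X} (f : L0 m) : L0 m :=
  leastOf {G : L0 m | IsRelaxedGradient f G}

/-- A cotangent module `(L⁰(T^*X), d)` of `(X, d, m)`; `map_comb` is linearity of `d` on the
vector space `S²(X)`. -/
structure CotangentModule {X : Type u} [MetricSpace X] [MeasurableSpace X] (m : Measure X) where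
  /-- the module `L⁰(T^*X)` -/
  M : PNModule.{u, w} m
  isL0Normed : M.IsL0Normed
  /-- the differential -/
  d : S2 m → M
  map_comb : ∀ (a b : ℝ) (f g h : S2 m), (h : L0 m) = a • (f : L0 m) + b • (g : L0 m) →
    d h = (AEEqFun.const X a : L0 m) • d f + (AEEqFun.const X b : L0 m) • d g
  pnorm_d : ∀ f : S2 m, M.pnorm (d f) = wug (f : L0 m)
  generates : M.Generates (Set.range d)

/-- The tangent module `L⁰(TX)`, dual of the cotangent module. -/
def CotangentModule.tangent {X : Type u} [MetricSpace X] [MeasurableSpace X] {m : Measure X}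
    (C : CotangentModule.{u, w} m) : PNModule.{u, max u w} m :=
  C.M.dual

end Sobolev

/-! ## Metric-valued Sobolev maps -/

section Maps

variable {X : Type u} {Y : Type v} [MetricSpace X] [MeasurableSpace X]
  [MetricSpace Y] [MeasurableSpace Y] [BorelSpace Y]

/-- For `u` Borel and `f` Lipschitz, the class of `f ∘ u` in `L⁰(m)`. -/
def compLip (m : Measure X) {u : X → Y} (hu : Measurable u) {f : Y → ℝ} {K : ℝ≥0}
    (hf : LipschitzWith K f) : L0 m :=
  AEEqFun.mk (f ∘ u) (hf.continuous.measurable.comp hu).aestronglyMeasurable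

/-- The functions `G ∈ L²(m)`, `G ≥ 0`, such that for every Lipschitz `f : Y → ℝ` one has
`f ∘ u ∈ S²(X)` and `|d(f ∘ u)| ≤ Lip(f) G` a.e. -/
def upperGradients (m : Measure X) (u : X → Y) : Set (L0 m) :=
  {G | MemLp G 2 m ∧ 0 ≤ G ∧ ∃ hu : Measurable u, ∀ (f : Y → ℝ) (K : ℝ≥0)
    (hf : LipschitzWith K f),
      compLip m hu hf ∈ S2 m ∧ wug (compLip m hu hf) ≤ (K : ℝ) • G}

/-- The class `S²(X, Y)`. -/
structure IsSobolevMap (m : Measure X) (u : X → Y) : Prop where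
  measurable : Measurable u
  essSeparable : ∃ N : Set X, m N = 0 ∧ TopologicalSpace.IsSeparable (u '' Nᶜ)
  exists_upperGradient : (upperGradients m u).Nonempty

/-- `|Du|`, the least `G` as in the definition of `S²(X, Y)`. -/
def mapGrad (m : Measure X) (u : X → Y) : L0 m := leastOf (upperGradients m u)

/-- `μ = u_*(|Du|² m)`. -/
def targetMeasure (m : Measure X) (u : X → Y) : Measure Y :=
  (m.withDensity fun x => ENNReal.ofReal (mapGrad m u x ^ 2)).map u

/-- The set `{|Du| > 0}`. -/
def posSet (m : Measure X) (u : X → Y) : Set X := {x | 0 < mapGrad m u x}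

theorem measurableSet_posSet (m : Measure X) (u : X → Y) : MeasurableSet (posSet m u) :=
  measurableSet_lt measurable_const (mapGrad m u).measurable

/-- `u_*(m|_{|Du| > 0}) ≪ μ`. -/
theorem quasiMeasurePreserving_posSet (m : Measure X) {u : X → Y} (hu : Measurable u) :
    Measure.QuasiMeasurePreserving u (m.restrict (posSet m u)) (targetMeasure m u) := by
  refine ⟨hu, Measure.AbsolutelyContinuous.mk fun s hs h => ?_⟩
  rw [targetMeasure, Measure.map_apply hu hs, withDensity_apply _ (hu hs),
    lintegral_eq_zero_iff (by fun_prop)] at h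
  rw [Measure.map_apply hu hs]
  have h' := (ae_restrict_iff' (hu hs)).1 h
  rw [Measure.restrict_apply (hu hs)]
  refine measure_mono_null ?_ h'
  rintro x ⟨hx, hx'⟩ hc
  have := hc hx
  simp only [Pi.zero_apply, ENNReal.ofReal_eq_zero] at this
  have hpos : 0 < mapGrad m u x := hx'
  exact absurd this (not_le.2 (pow_pos hpos 2))

/-- `g` represents `f ∘ u`: one has `g = f ∘ u` a.e. on `{|Du| > 0}` and
`|dg| ≤ |d_μ f| ∘ u |Du|` a.e. -/
def IsComposition (m : Measure X) (u : X → Y) (f : S2 (targetMeasure m u)) (g : S2 m) : Prop :=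
  (∀ᵐ x ∂m, 0 < mapGrad m u x → (g : L0 m) x = (f : L0 (targetMeasure m u)) (u x)) ∧
  ∀ᵐ x ∂m, wug (g : L0 m) x ≤ wug (f : L0 (targetMeasure m u)) (u x) * mapGrad m u x

/-- The module `Ext((u^* L⁰_μ(T^*Y))^*)`. -/
abbrev diffTarget {m : Measure X} {u : X → Y} (hu : Measurable u)
    {CY : CotangentModule.{v, w₂} (targetMeasure m u)}
    (P : PullbackModule.{u, v, w₂, w₃} (quasiMeasurePreserving_posSet m hu) CY.M) :
    PNModule.{u, max u w₃} m :=
  P.M.dual.Ext (measurableSet_posSet m u)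

/-- `W ∈ Ext((u^* L⁰_μ(T^*Y))^*)` satisfies the relation characterizing `du(V)`: for all
`f ∈ S²(Y, d_Y, μ)` and all `g ∈ S²(X)` representing `f ∘ u`,
`ext([u^* d_μ f])(W) = dg(V)`, where `ext(w)(ext(L)) = ext(L(w))`. -/
def IsDifferentialAt {m : Measure X} {u : X → Y} (hu : Measurable u)
    (C : CotangentModule.{u, w₁} m) {CY : CotangentModule.{v, w₂} (targetMeasure m u)}
    (P : PullbackModule.{u, v, w₂, w₃} (quasiMeasurePreserving_posSet m hu) CY.M)
    (V : C.tangent) (W : diffTarget hu P) : Prop :=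
  let L : P.M.dualSubmodule := W
  let V' : C.M.dualSubmodule := V
  ∀ (f : S2 (targetMeasure m u)) (g : S2 m), IsComposition m u f g →
    extL0 (measurableSet_posSet m u) (L.1 (P.map (CY.d f))) = V'.1 (C.d g)

end Maps

end MetricSobolev

end

open MetricSobolev

noncomputable section

namespace MetricSobolev

/-! ## Order and completeness properties of `L⁰` -/

section OrderL0

variable {X : Type u} [MeasurableSpace X] {m : Measure X}

/-! Fix `V` in `L⁰(TX)`. If `g` represents `f ∘ u`, then `|V(dg)| ≤ |V| |Dg| ≤ |V| |Du| |Df| ∘ u`,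
and on `{|Du| > 0}` the last factor is the pointwise norm of `[u^* d f]`. Hence `[u^* d f] ↦ V(dg)`
is dominated by `|V| |Du|` times the norm. A Hahn–Banach theorem with values in `L⁰` extends it to a
functional on the whole pullback, which is `du(V)`, with `|du(V)| ≤ |V| |Du|`. Uniqueness holds
because the `[u^* d f]` generate, and linearity and continuity follow from uniqueness and the bound.
That `dg` depends only on `f` is locality: representatives agree where `|Du| > 0` and have zero
differential elsewhere (`d_eq_of_isLift`).

For the lower bound on `|du|`, let `h` bound all `|du(V)|` with `|V| ≤ 1`, and let `f` be
`K`-Lipschitz with `g` representing `f ∘ u`. For a `V` norming `dg`, `|Dg| = V(dg) ≤ |du(V)| |Df| ∘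
u ≤ K h`. So `h ⊓ |Du|` is again an upper gradient of `u`, and minimality of `|Du|` gives `|Du| ≤
h`.

The analytic core is the existence of representatives (`exists_isWeakBound`). Everything on the
Sobolev side is done with `IsWeakBound`, in which a bound for `lip_a` of the approximants converges
strongly in `L²`; Mazur's lemma and the parallelogram law show that it has the same least element as
the class of relaxed gradients. This notion has simple calculus rules, and bounds can be glued along
Borel sets, so a least one exists. For Lipschitz `h` on `Y`, covering by small balls gives `|D(h ∘
u)| ≤ lip_a h ∘ u |Du|`. For general `f` the approximants are composed with `arctan` to make them
bounded, a limit is extracted by convex combinations (off `{|Du| > 0}` no convergence is available),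
and `tan` undoes the truncation. The choice `μ = u_*(|Du|² m)` makes `g ↦ g ∘ u |Du|` an isometry of
`L²(μ)` into `L²(m)`, which transports the convergence of the bounds.

The cotangent and pullback modules come from one construction, `exists_generated`: a real vector
space with an `L⁰`-valued seminorm is mapped into dominated families indexed by its dominated
functionals, and the closed `L⁰`-span of the image is taken. -/

theorem L0.le_iff {f g : L0 m} : f ≤ g ↔ ∀ᵐ x ∂m, f x ≤ g x := AEEqFun.coeFn_le.symm

instance L0.instIsOrderedRing : IsOrderedRing (L0 m) where
  add_le_add_left f g hfg h := by
    rw [L0.le_iff] at *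
    filter_upwards [hfg, AEEqFun.coeFn_add f h, AEEqFun.coeFn_add g h] with x h1 h2 h3
    rw [h2, h3]
    exact add_le_add_left h1 _
  zero_le_one := by
    rw [L0.le_iff]
    filter_upwards [AEEqFun.coeFn_zero (μ := m) (β := ℝ),
      AEEqFun.coeFn_one (μ := m) (β := ℝ)] with x h1 h2
    rw [h1, h2]
    simp
  mul_le_mul_of_nonneg_left f hf g h hgh := by
    rw [L0.le_iff] at *
    filter_upwards [hf, hgh, AEEqFun.coeFn_mul f g, AEEqFun.coeFn_mul f h,
      AEEqFun.coeFn_zero (μ := m) (β := ℝ)] with x h1 h2 h3 h4 h5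
    rw [h3, h4]
    rw [h5] at h1
    exact mul_le_mul_of_nonneg_left h2 h1
  mul_le_mul_of_nonneg_right f hf g h hgh := by
    rw [L0.le_iff] at *
    filter_upwards [hf, hgh, AEEqFun.coeFn_mul g f, AEEqFun.coeFn_mul h f,
      AEEqFun.coeFn_zero (μ := m) (β := ℝ)] with x h1 h2 h3 h4 h5
    rw [h3, h4]
    rw [h5] at h1
    exact mul_le_mul_of_nonneg_right h2 h1

theorem L0.abs_mul (f g : L0 m) : |f * g| = |f| * |g| := by
  refine AEEqFun.ext ?_
  filter_upwards [AEEqFun.coeFn_abs (f * g), AEEqFun.coeFn_abs f, AEEqFun.coeFn_abs g,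
    AEEqFun.coeFn_mul f g, AEEqFun.coeFn_mul |f| |g|] with x h1 h2 h3 h4 h5
  rw [h1, h4, h5, Pi.mul_apply, Pi.mul_apply, h2, h3]
  exact _root_.abs_mul _ _

theorem L0.nonneg_iff {f : L0 m} : 0 ≤ f ↔ ∀ᵐ x ∂m, 0 ≤ f x := by
  rw [L0.le_iff]
  constructor
  · intro h
    filter_upwards [h, AEEqFun.coeFn_zero (μ := m) (β := ℝ)] with x h1 h2
    rwa [h2] at h1
  · intro h
    filter_upwards [h, AEEqFun.coeFn_zero (μ := m) (β := ℝ)] with x h1 h2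
    rwa [h2]

theorem L0.const_smul_eq (c : ℝ) (f : L0 m) : (AEEqFun.const X c : L0 m) * f = c • f := by
  refine AEEqFun.ext ?_
  filter_upwards [AEEqFun.coeFn_mul (AEEqFun.const X c : L0 m) f, AEEqFun.coeFn_smul c f,
    AEEqFun.coeFn_const (μ := m) (α := X) c] with x h1 h2 h3
  rw [h1, h2, Pi.mul_apply, h3]
  rfl

/-- The constant functions, as a ring homomorphism. -/
def L0.constHom (m : Measure X) : ℝ →+* L0 m where
  toFun c := AEEqFun.const X c
  map_one' := rfl
  map_zero' := rfl
  map_mul' _ _ := rfl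
  map_add' _ _ := rfl

/-- A nonempty family in `L⁰` which is bounded above and closed under `⊔` has a least upper bound,
which is the a.e. limit of an increasing sequence in the family. -/
theorem L0.exists_isLUB_of_supClosed [SFinite m] {S : Set (L0 m)} (hne : S.Nonempty)
    (hbdd : BddAbove S) (hS : SupClosed S) :
    ∃ (g : L0 m) (f : ℕ → L0 m), IsLUB S g ∧ (∀ n, f n ∈ S) ∧ Monotone f ∧
      ∀ᵐ x ∂m, Tendsto (fun n => f n x) atTop (𝓝 (g x)) := by
  obtain ⟨b, hb⟩ := hbdd
  set ν := m.toFinite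
  have hae : ae ν = ae m := ae_toFinite
  have hac : ν ≪ m := toFinite_absolutelyContinuous m
  have hmeas : ∀ f : L0 m, AEStronglyMeasurable (fun x => Real.arctan (f x)) ν := fun f =>
    (Real.continuous_arctan.comp_aestronglyMeasurable f.aestronglyMeasurable).mono_ac hac
  have hpi : ∀ t : ℝ, ‖Real.arctan t‖ ≤ Real.pi / 2 := fun t => by
    rw [Real.norm_eq_abs, abs_le]
    exact ⟨(Real.neg_pi_div_two_lt_arctan t).le, (Real.arctan_lt_pi_div_two t).le⟩
  have hint : ∀ f : L0 m, Integrable (fun x => Real.arctan (f x)) ν := fun f =>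
    Integrable.of_bound (hmeas f) (Real.pi / 2) (Eventually.of_forall fun x => hpi _)
  set I : L0 m → ℝ := fun f => ∫ x, Real.arctan (f x) ∂ν
  have Imono : ∀ f g : L0 m, f ≤ g → I f ≤ I g := fun f g hfg => by
    refine integral_mono_ae (hint f) (hint g) ?_
    rw [EventuallyLE, hae]
    filter_upwards [L0.le_iff.1 hfg] with x hx
    exact Real.arctan_mono hx
  have Ibdd : BddAbove (I '' S) := by
    refine ⟨I b, ?_⟩
    rintro _ ⟨f, hf, rfl⟩
    exact Imono f b (hb hf)
  obtain ⟨s, hs_mono, hs_lim, hs_mem⟩ := exists_seq_tendsto_sSup (hne.image I) Ibdd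
  choose a haS haI using hs_mem
  set f : ℕ → L0 m := fun n => partialSups a n
  have hfS : ∀ n, f n ∈ S := by
    intro n
    induction n with
    | zero => simpa [f] using haS 0
    | succ k ih =>
      have : f (k + 1) = f k ⊔ a (k + 1) := partialSups_add_one a k
      rw [this]
      exact hS ih (haS _)
  have hfm : Monotone f := (partialSups a).monotone
  have hfI : Tendsto (fun n => I (f n)) atTop (𝓝 (sSup (I '' S))) := by
    refine tendsto_of_tendsto_of_tendsto_of_le_of_le hs_lim tendsto_const_nhds (fun n => ?_)
      (fun n => le_csSup Ibdd ⟨_, hfS n, rfl⟩)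
    change s n ≤ I (f n)
    rw [← haI n]
    exact Imono _ _ (le_partialSups a n)
  have hlim : ∀ᵐ x ∂m, ∃ l, Tendsto (fun n => f n x) atTop (𝓝 l) := by
    have h1 : ∀ᵐ x ∂m, ∀ n, f n x ≤ f (n + 1) x :=
      ae_all_iff.2 fun n => L0.le_iff.1 (hfm n.le_succ)
    have h2 : ∀ᵐ x ∂m, ∀ n, f n x ≤ b x := ae_all_iff.2 fun n => L0.le_iff.1 (hb (hfS n))
    filter_upwards [h1, h2] with x h1 h2
    exact ⟨_, tendsto_atTop_ciSup (monotone_nat_of_le_succ h1)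
      ⟨b x, Set.forall_mem_range.2 h2⟩⟩
  obtain ⟨g₀, hg₀m, hg₀⟩ := measurable_limit_of_tendsto_metrizable_ae
    (fun n => (f n).aestronglyMeasurable.aemeasurable) hlim
  set g : L0 m := AEEqFun.mk g₀ hg₀m.aestronglyMeasurable
  have hg : ∀ᵐ x ∂m, Tendsto (fun n => f n x) atTop (𝓝 (g x)) := by
    filter_upwards [hg₀, AEEqFun.coeFn_mk g₀ hg₀m.aestronglyMeasurable (μ := m)] with x h1 h2
    rw [h2]
    exact h1
  have hDCT : ∀ (F : ℕ → L0 m) (G : L0 m),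
      (∀ᵐ x ∂m, Tendsto (fun n => F n x) atTop (𝓝 (G x))) →
      Tendsto (fun n => I (F n)) atTop (𝓝 (I G)) := by
    intro F G hFG
    refine tendsto_integral_of_dominated_convergence (fun _ => Real.pi / 2) (fun n => hmeas _)
      (integrable_const _) (fun n => Eventually.of_forall fun x => hpi _) ?_
    rw [hae]
    filter_upwards [hFG] with x hx
    exact (Real.continuous_arctan.tendsto _).comp hx
  have hIg : I g = sSup (I '' S) := tendsto_nhds_unique (hDCT f g hg) hfI
  refine ⟨g, f, ⟨?_, ?_⟩, hfS, hfm, hg⟩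
  · intro h hh
    have hsup : Tendsto (fun n => I (f n ⊔ h)) atTop (𝓝 (I (g ⊔ h))) := by
      refine hDCT _ _ ?_
      have h1 : ∀ᵐ x ∂m, ∀ n, (f n ⊔ h : L0 m) x = f n x ⊔ h x :=
        ae_all_iff.2 fun n => AEEqFun.coeFn_sup (f n) h
      filter_upwards [hg, h1, AEEqFun.coeFn_sup g h] with x hx h1 h2
      simp only [h1, h2]
      exact hx.max tendsto_const_nhds
    -- Each `f n ⊔ h` stays in `S`, so `I` cannot exceed the supremum already attained by `g`; thus
    -- `g ⊔ h = g` a.e.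
    have hle : I (g ⊔ h) ≤ I g := by
      rw [hIg]
      exact le_of_tendsto' hsup fun n => le_csSup Ibdd ⟨_, hS (hfS n) hh, rfl⟩
    have hmono : (fun x => Real.arctan (g x)) ≤ᵐ[ν] fun x => Real.arctan ((g ⊔ h : L0 m) x) := by
      rw [EventuallyLE, hae]
      filter_upwards [L0.le_iff.1 (le_sup_left : g ≤ g ⊔ h)] with x hx
      exact Real.arctan_mono hx
    have heq := (integral_eq_iff_of_ae_le (hint g) (hint (g ⊔ h)) hmono).1
      (le_antisymm (Imono _ _ le_sup_left) hle)
    rw [EventuallyEq, hae] at heq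
    rw [L0.le_iff]
    filter_upwards [heq, L0.le_iff.1 (le_sup_right : h ≤ g ⊔ h)] with x h1 h2
    rwa [Real.arctan_injective h1]
  · intro c hc
    rw [L0.le_iff]
    have h1 : ∀ᵐ x ∂m, ∀ n, f n x ≤ c x := ae_all_iff.2 fun n => L0.le_iff.1 (hc (hfS n))
    filter_upwards [hg, h1] with x h1 h2
    exact le_of_tendsto' h1 h2

theorem L0.exists_isLUB [SFinite m] {S : Set (L0 m)} (hne : S.Nonempty) (hbdd : BddAbove S) :
    ∃ g, IsLUB S g := by
  obtain ⟨g, -, hg, -⟩ := L0.exists_isLUB_of_supClosed (hne.mono subset_supClosure)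
    (by rwa [BddAbove, upperBounds_supClosure]) (supClosed_supClosure (s := S))
  exact ⟨g, isLUB_supClosure.1 hg⟩

theorem L0.exists_isGLB [SFinite m] {S : Set (L0 m)} (hne : S.Nonempty) (hbdd : BddBelow S) :
    ∃ g, IsGLB S g := by
  obtain ⟨g, hg⟩ := L0.exists_isLUB (S := -S) hne.neg hbdd.neg
  exact ⟨-g, isLUB_neg.1 hg⟩

/-- A nonempty family in `L⁰` which is bounded below and closed under `⊓` has a greatest lower
bound, which is the a.e. limit of a decreasing sequence in the family. -/
theorem L0.exists_isGLB_of_infClosed [SFinite m] {S : Set (L0 m)} (hne : S.Nonempty)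
    (hbdd : BddBelow S) (hS : InfClosed S) :
    ∃ (g : L0 m) (f : ℕ → L0 m), IsGLB S g ∧ (∀ n, f n ∈ S) ∧ Antitone f ∧
      ∀ᵐ x ∂m, Tendsto (fun n => f n x) atTop (𝓝 (g x)) := by
  obtain ⟨g, f, hg, hf, hm, hlim⟩ := L0.exists_isLUB_of_supClosed (S := -S) hne.neg hbdd.neg
    (by
      intro a ha b hb
      change -(a ⊔ b) ∈ S
      rw [neg_sup]
      exact hS ha hb)
  refine ⟨-g, fun n => -f n, isLUB_neg.1 hg, fun n => hf n, fun i j hij => neg_le_neg (hm hij), ?_⟩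
  have h1 : ∀ᵐ x ∂m, ∀ n, (-f n : L0 m) x = -f n x := ae_all_iff.2 fun n => AEEqFun.coeFn_neg _
  filter_upwards [hlim, h1, AEEqFun.coeFn_neg g] with x h1 h2 h3
  simp only [h2, h3, Pi.neg_apply]
  exact h1.neg

theorem isLUB_essSupOf [SFinite m] {S : Set (L0 m)} (hne : S.Nonempty) (hbdd : BddAbove S) :
    IsLUB S (essSupOf S) := by
  obtain ⟨g, hg⟩ := L0.exists_isLUB hne hbdd
  rwa [essSupOf_eq hg]

theorem leastOf_isLeast {S : Set (L0 m)} (h : ∃ g, IsLeast S g) : IsLeast S (leastOf S) := by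
  obtain ⟨g, hg⟩ := h
  rwa [leastOf_eq hg]

end OrderL0


/-! ## The Hahn–Banach–Kantorovich theorem -/

section HahnBanach

variable {X : Type u} [MeasurableSpace X] {m : Measure X}

instance L0.instIsOrderedModule : IsOrderedModule ℝ (L0 m) where
  smul_le_smul_of_nonneg_left c hc f g hfg := by
    rw [L0.le_iff] at *
    filter_upwards [hfg, AEEqFun.coeFn_smul c f, AEEqFun.coeFn_smul c g] with x h1 h2 h3
    rw [h2, h3]
    exact mul_le_mul_of_nonneg_left h1 hc
  smul_le_smul_of_nonneg_right f hf c d hcd := by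
    rw [L0.nonneg_iff] at hf
    rw [L0.le_iff]
    filter_upwards [hf, AEEqFun.coeFn_smul c f, AEEqFun.coeFn_smul d f] with x h1 h2 h3
    rw [h2, h3]
    exact mul_le_mul_of_nonneg_right hcd h1

variable {V : Type v} [AddCommGroup V] [Module ℝ V]

/-- Sublinear maps from a real vector space into `L⁰`. -/
structure IsSublinear (p : V → L0 m) : Prop where
  map_zero_le : p 0 ≤ 0
  map_add_le : ∀ v w, p (v + w) ≤ p v + p w
  map_smul_le : ∀ (c : ℝ) (v : V), 0 < c → p (c • v) ≤ c • p v

namespace IsSublinear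

theorem map_zero {p : V → L0 m} (hp : IsSublinear p) : p 0 = 0 := by
  refine le_antisymm hp.map_zero_le ?_
  have h := hp.map_add_le 0 0
  rw [add_zero] at h
  exact le_add_iff_nonneg_left _ |>.1 h

theorem neg_map_neg_le {p : V → L0 m} (hp : IsSublinear p) (v : V) : -p (-v) ≤ p v := by
  have h := hp.map_add_le v (-v)
  rw [add_neg_cancel, hp.map_zero] at h
  exact neg_le_iff_add_nonneg.2 h

theorem map_smul {p : V → L0 m} (hp : IsSublinear p) {c : ℝ} (hc : 0 ≤ c) (v : V) :
    p (c • v) = c • p v := by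
  rcases hc.eq_or_lt with rfl | hc
  · rw [zero_smul, zero_smul, hp.map_zero]
  · refine le_antisymm (hp.map_smul_le c v hc) ?_
    have h := hp.map_smul_le c⁻¹ (c • v) (inv_pos.2 hc)
    rw [smul_smul, inv_mul_cancel₀ hc.ne', one_smul] at h
    have h' := smul_le_smul_of_nonneg_left h hc.le
    rwa [smul_smul, mul_inv_cancel₀ hc.ne', one_smul] at h'

/-- The infimal convolution of a sublinear map with a cone of prescribed lower bounds. -/
theorem exists_inf_cone [SFinite m] {p : V → L0 m} (hp : IsSublinear p) (K : Set (V × L0 m))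
    (h0 : (0, 0) ∈ K) (hadd : ∀ a ∈ K, ∀ b ∈ K, a + b ∈ K)
    (hsmul : ∀ (c : ℝ), 0 < c → ∀ a ∈ K, c • a ∈ K) (hK : ∀ a ∈ K, a.2 ≤ p a.1) :
    ∃ q : V → L0 m, IsSublinear q ∧ ∀ v, ∀ a ∈ K, q v ≤ p (v + a.1) - a.2 := by
  have hglb : ∀ v, ∃ g, IsGLB ((fun a : V × L0 m => p (v + a.1) - a.2) '' K) g := by
    intro v
    refine L0.exists_isGLB ⟨_, _, h0, rfl⟩ ⟨-p (-v), ?_⟩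
    rintro _ ⟨a, ha, rfl⟩
    have h1 : p a.1 ≤ p (v + a.1) + p (-v) := by
      have := hp.map_add_le (v + a.1) (-v)
      rwa [show v + a.1 + -v = a.1 by abel] at this
    have h2 := (hK a ha).trans h1
    change -p (-v) ≤ p (v + a.1) - a.2
    rw [neg_le_sub_iff_le_add]
    exact h2
  choose q hq using hglb
  have hle : ∀ v, ∀ a ∈ K, q v ≤ p (v + a.1) - a.2 := fun v a ha => (hq v).1 ⟨a, ha, rfl⟩
  refine ⟨q, ⟨?_, ?_, ?_⟩, hle⟩
  · simpa [hp.map_zero] using hle 0 _ h0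
  · intro v w
    have key : ∀ a ∈ K, ∀ b ∈ K, q (v + w) ≤ (p (v + a.1) - a.2) + (p (w + b.1) - b.2) := by
      intro a ha b hb
      refine (hle _ _ (hadd a ha b hb)).trans ?_
      have h1 := hp.map_add_le (v + a.1) (w + b.1)
      rw [show v + a.1 + (w + b.1) = v + w + (a + b).1 by simp only [Prod.fst_add]; abel] at h1
      rw [show p (v + a.1) - a.2 + (p (w + b.1) - b.2)
        = p (v + a.1) + p (w + b.1) - (a + b).2 by simp only [Prod.snd_add]; abel]
      exact sub_le_sub_right h1 _
    rw [← sub_le_iff_le_add]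
    refine (hq v).2 ?_
    rintro _ ⟨a, ha, rfl⟩
    rw [sub_le_comm]
    refine (hq w).2 ?_
    rintro _ ⟨b, hb, rfl⟩
    rw [sub_le_iff_le_add']
    exact key a ha b hb
  · intro c v hc
    have h : c⁻¹ • q (c • v) ≤ q v := by
      refine (hq v).2 ?_
      rintro _ ⟨a, ha, rfl⟩
      have h1 := hle (c • v) _ (hsmul c hc a ha)
      rw [Prod.smul_fst, Prod.smul_snd, ← smul_add, hp.map_smul hc.le, ← smul_sub] at h1
      have h2 := smul_le_smul_of_nonneg_left h1 (inv_pos.2 hc).le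
      rwa [smul_smul, inv_mul_cancel₀ hc.ne', one_smul] at h2
    have h2 := smul_le_smul_of_nonneg_left h hc.le
    rwa [smul_smul, mul_inv_cancel₀ hc.ne', one_smul] at h2

/-- Zorn's lemma in the order dual. The infimum of a chain exists because every member at `v` is at
least `-p (-v)`. It remains subadditive because, of two members of the chain, the smaller one can
serve for both arguments. -/
theorem exists_minimal [SFinite m] {p : V → L0 m} (hp : IsSublinear p) :
    ∃ q : V → L0 m, IsSublinear q ∧ q ≤ p ∧ ∀ r : V → L0 m, IsSublinear r → r ≤ q → r = q := by
  have hz := zorn_le₀ (α := (V → L0 m)ᵒᵈ)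
    {q | IsSublinear (OrderDual.ofDual q) ∧ OrderDual.ofDual q ≤ p} ?_
  · obtain ⟨q, ⟨hq, hqp⟩, hmax⟩ := hz
    refine ⟨OrderDual.ofDual q, hq, hqp, fun r hr hrq => le_antisymm hrq ?_⟩
    exact hmax (y := OrderDual.toDual r) ⟨hr, hrq.trans hqp⟩ hrq
  · intro c hc hchain
    rcases c.eq_empty_or_nonempty with rfl | hne
    · exact ⟨OrderDual.toDual p, ⟨hp, le_rfl⟩, fun z hz => absurd hz (Set.notMem_empty z)⟩
    have hglb : ∀ v, ∃ g,
        IsGLB ((fun q : (V → L0 m)ᵒᵈ => OrderDual.ofDual q v) '' c) g := by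
      intro v
      refine L0.exists_isGLB (hne.image _) ⟨-p (-v), ?_⟩
      rintro _ ⟨q, hq, rfl⟩
      exact (neg_le_neg ((hc hq).2 _)).trans ((hc hq).1.neg_map_neg_le v)
    choose r hr using hglb
    have hle : ∀ q ∈ c, ∀ v, r v ≤ OrderDual.ofDual q v := fun q hq v => (hr v).1 ⟨q, hq, rfl⟩
    obtain ⟨q₀, hq₀⟩ := hne
    refine ⟨OrderDual.toDual r, ⟨⟨?_, ?_, ?_⟩, fun v => (hle q₀ hq₀ v).trans ((hc hq₀).2 v)⟩,
      fun q hq => hle q hq⟩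
    · exact (hle q₀ hq₀ 0).trans (hc hq₀).1.map_zero_le
    · intro v w
      change r (v + w) ≤ r v + r w
      rw [← sub_le_iff_le_add]
      refine (hr v).2 ?_
      rintro _ ⟨a, ha, rfl⟩
      rw [sub_le_comm]
      refine (hr w).2 ?_
      rintro _ ⟨b, hb, rfl⟩
      rw [sub_le_iff_le_add']
      rcases hchain.total ha hb with h | h
      · exact (hle b hb _).trans (((hc hb).1.map_add_le v w).trans (add_le_add_left (h v) _))
      · exact (hle a ha _).trans (((hc ha).1.map_add_le v w).trans (add_le_add_right (h w) _))
    · intro s v hs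
      change r (s • v) ≤ s • r v
      have h : s⁻¹ • r (s • v) ≤ r v := by
        refine (hr v).2 ?_
        rintro _ ⟨a, ha, rfl⟩
        have h2 := smul_le_smul_of_nonneg_left
          ((hle a ha (s • v)).trans ((hc ha).1.map_smul_le s v hs)) (inv_pos.2 hs).le
        rwa [smul_smul, inv_mul_cancel₀ hs.ne', one_smul] at h2
      have h2 := smul_le_smul_of_nonneg_left h hs.le
      rwa [smul_smul, mul_inv_cancel₀ hs.ne', one_smul] at h2

/-- **Hahn–Banach–Kantorovich**: below a sublinear map with values in `L⁰` there is a linear one. -/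
theorem exists_linearMap_le [SFinite m] {p : V → L0 m} (hp : IsSublinear p) :
    ∃ L : V →ₗ[ℝ] L0 m, ∀ v, L v ≤ p v := by
  obtain ⟨q, hq, hqp, hmin⟩ := hp.exists_minimal
  have hsuper : ∀ v a, q v + q a ≤ q (v + a) := by
    intro v a
    -- The cone is the ray through `(a, q a)`. Taking `t = 0` shows `r ≤ q`, so minimality gives `r
    -- = q`; then `t = 1` reads `q v ≤ q (v + a) - q a`.
    obtain ⟨r, hr, hrK⟩ := hq.exists_inf_cone
      {b | ∃ t : ℝ, 0 ≤ t ∧ b = (t • a, t • q a)} ⟨0, le_rfl, by simp⟩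
      (by
        rintro _ ⟨s, hs, rfl⟩ _ ⟨t, ht, rfl⟩
        exact ⟨s + t, add_nonneg hs ht, by simp [add_smul]⟩)
      (by
        rintro c hc _ ⟨s, hs, rfl⟩
        exact ⟨c * s, mul_nonneg hc.le hs, by simp [mul_smul]⟩)
      (by
        rintro _ ⟨s, hs, rfl⟩
        exact (hq.map_smul hs a).ge)
    have hrq : r = q := hmin r hr fun v => by simpa using hrK v _ ⟨0, le_rfl, rfl⟩
    have h := hrK v _ ⟨1, zero_le_one, rfl⟩
    rw [hrq, one_smul, one_smul] at h
    exact le_sub_iff_add_le.1 h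
  have hadd : ∀ v a, q (v + a) = q v + q a := fun v a => le_antisymm (hq.map_add_le v a) (hsuper v a)
  have hneg : ∀ v, q (-v) = -q v := fun v => by
    rw [eq_neg_iff_add_eq_zero, ← hadd, neg_add_cancel, hq.map_zero]
  refine ⟨{ toFun := q, map_add' := hadd, map_smul' := fun c v => ?_ }, hqp⟩
  rcases le_total 0 c with hc | hc
  · exact hq.map_smul hc v
  · have h := hq.map_smul (neg_nonneg.2 hc) v
    rw [neg_smul, hneg, neg_smul, neg_inj] at h
    exact h

/-- **Hahn–Banach–Kantorovich**, extension form. -/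
theorem exists_linearMap_extension [SFinite m] {W : Type w} [AddCommGroup W] [Module ℝ W]
    {p : V → L0 m} (hp : IsSublinear p) (T : W →ₗ[ℝ] V) (S : W →ₗ[ℝ] L0 m)
    (hS : ∀ x, S x ≤ p (T x)) :
    ∃ L : V →ₗ[ℝ] L0 m, (∀ v, L v ≤ p v) ∧ ∀ x, L (T x) = S x := by
  obtain ⟨q, hq, hqK⟩ := hp.exists_inf_cone (Set.range fun x => (T x, S x))
    ⟨0, by simp⟩
    (by
      rintro _ ⟨x, rfl⟩ _ ⟨y, rfl⟩
      exact ⟨x + y, by simp⟩)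
    (by
      rintro c - _ ⟨x, rfl⟩
      exact ⟨c • x, by simp⟩)
    (by
      rintro _ ⟨x, rfl⟩
      exact hS x)
  obtain ⟨L, hL⟩ := hq.exists_linearMap_le
  -- The cone used is the graph of `S` over `T`. Evaluating at `-T x` against the element `(T x, S
  -- x)` leaves `p 0 - S x`. Since the graph is symmetric, the opposite inequality follows by
  -- replacing `x` with `-x`.
  have hLe : ∀ x, S x ≤ L (T x) := by
    intro x
    have h := (hL (-T x)).trans (hqK (-T x) _ ⟨x, rfl⟩)
    rw [neg_add_cancel, hp.map_zero, zero_sub, _root_.map_neg, neg_le_neg_iff] at h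
    exact h
  refine ⟨L, fun v => (hL v).trans ?_, fun x => le_antisymm ?_ (hLe x)⟩
  · have h := hqK v (T 0, S 0) ⟨0, rfl⟩
    simpa using h
  · have h := hLe (-x)
    rwa [_root_.map_neg, _root_.map_neg, _root_.map_neg, neg_le_neg_iff] at h

end IsSublinear

end HahnBanach


/-! ## Functionals on `L⁰`-normed modules -/

section Functionals

variable {X : Type u} [MeasurableSpace X] {m : Measure X}

theorem coeFn_compHom {Y : Type v} [MeasurableSpace Y]
    {μ : Measure Y} {φ : X → Y} (hφ : Measure.QuasiMeasurePreserving φ m μ) (f : L0 μ) :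
    ∀ᵐ x ∂m, compHom hφ f x = f (φ x) :=
  AEEqFun.coeFn_compQuasiMeasurePreserving f hφ

theorem compHom_mono {Y : Type v} [MeasurableSpace Y]
    {μ : Measure Y} {φ : X → Y} (hφ : Measure.QuasiMeasurePreserving φ m μ) {f g : L0 μ}
    (hfg : f ≤ g) : compHom hφ f ≤ compHom hφ g := by
  rw [L0.le_iff] at *
  filter_upwards [coeFn_compHom hφ f, coeFn_compHom hφ g, hφ.ae hfg] with x h1 h2 h3
  rwa [h1, h2]

/-- The pointwise inverse, with `0⁻¹ = 0`. -/
def L0.inv (f : L0 m) : L0 m := f.compMeasurable Inv.inv measurable_inv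

theorem L0.coeFn_inv (f : L0 m) : ∀ᵐ x ∂m, L0.inv f x = (f x)⁻¹ :=
  AEEqFun.coeFn_compMeasurable _ _ _

theorem L0.mul_inv_mul (f : L0 m) : f * (L0.inv f * f) = f := by
  refine AEEqFun.ext ?_
  filter_upwards [L0.coeFn_inv f, AEEqFun.coeFn_mul f (L0.inv f * f),
    AEEqFun.coeFn_mul (L0.inv f) f] with x h1 h2 h3
  rw [h2, Pi.mul_apply, h3, Pi.mul_apply, h1, ← mul_assoc]
  exact mul_inv_mul_cancel _

theorem L0.inv_mul_le_one (f : L0 m) : L0.inv f * f ≤ 1 := by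
  rw [L0.le_iff]
  filter_upwards [L0.coeFn_inv f, AEEqFun.coeFn_mul (L0.inv f) f,
    AEEqFun.coeFn_one (μ := m) (β := ℝ)] with x h1 h3 h4
  rw [h3, Pi.mul_apply, h1, h4, Pi.one_apply]
  exact _root_.inv_mul_le_one

theorem L0.inv_nonneg {f : L0 m} (hf : 0 ≤ f) : 0 ≤ L0.inv f := by
  rw [L0.nonneg_iff] at *
  filter_upwards [hf, L0.coeFn_inv f] with x h1 h2
  rw [h2]
  exact _root_.inv_nonneg.2 h1

theorem L0.abs_const (c : ℝ) :
    |(AEEqFun.const X c : L0 m)| = (AEEqFun.const X |c| : L0 m) := by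
  refine AEEqFun.ext ?_
  filter_upwards [AEEqFun.coeFn_abs (AEEqFun.const X c : L0 m),
    AEEqFun.coeFn_const (μ := m) (α := X) c, AEEqFun.coeFn_const (μ := m) (α := X) |c|]
    with x h1 h2 h3
  rw [h1, h2, h3]
  rfl

namespace PNModule

/-- The real vector space structure underlying an `L⁰`-module. -/
@[reducible] def realModule (M : PNModule.{u, w} m) : Module ℝ M :=
  Module.compHom M.carrier (L0.constHom m)

namespace IsL0Normed

variable {M : PNModule.{u, w} m}

theorem pnorm_zero (hM : M.IsL0Normed) : M.pnorm 0 = 0 := (hM.pnorm_eq_zero 0).2 rfl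

theorem pnorm_neg (hM : M.IsL0Normed) (v : M) : M.pnorm (-v) = M.pnorm v := by
  have h := hM.pnorm_smul (-1) v
  rwa [abs_neg, abs_of_nonneg (zero_le_one' (L0 m)), one_mul, neg_smul, one_smul] at h

theorem pnorm_sub_comm (hM : M.IsL0Normed) (v v' : M) : M.pnorm (v - v') = M.pnorm (v' - v) := by
  rw [← hM.pnorm_neg, neg_sub]

theorem pnorm_const_smul (hM : M.IsL0Normed) (c : ℝ) (v : M) :
    M.pnorm ((AEEqFun.const X c : L0 m) • v) = |c| • M.pnorm v := by
  rw [hM.pnorm_smul, L0.abs_const, L0.const_smul_eq]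

/-- Additive homogeneous maps from a normed module into some `L⁰`, bounded by the pointwise norm,
are compatible with the multiplication by `L⁰` functions. -/
theorem map_smul_of_bound {Y : Type v} [MeasurableSpace Y] {μ : Measure Y}
    {N : PNModule.{v, w} μ} (hN : N.IsL0Normed) {φ : X → Y}
    (hφ : Measure.QuasiMeasurePreserving φ m μ) (Φ : N → L0 m)
    (hadd : ∀ a b, Φ (a + b) = Φ a + Φ b)
    (hsmul : ∀ (c : ℝ) a, Φ ((AEEqFun.const Y c : L0 μ) • a) = c • Φ a)
    (k : L0 m) (hk : ∀ a, |Φ a| ≤ k * compHom hφ (N.pnorm a)) (h : L0 μ) (a : N) :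
    Φ (h • a) = compHom hφ h * Φ a := by
  -- Freezing `h` at a constant `t` costs at most a multiple of `|h - t|`. With `t` rational the
  -- null sets are countably many, so the estimate holds for all `t` at once off one null set. By
  -- density it extends to real `t`, and `t = h (φ x)` makes the error vanish.
  have hb : ∀ t : ℚ, ∀ᵐ x ∂m,
      |Φ (h • a) x - t * Φ a x| ≤ k x * (|h (φ x) - t| * N.pnorm a (φ x)) := by
    intro t
    set z : N := h • a - (AEEqFun.const Y (t : ℝ) : L0 μ) • a
    have hz : Φ (h • a) = Φ z + (t : ℝ) • Φ a := by
      rw [← hsmul, ← hadd, sub_add_cancel]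
    have hz' : z = (h - AEEqFun.const Y (t : ℝ)) • a := (sub_smul _ _ _).symm
    have hn : N.pnorm z = |h - AEEqFun.const Y (t : ℝ)| * N.pnorm a := by
      rw [hz', hN.pnorm_smul]
    have h1 : ∀ᵐ y ∂μ, N.pnorm z y = |h y - t| * N.pnorm a y := by
      rw [hn]
      filter_upwards [AEEqFun.coeFn_mul |h - AEEqFun.const Y (t : ℝ)| (N.pnorm a),
        AEEqFun.coeFn_abs (h - AEEqFun.const Y (t : ℝ)),
        AEEqFun.coeFn_sub h (AEEqFun.const Y (t : ℝ)),
        AEEqFun.coeFn_const (μ := μ) (α := Y) (t : ℝ)] with y h1 h2 h3 h4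
      rw [h1, Pi.mul_apply, h2, h3, Pi.sub_apply, h4]
      rfl
    filter_upwards [hφ.ae h1, L0.le_iff.1 (hk z), AEEqFun.coeFn_abs (Φ z),
      AEEqFun.coeFn_mul k (compHom hφ (N.pnorm z)), coeFn_compHom hφ (N.pnorm z),
      AEEqFun.coeFn_add (Φ z) ((t : ℝ) • Φ a), AEEqFun.coeFn_smul (t : ℝ) (Φ a)]
      with x a1 a2 a3 a4 a5 a6 a7
    rw [a3, a4, Pi.mul_apply, a5, a1] at a2
    rw [hz, a6, Pi.add_apply, a7, Pi.smul_apply, smul_eq_mul, add_sub_cancel_right]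
    exact a2
  refine AEEqFun.ext ?_
  filter_upwards [ae_all_iff.2 hb, AEEqFun.coeFn_mul (compHom hφ h) (Φ a),
    coeFn_compHom hφ h] with x h1 h2 h3
  rw [h2, Pi.mul_apply, h3]
  have hr : ∀ t : ℝ, |Φ (h • a) x - t * Φ a x| ≤ k x * (|h (φ x) - t| * N.pnorm a (φ x)) := by
    intro t
    refine Rat.denseRange_cast.induction_on
      (p := fun t : ℝ => |Φ (h • a) x - t * Φ a x| ≤ k x * (|h (φ x) - t| * N.pnorm a (φ x))) t
      (isClosed_le (by fun_prop) (by fun_prop)) h1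
  have := hr (h (φ x))
  rw [sub_self, abs_zero, zero_mul, mul_zero] at this
  exact sub_eq_zero.1 (abs_nonpos_iff.1 this)

/-- Extension of a dominated real-linear map to an `L⁰`-linear functional. -/
theorem exists_functional_extension [SFinite m] (hM : M.IsL0Normed) {W : Type v} [AddCommGroup W]
    [Module ℝ W] (T : W →+ M) (hT : ∀ (c : ℝ) x, T (c • x) = (AEEqFun.const X c : L0 m) • T x)
    (S : W →ₗ[ℝ] L0 m) {k : L0 m} (hk : 0 ≤ k) (hS : ∀ x, |S x| ≤ k * M.pnorm (T x)) :
    ∃ L : M →ₗ[L0 m] L0 m, (∀ v, |L v| ≤ k * M.pnorm v) ∧ ∀ x, L (T x) = S x := by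
  let := M.realModule
  have hp : IsSublinear (fun v : M => k * M.pnorm v) := by
    refine ⟨?_, fun v v' => ?_, fun c v hc => ?_⟩
    · simp only [hM.pnorm_zero, mul_zero, le_refl]
    · rw [← mul_add]
      exact mul_le_mul_of_nonneg_left (hM.pnorm_add_le v v') hk
    · have h : M.pnorm (c • v) = c • M.pnorm v := by
        have := hM.pnorm_const_smul c v
        rwa [abs_of_pos hc] at this
      rw [h, ← L0.const_smul_eq, ← L0.const_smul_eq, mul_left_comm]
  obtain ⟨L, hL, hLT⟩ := hp.exists_linearMap_extension
    { toFun := T, map_add' := map_add T, map_smul' := hT } S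
    (fun x => (le_abs_self _).trans (hS x))
  have hb : ∀ v, |L v| ≤ k * M.pnorm v := by
    intro v
    refine abs_le'.2 ⟨hL v, ?_⟩
    have h := hL (-v)
    rwa [map_neg, hM.pnorm_neg] at h
  have hcomp : ∀ f : L0 m, compHom (Measure.QuasiMeasurePreserving.id m) f = f := fun f =>
    AEEqFun.compQuasiMeasurePreserving_id f
  refine ⟨{ toFun := L, map_add' := map_add L, map_smul' := fun f v => ?_ }, hb, hLT⟩
  have h := hM.map_smul_of_bound (Measure.QuasiMeasurePreserving.id m) L (map_add L)
    (fun c a => L.map_smul c a) k (fun a => by rw [hcomp]; exact hb a) f v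
  rw [hcomp] at h
  exact h

/-- Every element of a normed module is normed by a functional. -/
theorem exists_norming [SFinite m] (hM : M.IsL0Normed) (v₀ : M) :
    ∃ L : M →ₗ[L0 m] L0 m, (∀ v, |L v| ≤ M.pnorm v) ∧ L v₀ = M.pnorm v₀ := by
  obtain ⟨L, hL, hL₀⟩ := hM.exists_functional_extension
    (W := ℝ)
    { toFun := fun t => (AEEqFun.const X t : L0 m) • v₀
      map_zero' := by
        change (0 : L0 m) • v₀ = 0
        rw [zero_smul]
      map_add' := fun s t => by
        change ((AEEqFun.const X s : L0 m) + (AEEqFun.const X t : L0 m)) • v₀ = _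
        rw [add_smul] }
    (fun c t => by
      change ((AEEqFun.const X c : L0 m) * (AEEqFun.const X t : L0 m)) • v₀ = _
      rw [mul_smul]; rfl)
    (LinearMap.toSpanSingleton ℝ (L0 m) (M.pnorm v₀)) (zero_le_one' (L0 m))
    (fun t => by
      rw [one_mul, LinearMap.toSpanSingleton_apply]
      change _ ≤ M.pnorm ((AEEqFun.const X t : L0 m) • v₀)
      rw [hM.pnorm_smul, ← L0.const_smul_eq, L0.abs_mul, abs_of_nonneg (hM.pnorm_nonneg v₀)])
  refine ⟨L, fun v => by simpa using hL v, ?_⟩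
  have h := hL₀ 1
  rw [LinearMap.toSpanSingleton_apply, one_smul] at h
  rw [← h]
  change L v₀ = L ((1 : L0 m) • v₀)
  rw [one_smul]

theorem isLUB_dual_pnorm [SFinite m] (hM : M.IsL0Normed) (L : M.dualSubmodule) :
    IsLUB {h | ∃ v : M, M.pnorm v ≤ 1 ∧ h = |L.1 v|} (M.dual.pnorm L) := by
  obtain ⟨g, hg⟩ := L.2
  refine isLUB_essSupOf ⟨_, 0, by rw [hM.pnorm_zero]; exact zero_le_one, rfl⟩ ⟨|g|, ?_⟩
  rintro _ ⟨v, hv, rfl⟩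
  calc |L.1 v| ≤ g * M.pnorm v := hg v
    _ ≤ |g| * M.pnorm v := mul_le_mul_of_nonneg_right (le_abs_self g) (hM.pnorm_nonneg v)
    _ ≤ |g| * 1 := mul_le_mul_of_nonneg_left hv (abs_nonneg g)
    _ = |g| := mul_one _

theorem dual_pnorm_nonneg [SFinite m] (hM : M.IsL0Normed) (L : M.dualSubmodule) :
    0 ≤ M.dual.pnorm L :=
  (abs_nonneg (L.1 0)).trans
    ((hM.isLUB_dual_pnorm L).1 ⟨0, by rw [hM.pnorm_zero]; exact zero_le_one, rfl⟩)

/-- The element `v` is its norm times a normalized element of the unit ball, also where the norm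
vanishes: there `0⁻¹ = 0`, and both sides of the factorization are zero. -/
theorem abs_apply_le [SFinite m] (hM : M.IsL0Normed) (L : M.dualSubmodule) (v : M) :
    |L.1 v| ≤ M.dual.pnorm L * M.pnorm v := by
  set r := M.pnorm v
  have hr : 0 ≤ r := hM.pnorm_nonneg v
  have hv : v = r • (L0.inv r • v) := by
    rw [← sub_eq_zero, ← hM.pnorm_eq_zero]
    have : v - r • (L0.inv r • v) = (1 - r * L0.inv r) • v := by
      rw [sub_smul, one_smul, mul_smul]
    rw [this, hM.pnorm_smul]
    change |1 - r * L0.inv r| * r = 0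
    have h0 : (1 - r * L0.inv r) * r = 0 := by
      rw [sub_mul, one_mul, mul_assoc, L0.mul_inv_mul, sub_self]
    calc |1 - r * L0.inv r| * r = |(1 - r * L0.inv r) * r| := by rw [L0.abs_mul, abs_of_nonneg hr]
      _ = 0 := by rw [h0, abs_zero]
  have h1 : M.pnorm (L0.inv r • v) ≤ 1 := by
    rw [hM.pnorm_smul, abs_of_nonneg (L0.inv_nonneg hr)]
    exact L0.inv_mul_le_one r
  have h2 := (hM.isLUB_dual_pnorm L).1 ⟨_, h1, rfl⟩
  calc |L.1 v| = |L.1 (r • (L0.inv r • v))| := by rw [← hv]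
    _ = |L.1 (L0.inv r • v)| * r := by
      rw [map_smul L.1, smul_eq_mul, L0.abs_mul, abs_of_nonneg hr, mul_comm]
    _ ≤ _ := mul_le_mul_of_nonneg_right h2 hr

theorem dual_pnorm_le [SFinite m] (hM : M.IsL0Normed) (L : M.dualSubmodule) {k : L0 m} (hk : 0 ≤ k)
    (h : ∀ v, |L.1 v| ≤ k * M.pnorm v) : M.dual.pnorm L ≤ k := by
  refine (hM.isLUB_dual_pnorm L).2 ?_
  rintro _ ⟨v, hv, rfl⟩
  refine (h v).trans ?_
  simpa using mul_le_mul_of_nonneg_left hv hk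

end IsL0Normed

end PNModule

end Functionals


/-! ## A metric for the convergence in `L⁰` -/

section Rho

variable {X : Type u} [MeasurableSpace X] {m : Measure X}

/-- The integral of `min 1 |f|` against a finite measure equivalent to `m`. -/
def rho (m : Measure X) [SFinite m] (f : X → ℝ) : ℝ≥0∞ := ∫⁻ x, min 1 ‖f x‖ₑ ∂m.toFinite

section SFinite

variable [SFinite m]

theorem rho_mono {f g : X → ℝ} (h : ∀ᵐ x ∂m, |f x| ≤ |g x|) : rho m f ≤ rho m g := by
  refine lintegral_mono_ae ?_
  rw [ae_toFinite]
  filter_upwards [h] with x hx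
  refine min_le_min le_rfl ?_
  rw [← ofReal_norm, ← ofReal_norm]
  exact ENNReal.ofReal_le_ofReal hx

theorem rho_congr {f g : X → ℝ} (h : f =ᵐ[m] g) : rho m f = rho m g := by
  refine lintegral_congr_ae ?_
  rw [EventuallyEq, ae_toFinite]
  filter_upwards [h] with x hx
  rw [hx]

theorem aemeasurable_rho_integrand {f : X → ℝ} (hf : AEStronglyMeasurable f m) :
    AEMeasurable (fun x => min 1 ‖f x‖ₑ) m.toFinite :=
  aemeasurable_const.min (hf.mono_ac (toFinite_absolutelyContinuous m)).enorm

theorem rho_add_le {f g : X → ℝ} (hf : AEStronglyMeasurable f m) :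
    rho m (fun x => f x + g x) ≤ rho m f + rho m g := by
  rw [rho, rho, rho, ← lintegral_add_left' (aemeasurable_rho_integrand hf)]
  refine lintegral_mono fun x => ?_
  refine (min_le_min le_rfl (enorm_add_le _ _)).trans ?_
  rcases le_total 1 ‖f x‖ₑ with h | h
  · rw [min_eq_left h]
    exact (min_le_left _ _).trans le_self_add
  rcases le_total 1 ‖g x‖ₑ with h' | h'
  · rw [min_eq_left h']
    exact (min_le_left _ _).trans le_add_self
  · rw [min_eq_right h, min_eq_right h']
    exact min_le_right _ _

@[simp] theorem rho_zero : rho m (fun _ => 0) = 0 := by simp [rho]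

theorem tendsto_rho_of_ae {f : ℕ → X → ℝ} (hf : ∀ n, AEStronglyMeasurable (f n) m)
    (h : ∀ᵐ x ∂m, Tendsto (fun n => f n x) atTop (𝓝 0)) :
    Tendsto (fun n => rho m (f n)) atTop (𝓝 0) := by
  have h0 : ∫⁻ _, (0 : ℝ≥0∞) ∂m.toFinite = 0 := lintegral_zero
  rw [← h0]
  refine tendsto_lintegral_of_dominated_convergence' (fun _ => 1)
    (fun n => aemeasurable_rho_integrand (hf n))
    (fun n => Eventually.of_forall fun x => min_le_left _ _) ?_ ?_
  · rw [lintegral_one]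
    exact measure_ne_top _ _
  · rw [ae_toFinite]
    filter_upwards [h] with x hx
    have h1 : Tendsto (fun n => ‖f n x‖ₑ) atTop (𝓝 0) := by
      have := (continuous_enorm.tendsto (0 : ℝ)).comp hx
      rwa [enorm_zero] at this
    have h2 : Tendsto (fun n => min 1 ‖f n x‖ₑ) atTop (𝓝 (min 1 0)) :=
      tendsto_const_nhds.min h1
    rwa [min_eq_right zero_le_one] at h2

/-- Integrating the series shows that the truncations `min 1 |f n|` are a.e. summable. Their terms
are then eventually below `1`, so the truncation is inactive from some index on. -/
theorem ae_summable_of_tsum_rho {f : ℕ → X → ℝ} (hf : ∀ n, AEStronglyMeasurable (f n) m)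
    (h : ∑' n, rho m (f n) ≠ ∞) : ∀ᵐ x ∂m, ∑' n, ‖f n x‖ₑ ≠ ∞ := by
  unfold rho at h
  rw [← lintegral_tsum fun n => aemeasurable_rho_integrand (hf n)] at h
  have h1 := ae_lt_top' (AEMeasurable.tsum fun n => aemeasurable_rho_integrand (hf n)) h
  rw [ae_toFinite] at h1
  filter_upwards [h1] with x hx
  have hx' := hx.ne
  have hlim := ENNReal.tendsto_atTop_zero_of_tsum_ne_top hx'
  obtain ⟨N, hN⟩ := (hlim.eventually_lt_const zero_lt_one).exists_forall_of_atTop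
  rw [← ENNReal.summable.sum_add_tsum_nat_add' (k := N)]
  rw [← ENNReal.summable.sum_add_tsum_nat_add' (k := N)] at hx'
  refine ENNReal.add_ne_top.2 ⟨?_, ?_⟩
  · exact (ENNReal.sum_lt_top.2 fun i _ => enorm_lt_top).ne
  · convert (ENNReal.add_ne_top.1 hx').2 using 3 with i
    have := hN (i + N) (Nat.le_add_left _ _)
    rcases min_lt_iff.1 this with h | h
    · exact absurd h (lt_irrefl _)
    · exact (min_eq_right h.le).symm

theorem exists_subseq_ae_of_rho {f : ℕ → X → ℝ} (hf : ∀ n, AEStronglyMeasurable (f n) m)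
    (h : Tendsto (fun n => rho m (f n)) atTop (𝓝 0)) :
    ∃ φ : ℕ → ℕ, StrictMono φ ∧ ∀ᵐ x ∂m, Tendsto (fun n => f (φ n) x) atTop (𝓝 0) := by
  obtain ⟨ε, hε, hsum⟩ := ENNReal.exists_pos_sum_of_countable' one_ne_zero ℕ
  obtain ⟨φ, hφ, hφε⟩ := extraction_forall_of_eventually
    (P := fun n k => rho m (f k) < ε n)
    (fun n => h.eventually_lt_const (hε n))
  refine ⟨φ, hφ, ?_⟩
  have h1 : ∑' n, rho m (f (φ n)) ≠ ∞ :=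
    ((ENNReal.tsum_le_tsum fun n => (hφε n).le).trans_lt (hsum.trans ENNReal.one_lt_top)).ne
  filter_upwards [ae_summable_of_tsum_rho (fun n => hf (φ n)) h1] with x hx
  have h2 := ENNReal.tendsto_atTop_zero_of_tsum_ne_top hx
  exact tendsto_zero_iff_enorm_tendsto_zero.2 h2

theorem tendsto_rho_mul {f : ℕ → X → ℝ} (hf : ∀ n, AEStronglyMeasurable (f n) m)
    {k : X → ℝ} (hk : AEStronglyMeasurable k m) (h : Tendsto (fun n => rho m (f n)) atTop (𝓝 0)) :
    Tendsto (fun n => rho m (fun x => k x * f n x)) atTop (𝓝 0) := by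
  refine tendsto_of_subseq_tendsto fun ns hns => ?_
  obtain ⟨φ, hφ, hlim⟩ := exists_subseq_ae_of_rho (fun n => hf (ns n)) (h.comp hns)
  refine ⟨φ, tendsto_rho_of_ae (fun n => hk.mul (hf _)) ?_⟩
  filter_upwards [hlim] with x hx
  simpa using hx.const_mul (k x)

end SFinite

/-- The `α`-measure is the integral of the density `dα/dβ`, which has finite total integral, over
sets of vanishing `β`-measure. -/
theorem tendsto_measure_of_absolutelyContinuous {α β : Measure X} [IsFiniteMeasure α]
    [SigmaFinite β] (hαβ : α ≪ β) {ι : Type*} {l : Filter ι} {s : ι → Set X}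
    (h : Tendsto (fun i => β (s i)) l (𝓝 0)) : Tendsto (fun i => α (s i)) l (𝓝 0) := by
  have h1 := tendsto_setLIntegral_zero (μ := β) (f := α.rnDeriv β)
    ((Measure.lintegral_rnDeriv_lt_top α β).ne) (s := s) h
  refine tendsto_of_tendsto_of_tendsto_of_le_of_le tendsto_const_nhds h1 (fun i => zero_le) ?_
  intro i
  exact (Measure.setLIntegral_rnDeriv hαβ (s i)).ge

/-- Local convergence in measure to zero is convergence to zero of `rho`. -/
theorem tendsto_rho_iff [SigmaFinite m] {ι : Type*} {l : Filter ι} {F : ι → X → ℝ}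
    (hF : ∀ i, AEStronglyMeasurable (F i) m) :
    (∀ A : Set X, MeasurableSet A → m A < ∞ → ∀ ε : ℝ, 0 < ε →
      Tendsto (fun i => m.restrict A {x | ε ≤ |F i x|}) l (𝓝 0)) ↔
    Tendsto (fun i => rho m (F i)) l (𝓝 0) := by
  have hset : ∀ (ε : ℝ) i, {x | ε ≤ |F i x|} = {x | ENNReal.ofReal ε ≤ ‖F i x‖ₑ} := by
    intro ε i
    ext x
    simp only [Set.mem_ofPred_eq]
    rw [← ofReal_norm, Real.norm_eq_abs, ENNReal.ofReal_le_ofReal_iff (abs_nonneg _)]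
  set ν := m.toFinite
  have hνm : ν ≪ m := toFinite_absolutelyContinuous m
  have hmν : m ≪ ν := absolutelyContinuous_toFinite m
  constructor
  · intro h
    -- All but `η / 2` of the finite measure `ν` lies in one spanning set. That set has finite
    -- `m`-measure, so local convergence in measure applies to it.
    have hν : ∀ ε : ℝ, 0 < ε → Tendsto (fun i => ν {x | ε ≤ |F i x|}) l (𝓝 0) := by
      intro ε hε
      rw [ENNReal.tendsto_nhds_zero]
      intro η hη
      have hlim : Tendsto (fun n => ν (spanningSets m n)ᶜ) atTop (𝓝 0) := by
        have := tendsto_measure_iInter_atTop (μ := ν) (s := fun n => (spanningSets m n)ᶜ)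
          (fun n => (measurableSet_spanningSets m n).compl.nullMeasurableSet)
          (fun i j hij => Set.compl_subset_compl.2 (monotone_spanningSets m hij))
          ⟨0, measure_ne_top _ _⟩
        rwa [← Set.compl_iUnion, iUnion_spanningSets, Set.compl_univ, measure_empty] at this
      have hη2 : 0 < η / 2 := ENNReal.half_pos hη.ne'
      obtain ⟨k, hk⟩ := (hlim.eventually_lt_const hη2).exists
      have h1 := tendsto_measure_of_absolutelyContinuous
        (Measure.AbsolutelyContinuous.restrict hνm (spanningSets m k))
        (h _ (measurableSet_spanningSets m k) (measure_spanningSets_lt_top m k) ε hε)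
      filter_upwards [h1.eventually_lt_const hη2] with i hi
      calc ν {x | ε ≤ |F i x|}
          ≤ ν ({x | ε ≤ |F i x|} ∩ spanningSets m k) + ν ({x | ε ≤ |F i x|} \ spanningSets m k) :=
            measure_le_inter_add_sdiff _ _ _
        _ ≤ η / 2 + η / 2 := by
            refine add_le_add ?_ ?_
            · rw [← Measure.restrict_apply' (measurableSet_spanningSets m k)]
              exact hi.le
            · exact (measure_mono fun x hx => hx.2).trans hk.le
        _ = η := ENNReal.add_halves η
    rw [ENNReal.tendsto_nhds_zero]
    intro η hη
    obtain ⟨δ, hδ, hδη⟩ : ∃ δ : ℝ, 0 < δ ∧ ENNReal.ofReal δ * ν Set.univ ≤ η / 2 := by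
      have hlim : Tendsto (fun δ : ℝ => ENNReal.ofReal δ * ν Set.univ) (𝓝[>] 0) (𝓝 0) := by
        have h2 : Tendsto (fun δ : ℝ => ENNReal.ofReal δ) (𝓝[>] 0) (𝓝 (ENNReal.ofReal 0)) :=
          (ENNReal.continuous_ofReal.tendsto 0).mono_left nhdsWithin_le_nhds
        have h3 := ENNReal.Tendsto.mul_const (b := ν Set.univ) h2 (Or.inr (measure_ne_top _ _))
        simpa using h3
      obtain ⟨δ, h1, h2⟩ := ((hlim.eventually_lt_const (ENNReal.half_pos hη.ne')).and
        self_mem_nhdsWithin).exists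
      exact ⟨δ, h2, h1.le⟩
    filter_upwards [(hν δ hδ).eventually_lt_const (ENNReal.half_pos hη.ne')] with i hi
    have hSm : NullMeasurableSet {x | δ ≤ |F i x|} ν := by
      rw [hset]
      exact nullMeasurableSet_le aemeasurable_const ((hF i).mono_ac hνm).enorm
    have hle : rho m (F i) ≤ ∫⁻ x, ENNReal.ofReal δ + {x | δ ≤ |F i x|}.indicator 1 x ∂ν := by
      refine lintegral_mono fun x => ?_
      by_cases hx : δ ≤ |F i x|
      · rw [Set.indicator_of_mem (show x ∈ {x | δ ≤ |F i x|} from hx)]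
        exact (min_le_left _ _).trans le_add_self
      · refine (min_le_right _ _).trans (le_trans ?_ le_self_add)
        rw [← ofReal_norm, Real.norm_eq_abs]
        exact ENNReal.ofReal_le_ofReal (not_le.1 hx).le
    refine hle.trans ?_
    rw [lintegral_add_left measurable_const, lintegral_const, lintegral_indicator_one₀ hSm,
      ← ENNReal.add_halves η]
    exact add_le_add hδη hi.le
  · intro h A hA hmA ε hε
    have : IsFiniteMeasure (m.restrict A) := ⟨by rwa [Measure.restrict_apply_univ]⟩
    refine tendsto_measure_of_absolutelyContinuous (β := ν)
      ((Measure.absolutelyContinuous_of_le Measure.restrict_le_self).trans hmν) ?_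
    have hε1 : 0 < min 1 (ENNReal.ofReal ε) := lt_min zero_lt_one (ENNReal.ofReal_pos.2 hε)
    have hε2 : min 1 (ENNReal.ofReal ε) ≠ ∞ := (min_le_left _ _).trans_lt ENNReal.one_lt_top |>.ne
    have h1 : Tendsto (fun i => rho m (F i) / min 1 (ENNReal.ofReal ε)) l (𝓝 0) := by
      have := ENNReal.Tendsto.div_const h (b := min 1 (ENNReal.ofReal ε)) (Or.inr hε1.ne')
      rwa [ENNReal.zero_div] at this
    refine tendsto_of_tendsto_of_tendsto_of_le_of_le tendsto_const_nhds h1 (fun i => zero_le) ?_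
    intro i
    change ν {x | ε ≤ |F i x|} ≤ rho m (F i) / min 1 (ENNReal.ofReal ε)
    rw [ENNReal.le_div_iff_mul_le (Or.inl hε1.ne') (Or.inl hε2), mul_comm]
    refine le_trans ?_ (mul_meas_ge_le_lintegral₀ (aemeasurable_rho_integrand (hF i))
      (min 1 (ENNReal.ofReal ε)))
    gcongr
    intro hx
    rw [← ofReal_norm, Real.norm_eq_abs]
    exact min_le_min le_rfl (ENNReal.ofReal_le_ofReal hx)

theorem tendstoL0_iff [SigmaFinite m] {f : ℕ → X → ℝ} {g : X → ℝ}
    (hf : ∀ n, AEStronglyMeasurable (f n) m) (hg : AEStronglyMeasurable g m) :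
    TendstoL0 m f g ↔ Tendsto (fun n => rho m (fun x => f n x - g x)) atTop (𝓝 0) := by
  rw [← tendsto_rho_iff (F := fun n x => f n x - g x) fun n => (hf n).sub hg]
  simp only [TendstoL0, tendstoInMeasure_iff_norm, Real.norm_eq_abs]

end Rho


/-! ## Construction of `L⁰`-normed modules -/

section Construction

variable {X : Type u} [MeasurableSpace X] {m : Measure X}

namespace PNModule

/-- The axioms of an `L⁰`-normed module other than completeness. -/
structure IsPreNormed (M : PNModule.{u, w} m) : Prop where
  pnorm_nonneg : ∀ v : M, 0 ≤ M.pnorm v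
  pnorm_eq_zero : ∀ v : M, M.pnorm v = 0 ↔ v = 0
  pnorm_add_le : ∀ v v' : M, M.pnorm (v + v') ≤ M.pnorm v + M.pnorm v'
  pnorm_smul : ∀ (f : L0 m) (v : M), M.pnorm (f • v) = |f| * M.pnorm v

theorem IsL0Normed.isPreNormed {M : PNModule.{u, w} m} (hM : M.IsL0Normed) : M.IsPreNormed :=
  ⟨hM.pnorm_nonneg, hM.pnorm_eq_zero, hM.pnorm_add_le, hM.pnorm_smul⟩

theorem converges_iff [SigmaFinite m] {M : PNModule.{u, w} m} {v : ℕ → M} {v₀ : M} :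
    M.Converges v v₀ ↔ Tendsto (fun n => rho m (M.pnorm (v n - v₀))) atTop (𝓝 0) := by
  rw [Converges, tendstoL0_iff (fun n => AEEqFun.aestronglyMeasurable _)
    aestronglyMeasurable_const]
  simp only [sub_zero]

namespace IsPreNormed

variable {M : PNModule.{u, w} m}

theorem pnorm_sub_comm (hM : M.IsPreNormed) (v v' : M) : M.pnorm (v - v') = M.pnorm (v' - v) := by
  have h := hM.pnorm_smul (-1) (v' - v)
  rwa [abs_neg, abs_of_nonneg (zero_le_one' (L0 m)), one_mul, neg_smul, one_smul, neg_sub] at h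

theorem isCauchy_iff [SigmaFinite m] (hM : M.IsPreNormed) {v : ℕ → M} :
    M.IsCauchy v ↔
      Tendsto (fun p : ℕ × ℕ => rho m (M.pnorm (v p.1 - v p.2))) atTop (𝓝 0) := by
  rw [← tendsto_rho_iff fun p => AEEqFun.aestronglyMeasurable _]
  have h : ∀ (A : Set X) (ε : ℝ) (p : ℕ × ℕ), m.restrict A {x | ε ≤ |M.pnorm (v p.1 - v p.2) x|}
      = m.restrict A {x | ε ≤ M.pnorm (v p.1 - v p.2) x} := by
    intro A ε p
    refine measure_congr ?_
    filter_upwards [ae_restrict_of_ae (L0.nonneg_iff.1 (hM.pnorm_nonneg (v p.1 - v p.2)))]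
      with x hx
    change (ε ≤ |_|) = (ε ≤ _)
    rw [abs_of_nonneg hx]
  simp only [h]
  rfl

theorem rho_triangle [SFinite m] (hM : M.IsPreNormed) (a b c : M) :
    rho m (M.pnorm (a - c)) ≤ rho m (M.pnorm (a - b)) + rho m (M.pnorm (b - c)) := by
  refine le_trans ?_ (rho_add_le (AEEqFun.aestronglyMeasurable _))
  refine rho_mono ?_
  have h : M.pnorm (a - c) ≤ M.pnorm (a - b) + M.pnorm (b - c) := by
    have := hM.pnorm_add_le (a - b) (b - c)
    rwa [sub_add_sub_cancel] at this
  filter_upwards [L0.le_iff.1 h, L0.nonneg_iff.1 (hM.pnorm_nonneg (a - c)),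
    AEEqFun.coeFn_add (M.pnorm (a - b)) (M.pnorm (b - c))] with x h1 h2 h3
  rw [h3] at h1
  rw [abs_of_nonneg h2]
  exact h1.trans (le_abs_self _)

/-- The extended pseudo-distance inducing the topology of a normed module. -/
@[reducible] def pseudoEMetricSpace [SFinite m] (hM : M.IsPreNormed) : PseudoEMetricSpace M where
  edist v v' := rho m (M.pnorm (v - v'))
  edist_self v := by
    have h : M.pnorm (v - v) = 0 := (hM.pnorm_eq_zero _).2 (sub_self v)
    rw [h, rho_congr AEEqFun.coeFn_zero]
    exact rho_zero
  edist_comm v v' := by rw [hM.pnorm_sub_comm]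
  edist_triangle := hM.rho_triangle

/-- To prove completeness, it suffices to find limits of rapidly Cauchy sequences. -/
theorem isL0Normed_of_controlled [SigmaFinite m] (hM : M.IsPreNormed)
    (H : ∀ v : ℕ → M, ∑' n, rho m (M.pnorm (v (n + 1) - v n)) ≠ ∞ → ∃ v₀, M.Converges v v₀) :
    M.IsL0Normed := by
  let := hM.pseudoEMetricSpace
  have hcomp : CompleteSpace M := by
    obtain ⟨ε, hε, hsum⟩ := ENNReal.exists_pos_sum_of_countable' one_ne_zero ℕ
    refine EMetric.complete_of_convergent_controlled_sequences ε hε fun v hv => ?_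
    obtain ⟨v₀, hv₀⟩ := H v (ne_top_of_le_ne_top (hsum.trans ENNReal.one_lt_top).ne
      (ENNReal.tsum_le_tsum fun n => (hv n (n + 1) n n.le_succ le_rfl).le))
    exact ⟨v₀, tendsto_iff_edist_tendsto_0.2 (converges_iff.1 hv₀)⟩
  refine ⟨hM.pnorm_nonneg, hM.pnorm_eq_zero, hM.pnorm_add_le, hM.pnorm_smul, fun v hv => ?_⟩
  have hc : CauchySeq v := by
    rw [EMetric.cauchySeq_iff]
    intro ε hε
    obtain ⟨p, hp⟩ := (((hM.isCauchy_iff).1 hv).eventually_lt_const hε).exists_forall_of_atTop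
    refine ⟨max p.1 p.2, fun i hi j hj => hp (i, j) ⟨?_, ?_⟩⟩
    · exact (le_max_left _ _).trans hi
    · exact (le_max_right _ _).trans hj
  obtain ⟨v₀, hv₀⟩ := cauchySeq_tendsto_of_complete hc
  exact ⟨v₀, converges_iff.2 (tendsto_iff_edist_tendsto_0.1 hv₀)⟩

end IsPreNormed

/-- Families in `L⁰` which are dominated by one element of `L⁰`. -/
def boundedFamilies (ι : Type v) (m : Measure X) : Submodule (L0 m) (ι → L0 m) where
  carrier := {F | ∃ g : L0 m, ∀ i, |F i| ≤ g}
  zero_mem' := ⟨0, fun i => by rw [Pi.zero_apply, abs_zero]⟩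
  add_mem' := by
    rintro F F' ⟨g, hg⟩ ⟨g', hg'⟩
    exact ⟨g + g', fun i => (abs_add_le _ _).trans (add_le_add (hg i) (hg' i))⟩
  smul_mem' := by
    rintro f F ⟨g, hg⟩
    refine ⟨|f| * g, fun i => ?_⟩
    rw [Pi.smul_apply, smul_eq_mul, L0.abs_mul]
    exact mul_le_mul_of_nonneg_left (hg i) (abs_nonneg f)

/-- The module of dominated families in `L⁰`, with the supremum norm. -/
def boundedModule (ι : Type v) (m : Measure X) : PNModule.{u, max u v} m where
  carrier := boundedFamilies ι m
  pnorm F := essSupOf (Set.range fun i => |F.1 i|)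

section BoundedModule

variable {ι : Type v} [Nonempty ι]

theorem isLUB_boundedModule_pnorm [SFinite m] (F : boundedFamilies ι m) :
    IsLUB (Set.range fun i => |F.1 i|) ((boundedModule ι m).pnorm F) := by
  obtain ⟨g, hg⟩ := F.2
  exact isLUB_essSupOf (Set.range_nonempty _) ⟨g, Set.forall_mem_range.2 hg⟩

theorem isPreNormed_boundedModule [SFinite m] : (boundedModule ι m).IsPreNormed where
  pnorm_nonneg F := by
    obtain ⟨i⟩ := ‹Nonempty ι›
    exact (abs_nonneg _).trans ((isLUB_boundedModule_pnorm F).1 ⟨i, rfl⟩)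
  pnorm_eq_zero F := by
    constructor
    · intro h
      refine Subtype.ext (funext fun i => ?_)
      have h1 := (isLUB_boundedModule_pnorm F).1 ⟨i, rfl⟩
      rw [h] at h1
      have h2 : |F.1 i| = 0 := le_antisymm h1 (abs_nonneg _)
      exact le_antisymm ((le_abs_self (F.1 i)).trans h2.le)
        (neg_nonpos.1 ((neg_le_abs (F.1 i)).trans h2.le))
    · rintro rfl
      refine (isLUB_boundedModule_pnorm (0 : boundedFamilies ι m)).unique ?_
      have : (Set.range fun i => |(0 : boundedFamilies ι m).1 i|) = {0} := by
        ext g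
        simp
      rw [this]
      exact isLUB_singleton
  pnorm_add_le F F' := by
    refine (isLUB_boundedModule_pnorm _).2 ?_
    rintro _ ⟨i, rfl⟩
    exact (abs_add_le _ _).trans (add_le_add ((isLUB_boundedModule_pnorm F).1 ⟨i, rfl⟩)
      ((isLUB_boundedModule_pnorm F').1 ⟨i, rfl⟩))
  pnorm_smul f F := by
    have hval : ∀ i, |(f • F : boundedFamilies ι m).1 i| = |f| * |F.1 i| := fun i =>
      L0.abs_mul f (F.1 i)
    set P := (boundedModule ι m).pnorm F
    refine le_antisymm ((isLUB_boundedModule_pnorm _).2 ?_) ?_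
    · rintro _ ⟨i, rfl⟩
      change |(f • F : boundedFamilies ι m).1 i| ≤ _
      rw [hval]
      exact mul_le_mul_of_nonneg_left ((isLUB_boundedModule_pnorm F).1 ⟨i, rfl⟩) (abs_nonneg f)
    · set h := (boundedModule ι m).pnorm (f • F)
      set r := L0.inv |f|
      have hr : 0 ≤ r := L0.inv_nonneg (abs_nonneg f)
      have hr1 : 0 ≤ 1 - r * |f| := sub_nonneg.2 (L0.inv_mul_le_one _)
      -- For the reverse inequality: where `f ≠ 0`, `r` inverts `|f|` and the first term bounds the
      -- family; where `f = 0`, the weight is `1` and `P` bounds it trivially. Multiplication by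
      -- `|f|` then removes the second term.
      have hP : P ≤ r * h + (1 - r * |f|) * P := by
        refine (isLUB_boundedModule_pnorm F).2 ?_
        rintro _ ⟨i, rfl⟩
        have h1 : |f| * |F.1 i| ≤ h := by
          rw [← hval]
          exact (isLUB_boundedModule_pnorm (f • F)).1 ⟨i, rfl⟩
        have h2 : |F.1 i| ≤ P := (isLUB_boundedModule_pnorm F).1 ⟨i, rfl⟩
        calc |F.1 i| = r * (|f| * |F.1 i|) + (1 - r * |f|) * |F.1 i| := by ring
          _ ≤ _ := add_le_add (mul_le_mul_of_nonneg_left h1 hr)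
            (mul_le_mul_of_nonneg_left h2 hr1)
      have h0 : 0 ≤ h := by
        obtain ⟨i⟩ := ‹Nonempty ι›
        exact (abs_nonneg _).trans ((isLUB_boundedModule_pnorm (f • F)).1 ⟨i, rfl⟩)
      calc |f| * P ≤ |f| * (r * h + (1 - r * |f|) * P) :=
            mul_le_mul_of_nonneg_left hP (abs_nonneg f)
        _ = r * |f| * h + (|f| - |f| * (r * |f|)) * P := by ring
        _ = r * |f| * h := by rw [L0.mul_inv_mul, sub_self, zero_mul, add_zero]
        _ ≤ 1 * h := mul_le_mul_of_nonneg_right (L0.inv_mul_le_one _) h0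
        _ = h := one_mul h

/-- The index set may be uncountable, so exceptional null sets cannot be united over `i`. Each
component is therefore treated alone, while the tails `R n` of the series of increments, which do
not involve `i`, bound all components in the a.e. order. -/
theorem exists_limit_boundedFamilies [SigmaFinite m] (V : ℕ → boundedFamilies ι m)
    (hv : ∑' n, rho m ((boundedModule ι m).pnorm (V (n + 1) - V n)) ≠ ∞) :
    ∃ F : boundedFamilies ι m,
      Tendsto (fun n => rho m ((boundedModule ι m).pnorm (V n - F))) atTop (𝓝 0) := by
  obtain ⟨r, hr'⟩ : ∃ r : ℕ → L0 m, ∀ n, (boundedModule ι m).pnorm (V (n + 1) - V n) = r n :=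
    ⟨_, fun n => rfl⟩
  simp only [hr'] at hv
  have hr : ∀ᵐ x ∂m, ∑' n, ‖r n x‖ₑ ≠ ∞ :=
    ae_summable_of_tsum_rho (fun n => (r n).aestronglyMeasurable) hv
  have hV : ∀ i, ∀ᵐ x ∂m, ∀ n, dist ((V n).1 i x) ((V (n + 1)).1 i x) ≤ |r n x| := by
    intro i
    rw [ae_all_iff]
    intro n
    have h1 : |(V (n + 1) - V n).1 i| ≤ r n := by
      rw [← hr']
      exact (isLUB_boundedModule_pnorm (V (n + 1) - V n)).1 ⟨i, rfl⟩
    have h2 : (V (n + 1) - V n).1 i = (V (n + 1)).1 i - (V n).1 i := rfl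
    rw [h2] at h1
    filter_upwards [L0.le_iff.1 h1, AEEqFun.coeFn_abs ((V (n + 1)).1 i - (V n).1 i),
      AEEqFun.coeFn_sub ((V (n + 1)).1 i) ((V n).1 i)] with x a1 a2 a3
    rw [a2, a3] at a1
    rw [dist_comm, Real.dist_eq]
    exact a1.trans (le_abs_self _)
  have hsummable : ∀ᵐ x ∂m, Summable fun n => |r n x| := by
    filter_upwards [hr] with x hx
    have := ENNReal.summable_toReal hx
    simpa using this
  set R₀ : ℕ → X → ℝ := fun n x => (∑' k, ‖r (n + k) x‖ₑ).toReal
  have hRm : ∀ n, Measurable (R₀ n) := fun n =>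
    (Measurable.tsum fun k => (r (n + k)).measurable.enorm).ennreal_toReal
  have hReq : ∀ n x, R₀ n x = ∑' k, |r (n + k) x| := by
    intro n x
    rw [show R₀ n x = (∑' k, ‖r (n + k) x‖ₑ).toReal from rfl,
      ENNReal.tsum_toReal_eq fun k => enorm_ne_top]
    simp
  obtain ⟨R, hR⟩ : ∃ R : ℕ → L0 m, ∀ n, ∀ᵐ x ∂m, R n x = R₀ n x :=
    ⟨fun n => AEEqFun.mk (R₀ n) (hRm n).aestronglyMeasurable, fun n => AEEqFun.coeFn_mk _ _⟩
  have hlim : ∀ i, ∃ F : L0 m, ∀ᵐ x ∂m, Tendsto (fun n => (V n).1 i x) atTop (𝓝 (F x)) := by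
    intro i
    obtain ⟨F, hFm, hF⟩ := measurable_limit_of_tendsto_metrizable_ae (μ := m)
      (f := fun n => ((V n).1 i : X → ℝ)) (L := atTop)
      (fun n => ((V n).1 i).aestronglyMeasurable.aemeasurable) (by
        filter_upwards [hV i, hsummable] with x h1 h2
        exact cauchySeq_tendsto_of_complete (cauchySeq_of_dist_le_of_summable _ h1 h2))
    refine ⟨AEEqFun.mk F hFm.aestronglyMeasurable, ?_⟩
    filter_upwards [hF, AEEqFun.coeFn_mk F hFm.aestronglyMeasurable (μ := m)] with x h1 h2
    rw [h2]
    exact h1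
  choose F hF using hlim
  have hbound : ∀ i n, |(V n).1 i - F i| ≤ R n := by
    intro i n
    rw [L0.le_iff]
    filter_upwards [hF i, hV i, hsummable, hR n, AEEqFun.coeFn_abs ((V n).1 i - F i),
      AEEqFun.coeFn_sub ((V n).1 i) (F i)] with x h1 h2 h3 h4 h5 h6
    rw [h5, h6, h4, hReq, Pi.sub_apply, ← Real.dist_eq]
    exact dist_le_tsum_of_dist_le_of_tendsto _ h2 h3 h1 n
  have hFmem : F ∈ boundedFamilies ι m := by
    obtain ⟨g, hg⟩ := (V 0).2
    refine ⟨g + R 0, fun i => ?_⟩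
    calc |F i| = |(V 0).1 i - ((V 0).1 i - F i)| := by rw [sub_sub_cancel]
      _ ≤ |(V 0).1 i| + |(V 0).1 i - F i| := by
        rw [sub_eq_add_neg, ← abs_neg ((V 0).1 i - F i)]
        exact abs_add_le _ _
      _ ≤ g + R 0 := add_le_add (hg i) (hbound i 0)
  obtain ⟨G, hG⟩ : ∃ G : boundedFamilies ι m, G.1 = F := ⟨⟨F, hFmem⟩, rfl⟩
  have hle : ∀ n, (boundedModule ι m).pnorm (V n - G) ≤ R n := by
    intro n
    have hl := isLUB_boundedModule_pnorm (V n - G)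
    refine hl.2 ?_
    rintro _ ⟨i, rfl⟩
    have h1 : (V n - G).1 i = (V n).1 i - G.1 i := rfl
    beta_reduce
    rw [h1, hG]
    exact hbound i n
  have hnn : ∀ n, 0 ≤ (boundedModule ι m).pnorm (V n - G) :=
    fun n => isPreNormed_boundedModule.pnorm_nonneg _
  have hR0 : Tendsto (fun n => rho m (R n)) atTop (𝓝 0) := by
    refine tendsto_rho_of_ae (fun n => (R n).aestronglyMeasurable) ?_
    filter_upwards [ae_all_iff.2 hR, hsummable] with x h1 h2
    simp only [h1, hReq]
    have := tendsto_sum_nat_add fun n => |r n x|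
    simpa only [add_comm] using this
  refine ⟨G, tendsto_of_tendsto_of_tendsto_of_le_of_le tendsto_const_nhds hR0 (fun i => zero_le)
    fun n => rho_mono ?_⟩
  filter_upwards [L0.le_iff.1 (hle n), L0.nonneg_iff.1 (hnn n)] with x h1 h2
  rw [abs_of_nonneg h2]
  exact h1.trans (le_abs_self _)

theorem isL0Normed_boundedModule [SigmaFinite m] : (boundedModule ι m).IsL0Normed := by
  refine isPreNormed_boundedModule.isL0Normed_of_controlled fun v hv => ?_
  obtain ⟨F, hF⟩ := exists_limit_boundedFamilies v hv
  exact ⟨F, converges_iff.2 hF⟩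

end BoundedModule

namespace IsL0Normed

variable {M : PNModule.{u, w} m}

theorem converges_add [SigmaFinite m] (hM : M.IsL0Normed) {a b : ℕ → M} {a₀ b₀ : M}
    (ha : M.Converges a a₀) (hb : M.Converges b b₀) :
    M.Converges (fun n => a n + b n) (a₀ + b₀) := by
  rw [converges_iff] at *
  have h := ha.add hb
  rw [add_zero] at h
  refine tendsto_of_tendsto_of_tendsto_of_le_of_le tendsto_const_nhds h (fun i => zero_le)
    fun n => ?_
  have h1 := hM.isPreNormed.rho_triangle (a n + b n) (a₀ + b n) (a₀ + b₀)
  rwa [add_sub_add_right_eq_sub, add_sub_add_left_eq_sub] at h1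

theorem converges_smul [SigmaFinite m] (hM : M.IsL0Normed) (f : L0 m) {a : ℕ → M} {a₀ : M}
    (ha : M.Converges a a₀) : M.Converges (fun n => f • a n) (f • a₀) := by
  rw [converges_iff] at *
  have h := tendsto_rho_mul (fun n => AEEqFun.aestronglyMeasurable _) f.aestronglyMeasurable ha
  refine h.congr fun n => le_antisymm (rho_mono ?_) (rho_mono ?_) <;>
  · rw [← smul_sub, hM.pnorm_smul]
    filter_upwards [AEEqFun.coeFn_mul |f| (M.pnorm (a n - a₀)), AEEqFun.coeFn_abs f] with x h1 h2
    rw [h1, Pi.mul_apply, h2]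
    simp only [_root_.abs_mul, abs_abs, le_refl]

/-- The closure of the `L⁰`-span of a subset of a normed module. -/
def closedSpan [SigmaFinite m] (hM : M.IsL0Normed) (S : Set M) : Submodule (L0 m) M where
  carrier := {w | ∃ s : ℕ → M, (∀ n, s n ∈ Submodule.span (L0 m) S) ∧ M.Converges s w}
  zero_mem' := ⟨fun _ => 0, fun _ => zero_mem _, by
    rw [converges_iff, sub_zero, hM.pnorm_zero, rho_congr AEEqFun.coeFn_zero]
    change Tendsto (fun _ => rho m fun _ => 0) atTop (𝓝 0)
    rw [rho_zero]
    exact tendsto_const_nhds⟩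
  add_mem' := by
    rintro a b ⟨s, hs, hsa⟩ ⟨t, ht, htb⟩
    exact ⟨fun n => s n + t n, fun n => add_mem (hs n) (ht n), hM.converges_add hsa htb⟩
  smul_mem' := by
    rintro f a ⟨s, hs, hsa⟩
    exact ⟨fun n => f • s n, fun n => Submodule.smul_mem _ _ (hs n), hM.converges_smul f hsa⟩

theorem converges_const [SigmaFinite m] (hM : M.IsL0Normed) (a : M) :
    M.Converges (fun _ => a) a := by
  rw [converges_iff, sub_self, hM.pnorm_zero, rho_congr AEEqFun.coeFn_zero]
  change Tendsto (fun _ => rho m fun _ => 0) atTop (𝓝 0)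
  rw [rho_zero]
  exact tendsto_const_nhds

theorem subset_closedSpan [SigmaFinite m] (hM : M.IsL0Normed) (S : Set M) :
    Submodule.span (L0 m) S ≤ hM.closedSpan S := fun a ha =>
  ⟨fun _ => a, fun _ => ha, hM.converges_const a⟩

/-- The closed span of a subset, as a normed module. -/
def closedSpanModule [SigmaFinite m] (hM : M.IsL0Normed) (S : Set M) : PNModule.{u, w} m where
  carrier := hM.closedSpan S
  pnorm v := M.pnorm v.1

theorem isL0Normed_closedSpanModule [SigmaFinite m] (hM : M.IsL0Normed) (S : Set M) :
    (hM.closedSpanModule S).IsL0Normed where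
  pnorm_nonneg v := hM.pnorm_nonneg v.1
  pnorm_eq_zero v := (hM.pnorm_eq_zero v.1).trans ⟨fun h => Subtype.ext h, fun h => by rw [h]; rfl⟩
  pnorm_add_le v v' := hM.pnorm_add_le v.1 v'.1
  pnorm_smul f v := hM.pnorm_smul f v.1
  complete v hv := by
    set V : ℕ → hM.closedSpan S := v
    obtain ⟨w₀, hw₀⟩ := hM.complete (fun n => (V n).1) hv
    -- A diagonal choice: replacing each term of the Cauchy sequence by a nearby element of the span
    -- shows that the limit in `M` stays in the closed span.
    have hex : ∀ n : ℕ, ∃ s ∈ Submodule.span (L0 m) S,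
        rho m (M.pnorm (s - (V n).1)) < ((n : ℝ≥0∞) + 1)⁻¹ := by
      intro n
      obtain ⟨s, hs, hlim⟩ := (V n).2
      obtain ⟨k, hk⟩ := ((converges_iff.1 hlim).eventually_lt_const
        (show 0 < ((n : ℝ≥0∞) + 1)⁻¹ from ENNReal.inv_pos.2 (by finiteness))).exists
      exact ⟨s k, hs k, hk⟩
    choose s hs hsn using hex
    have hinv : Tendsto (fun n : ℕ => ((n : ℝ≥0∞) + 1)⁻¹) atTop (𝓝 0) := by
      have := (tendsto_add_atTop_iff_nat 1).2 ENNReal.tendsto_inv_nat_nhds_zero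
      simpa using this
    have hmem : w₀ ∈ hM.closedSpan S := by
      refine ⟨s, hs, converges_iff.2 ?_⟩
      have h := hinv.add (converges_iff.1 hw₀)
      rw [add_zero] at h
      exact tendsto_of_tendsto_of_tendsto_of_le_of_le tendsto_const_nhds h (fun i => zero_le)
        fun n => (hM.isPreNormed.rho_triangle _ _ _).trans (add_le_add_left (hsn n).le _)
    exact ⟨(⟨w₀, hmem⟩ : hM.closedSpan S), hw₀⟩

theorem generates_closedSpanModule [SigmaFinite m] (hM : M.IsL0Normed) (S : Set M)
    (T : Set (hM.closedSpanModule S)) (hT : Subtype.val '' (show Set (hM.closedSpan S) from T) = S) :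
    (hM.closedSpanModule S).Generates T := by
  intro w₀
  set W₀ : hM.closedSpan S := w₀
  obtain ⟨s, hs, hlim⟩ := W₀.2
  have h2 : Submodule.span (L0 m) (Subtype.val '' (show Set (hM.closedSpan S) from T))
      = (Submodule.span (L0 m) (show Set (hM.closedSpan S) from T)).map
        (hM.closedSpan S).subtype :=
    (Submodule.map_span (hM.closedSpan S).subtype _).symm
  rw [hT] at h2
  have h3 : ∀ n, ∃ y ∈ Submodule.span (L0 m) (show Set (hM.closedSpan S) from T), y.1 = s n := by
    intro n
    have h := hs n
    rw [h2] at h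
    exact h
  choose y hy hys using h3
  have hsy : (fun n => (y n).1) = s := funext hys
  rw [← hsy] at hlim
  exact ⟨y, hy, hlim⟩

end IsL0Normed

/-- Each `L⁰`-valued seminorm on a real vector space is the pointwise norm along a linear map with
generating image in a normed module. -/
theorem exists_generated [SigmaFinite m] {V : Type v} [AddCommGroup V] [Module ℝ V] (p : V → L0 m)
    (hadd : ∀ a b, p (a + b) ≤ p a + p b) (hsmul : ∀ (c : ℝ) a, p (c • a) = |c| • p a) :
    ∃ (M : PNModule.{u, max u v} m) (T : V → M), M.IsL0Normed ∧
      (∀ a b, T (a + b) = T a + T b) ∧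
      (∀ (c : ℝ) a, T (c • a) = (AEEqFun.const X c : L0 m) • T a) ∧
      (∀ a, M.pnorm (T a) = p a) ∧ M.Generates (Set.range T) := by
  have hp : IsSublinear p := by
    refine ⟨?_, hadd, fun c v hc => ?_⟩
    · have := hsmul 0 0
      rw [zero_smul, abs_zero, zero_smul] at this
      exact this.le
    · rw [hsmul, abs_of_pos hc]
  have hneg : ∀ a, p (-a) = p a := fun a => by
    have := hsmul (-1) a
    rwa [neg_smul, one_smul, abs_neg, abs_one, one_smul] at this
  have hp0 : ∀ a, 0 ≤ p a := fun a => by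
    have h := hp.neg_map_neg_le a
    rw [hneg, neg_le_iff_add_nonneg, ← two_smul ℝ] at h
    have h2 := smul_le_smul_of_nonneg_left h (show (0 : ℝ) ≤ 2⁻¹ by norm_num)
    rwa [smul_zero, smul_smul, inv_mul_cancel₀ two_ne_zero, one_smul] at h2
  have hL : ∀ L : V →ₗ[ℝ] L0 m, (∀ v, L v ≤ p v) → ∀ v, |L v| ≤ p v := by
    intro L hL v
    refine abs_le'.2 ⟨hL v, ?_⟩
    have h := hL (-v)
    rwa [map_neg, hneg] at h
  -- A vector is represented by its values under all dominated functionals. The supremum norm of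
  -- this family is at most `p a`, and it equals `p a` because Hahn–Banach produces a functional
  -- taking the value `p a` at `a`.
  let ι := {L : V →ₗ[ℝ] L0 m // ∀ v, |L v| ≤ p v}
  have hι : Nonempty ι := ⟨⟨0, fun v => by rw [LinearMap.zero_apply, abs_zero]; exact hp0 v⟩⟩
  let T₀ : V → boundedFamilies ι m := fun v => ⟨fun L => L.1 v, p v, fun L => L.2 v⟩
  have hM : (boundedModule ι m).IsL0Normed := isL0Normed_boundedModule
  let S : Set (boundedModule ι m) := Set.range T₀
  let T : V → hM.closedSpan S := fun v =>
    ⟨T₀ v, hM.subset_closedSpan S (Submodule.subset_span ⟨v, rfl⟩)⟩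
  refine ⟨hM.closedSpanModule S, T, hM.isL0Normed_closedSpanModule S, fun a b => ?_, fun c a => ?_,
    fun a => ?_, hM.generates_closedSpanModule S _ ?_⟩
  · exact Subtype.ext (Subtype.ext (funext fun L => map_add L.1 a b))
  · refine Subtype.ext (Subtype.ext (funext fun L => (map_smul L.1 c a).trans ?_))
    exact (L0.const_smul_eq c (L.1 a)).symm
  · change (boundedModule ι m).pnorm (T₀ a) = p a
    refine (isLUB_boundedModule_pnorm (T₀ a)).unique ⟨?_, fun b hb => ?_⟩
    · rintro _ ⟨L, rfl⟩
      exact L.2 a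
    · obtain ⟨L, hLp, hLa⟩ := hp.exists_linearMap_extension (LinearMap.toSpanSingleton ℝ V a)
        (LinearMap.toSpanSingleton ℝ (L0 m) (p a)) (fun t => by
          rw [LinearMap.toSpanSingleton_apply, LinearMap.toSpanSingleton_apply, hsmul]
          exact smul_le_smul_of_nonneg_right (le_abs_self t) (hp0 a))
      have h1 := hLa 1
      rw [LinearMap.toSpanSingleton_apply, LinearMap.toSpanSingleton_apply, one_smul,
        one_smul] at h1
      rw [← h1]
      exact (le_abs_self _).trans (hb ⟨⟨L, hL L hLp⟩, rfl⟩)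
  · ext x
    constructor
    · rintro ⟨_, ⟨v, rfl⟩, rfl⟩
      exact ⟨v, rfl⟩
    · rintro ⟨v, rfl⟩
      exact ⟨T v, ⟨v, rfl⟩, rfl⟩

end PNModule

/-- Pullbacks of normed modules exist. -/
theorem nonempty_pullbackModule [SigmaFinite m] {Y : Type v} [MeasurableSpace Y] {μ : Measure Y}
    [SigmaFinite μ] {φ : X → Y} (hφ : Measure.QuasiMeasurePreserving φ m μ)
    (N : PNModule.{v, w} μ) (hN : N.IsL0Normed) :
    Nonempty (PullbackModule.{u, v, w, max u w} hφ N) := by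
  let := N.realModule
  obtain ⟨M, T, hM, hadd, hsmul, hnorm, hgen⟩ := PNModule.exists_generated (V := N)
    (fun a => compHom hφ (N.pnorm a))
    (fun a b => by
      rw [← map_add]
      exact compHom_mono hφ (hN.pnorm_add_le a b))
    (fun c a => by
      have h : N.pnorm (c • a) = (AEEqFun.const Y |c| : L0 μ) * N.pnorm a := by
        rw [L0.const_smul_eq]
        exact hN.pnorm_const_smul c a
      rw [h, map_mul, ← L0.const_smul_eq]
      rfl)
  refine ⟨⟨M, hM, T, hadd, hsmul, ?_, hnorm, hgen⟩⟩
  intro v v₀ hv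
  rw [PNModule.converges_iff] at *
  -- Composition with `φ` preserves a.e. convergence, as `φ` pulls null sets back to null sets;
  -- convergence in `L⁰` is thus tested on subsequences that converge a.e.
  refine tendsto_of_subseq_tendsto fun ns hns => ?_
  obtain ⟨ψ, hψ, hlim⟩ := exists_subseq_ae_of_rho
    (fun n => (N.pnorm (v (ns n) - v₀)).aestronglyMeasurable) (hv.comp hns)
  refine ⟨ψ, tendsto_rho_of_ae (fun n => AEEqFun.aestronglyMeasurable _) ?_⟩
  have hT : ∀ a b, T (a - b) = T a - T b := fun a b => by
    rw [eq_sub_iff_add_eq, ← hadd, sub_add_cancel]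
  have h1 : ∀ᵐ x ∂m, ∀ n, M.pnorm (T (v (ns (ψ n))) - T v₀) x
      = N.pnorm (v (ns (ψ n)) - v₀) (φ x) := by
    rw [ae_all_iff]
    intro n
    rw [← hT, hnorm]
    exact coeFn_compHom hφ _
  filter_upwards [h1, hφ.ae hlim] with x h1 h2
  simp only [h1]
  exact h2

end Construction


/-! ## Calculus of the asymptotic Lipschitz constant -/

section Lip

variable {X : Type u} [MetricSpace X]

/-- `f` has Lipschitz constant `c` near `x`. -/
def LipNear (f : X → ℝ) (x : X) (c : ℝ) : Prop :=
  ∀ᶠ p : X × X in 𝓝 (x, x), |f p.1 - f p.2| ≤ c * dist p.1 p.2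

/-- The asymptotic Lipschitz constant, as a real number. -/
def lipR (f : X → ℝ) (x : X) : ℝ := (lipa f x).toReal

theorem lipR_nonneg (f : X → ℝ) (x : X) : 0 ≤ lipR f x := ENNReal.toReal_nonneg

theorem LipNear.lipa_le {f : X → ℝ} {x : X} {c : ℝ} (h : LipNear f x c) :
    lipa f x ≤ ENNReal.ofReal c := by
  refine limsup_le_of_le (by isBoundedDefault) ?_
  filter_upwards [h] with p hp
  rw [edist_dist, edist_dist, Real.dist_eq]
  refine ENNReal.div_le_of_le_mul ?_
  rcases le_or_gt 0 c with hc | hc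
  · rw [← ENNReal.ofReal_mul hc]
    exact ENNReal.ofReal_le_ofReal hp
  · have h1 : |f p.1 - f p.2| ≤ 0 :=
      hp.trans (mul_nonpos_of_nonpos_of_nonneg hc.le dist_nonneg)
    rw [ENNReal.ofReal_of_nonpos h1]
    exact zero_le

theorem LipNear.lipR_le {f : X → ℝ} {x : X} {c : ℝ} (h : LipNear f x c) (hc : 0 ≤ c) :
    lipR f x ≤ c :=
  ENNReal.toReal_le_of_le_ofReal hc h.lipa_le

theorem eventually_of_lipa_lt {f : X → ℝ} {x : X} {c : ℝ≥0∞} (h : lipa f x < c) :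
    ∀ᶠ p : X × X in 𝓝 (x, x), edist (f p.1) (f p.2) / edist p.1 p.2 < c :=
  eventually_lt_of_limsup_lt h (by isBoundedDefault)

theorem LipNear.of_lipa_lt {f : X → ℝ} {x : X} {c : ℝ} (h : lipa f x < ENNReal.ofReal c) :
    LipNear f x c := by
  have hc : 0 < c := ENNReal.ofReal_pos.1 (zero_le.trans_lt h)
  filter_upwards [eventually_of_lipa_lt h] with p hp
  rcases eq_or_ne p.1 p.2 with hp' | hp'
  · simp [hp']
  · have h1 := (ENNReal.div_le_iff (edist_pos.2 hp').ne' (edist_ne_top _ _)).1 hp.le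
    rw [edist_dist, edist_dist, Real.dist_eq, ← ENNReal.ofReal_mul hc.le] at h1
    exact (ENNReal.ofReal_le_ofReal_iff (mul_nonneg hc.le dist_nonneg)).1 h1

theorem LipNear.const (a : ℝ) (x : X) : LipNear (fun _ => a) x 0 :=
  Eventually.of_forall fun p => by simp

theorem lipBd_iff {f : X → ℝ} : LipBd f ↔ ∀ B : Set X, Bornology.IsBounded B →
    ∃ K : ℝ, 0 ≤ K ∧ ∀ x ∈ B, ∀ y ∈ B, |f x - f y| ≤ K * dist x y := by
  refine forall₂_congr fun B _ => ⟨?_, ?_⟩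
  · rintro ⟨K, hK⟩
    exact ⟨K, K.2, fun x hx y hy => by
      rw [← Real.dist_eq]
      exact hK.dist_le_mul x hx y hy⟩
  · rintro ⟨K, hK0, hK⟩
    exact ⟨⟨K, hK0⟩, LipschitzOnWith.of_dist_le_mul fun x hx y hy => by
      rw [Real.dist_eq]
      exact hK x hx y hy⟩

theorem eventually_nhds_prod_mem_ball (x : X) :
    ∀ᶠ p : X × X in 𝓝 (x, x), p.1 ∈ Metric.ball x 1 ∧ p.2 ∈ Metric.ball x 1 :=
  (continuous_fst.tendsto (x, x)).eventually (Metric.ball_mem_nhds x one_pos) |>.and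
    ((continuous_snd.tendsto (x, x)).eventually (Metric.ball_mem_nhds x one_pos))

theorem LipBd.exists_lipNear {f : X → ℝ} (hf : LipBd f) (x : X) : ∃ c, LipNear f x c := by
  obtain ⟨K, -, hK⟩ := lipBd_iff.1 hf _ (Metric.isBounded_ball (x := x) (r := 1))
  refine ⟨K, ?_⟩
  filter_upwards [eventually_nhds_prod_mem_ball x] with p hp
  exact hK _ hp.1 _ hp.2

theorem LipBd.continuous {f : X → ℝ} (hf : LipBd f) : Continuous f := by
  rw [continuous_iff_continuousAt]
  intro x
  obtain ⟨K, hK⟩ := hf _ (Metric.isBounded_ball (x := x) (r := 1))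
  exact hK.continuousOn.continuousAt (Metric.ball_mem_nhds x one_pos)

theorem LipBd.lipa_lt_top {f : X → ℝ} (hf : LipBd f) (x : X) : lipa f x < ∞ := by
  obtain ⟨c, hc⟩ := hf.exists_lipNear x
  exact hc.lipa_le.trans_lt ENNReal.ofReal_lt_top

theorem LipBd.lipNear {f : X → ℝ} (hf : LipBd f) {x : X} {c : ℝ} (h : lipR f x < c) :
    LipNear f x c :=
  .of_lipa_lt ((ENNReal.lt_ofReal_iff_toReal_lt (hf.lipa_lt_top x).ne).2 h)

theorem _root_.LipschitzWith.lipBd {K : ℝ≥0} {f : X → ℝ} (hf : LipschitzWith K f) : LipBd f :=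
  fun _ _ => ⟨K, hf.lipschitzOnWith⟩

theorem _root_.LipschitzWith.lipNear {K : ℝ≥0} {f : X → ℝ} (hf : LipschitzWith K f) (x : X) :
    LipNear f x K :=
  Eventually.of_forall fun p => by
    rw [← Real.dist_eq]
    exact hf.dist_le_mul _ _

theorem LipBd.const (a : ℝ) : LipBd (fun _ : X => a) := (LipschitzWith.const a).lipBd

theorem LipBd.combo {f g : X → ℝ} (hf : LipBd f) (hg : LipBd g) (a b : ℝ) :
    LipBd (fun x => a * f x + b * g x) := by
  rw [lipBd_iff] at *
  intro B hB
  obtain ⟨K, hK0, hK⟩ := hf B hB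
  obtain ⟨L, hL0, hL⟩ := hg B hB
  refine ⟨|a| * K + |b| * L, by positivity, fun x hx y hy => ?_⟩
  calc |a * f x + b * g x - (a * f y + b * g y)| = |a * (f x - f y) + b * (g x - g y)| := by
        congr 1; ring
    _ ≤ |a| * |f x - f y| + |b| * |g x - g y| := by
        rw [← abs_mul, ← abs_mul]; exact abs_add_le _ _
    _ ≤ |a| * (K * dist x y) + |b| * (L * dist x y) := by
        gcongr
        · exact hK x hx y hy
        · exact hL x hx y hy
    _ = (|a| * K + |b| * L) * dist x y := by ring

theorem LipBd.comp {f : X → ℝ} (hf : LipBd f) {K : ℝ≥0} {F : ℝ → ℝ} (hF : LipschitzWith K F) :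
    LipBd (fun x => F (f x)) := by
  intro B hB
  obtain ⟨L, hL⟩ := hf B hB
  exact ⟨K * L, hF.comp_lipschitzOnWith hL⟩

/-- Product rule on bounded sets, for bounded factors. -/
theorem LipBd.mul_of_bounded {f g : X → ℝ} (hf : LipBd f) (hg : LipBd g) {a b : ℝ}
    (ha : ∀ x, |f x| ≤ a) (hb : ∀ x, |g x| ≤ b) : LipBd (fun x => f x * g x) := by
  rw [lipBd_iff] at *
  intro B hB
  obtain ⟨K, hK0, hK⟩ := hf B hB
  obtain ⟨L, hL0, hL⟩ := hg B hB
  refine ⟨|a| * L + |b| * K, by positivity, fun x hx y hy => ?_⟩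
  calc |f x * g x - f y * g y| = |f x * (g x - g y) + g y * (f x - f y)| := by
        congr 1; ring
    _ ≤ |f x| * |g x - g y| + |g y| * |f x - f y| := by
        rw [← abs_mul, ← abs_mul]; exact abs_add_le _ _
    _ ≤ |a| * (L * dist x y) + |b| * (K * dist x y) := by
        refine add_le_add (mul_le_mul ((ha x).trans (le_abs_self a)) (hL x hx y hy) (abs_nonneg _)
          (abs_nonneg _)) (mul_le_mul ((hb y).trans (le_abs_self b)) (hK x hx y hy) (abs_nonneg _)
          (abs_nonneg _))
    _ = (|a| * L + |b| * K) * dist x y := by ring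

theorem tendsto_nhdsGT_shift {Φ : ℝ → ℝ} (hΦ : Continuous Φ) :
    Tendsto Φ (𝓝[>] 0) (𝓝 (Φ 0)) :=
  (hΦ.tendsto 0).mono_left nhdsWithin_le_nhds

theorem lipR_combo_le {f g : X → ℝ} (hf : LipBd f) (hg : LipBd g) (a b : ℝ) (x : X) :
    lipR (fun y => a * f y + b * g y) x ≤ |a| * lipR f x + |b| * lipR g x := by
  have hlim := tendsto_nhdsGT_shift
    (Φ := fun δ => |a| * (lipR f x + δ) + |b| * (lipR g x + δ)) (by fun_prop)
  simp only [add_zero] at hlim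
  refine ge_of_tendsto hlim ?_
  filter_upwards [self_mem_nhdsWithin] with δ hδ
  have hδ' : 0 < δ := hδ
  have h1 := lipR_nonneg f x
  have h2 := lipR_nonneg g x
  refine LipNear.lipR_le ?_ (by positivity)
  filter_upwards [hf.lipNear (lt_add_of_pos_right (lipR f x) hδ'),
    hg.lipNear (lt_add_of_pos_right (lipR g x) hδ')] with p h3 h4
  calc |a * f p.1 + b * g p.1 - (a * f p.2 + b * g p.2)|
      = |a * (f p.1 - f p.2) + b * (g p.1 - g p.2)| := by congr 1; ring
    _ ≤ |a| * |f p.1 - f p.2| + |b| * |g p.1 - g p.2| := by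
        rw [← abs_mul, ← abs_mul]; exact abs_add_le _ _
    _ ≤ |a| * ((lipR f x + δ) * dist p.1 p.2) + |b| * ((lipR g x + δ) * dist p.1 p.2) := by
        gcongr
    _ = _ := by ring

/-- Because `lip_a` compares two points that both move, differentiability of `F` has to be strict.
-/
theorem lipR_comp_le {f : X → ℝ} (hf : LipBd f) {F : ℝ → ℝ} {d : ℝ} {x : X}
    (hF : HasStrictDerivAt F d (f x)) :
    lipR (fun y => F (f y)) x ≤ |d| * lipR f x := by
  have hlim := tendsto_nhdsGT_shift
    (Φ := fun δ => (|d| + δ) * (lipR f x + δ)) (by fun_prop)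
  simp only [add_zero] at hlim
  refine ge_of_tendsto hlim ?_
  filter_upwards [self_mem_nhdsWithin] with δ hδ
  have hδ' : 0 < δ := hδ
  have h1 := lipR_nonneg f x
  refine LipNear.lipR_le ?_ (by positivity)
  have hcont : Tendsto (fun p : X × X => (f p.1, f p.2)) (𝓝 (x, x)) (𝓝 (f x, f x)) :=
    ((hf.continuous.comp continuous_fst).prodMk (hf.continuous.comp continuous_snd)).tendsto _
  have hd : ∀ᶠ q : ℝ × ℝ in 𝓝 (f x, f x), |F q.1 - F q.2| ≤ (|d| + δ) * |q.1 - q.2| := by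
    have := (HasFDerivAtFilter.isLittleO hF.hasStrictFDerivAt).def hδ'
    filter_upwards [this] with q hq
    rw [Real.norm_eq_abs, Real.norm_eq_abs, ContinuousLinearMap.toSpanSingleton_apply,
      smul_eq_mul] at hq
    calc |F q.1 - F q.2| = |(F q.1 - F q.2 - (q.1 - q.2) * d) + (q.1 - q.2) * d| := by
          rw [sub_add_cancel]
      _ ≤ δ * |q.1 - q.2| + |q.1 - q.2| * |d| := by
          refine (abs_add_le _ _).trans (add_le_add hq (abs_mul _ _).le)
      _ = _ := by ring
  filter_upwards [hf.lipNear (lt_add_of_pos_right (lipR f x) hδ'), hcont.eventually hd]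
    with p h3 h4
  calc |F (f p.1) - F (f p.2)| ≤ (|d| + δ) * |f p.1 - f p.2| := h4
    _ ≤ (|d| + δ) * ((lipR f x + δ) * dist p.1 p.2) := by gcongr
    _ = _ := by ring

/-- Truncation at levels `±e`. -/
def clamp (e t : ℝ) : ℝ := max (-e) (min e t)

theorem lipschitzWith_clamp (e : ℝ) : LipschitzWith 1 (clamp e) :=
  (LipschitzWith.id.const_min e).const_max (-e)

theorem abs_clamp_le {e : ℝ} (he : 0 ≤ e) (t : ℝ) : |clamp e t| ≤ e :=
  abs_le.2 ⟨le_max_left _ _, max_le (by linarith) (min_le_left _ _)⟩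

theorem clamp_eq {e t : ℝ} (ht : |t| < e) : clamp e t = t := by
  rw [abs_lt] at ht
  rw [clamp, min_eq_right ht.2.le, max_eq_right ht.1.le]

theorem tendsto_clamp {e : ℝ} (he : 0 < e) {t : ℕ → ℝ} (ht : Tendsto t atTop (𝓝 0)) :
    Tendsto (fun n => clamp e (t n)) atTop (𝓝 0) := by
  have h := ((lipschitzWith_clamp e).continuous.tendsto 0).comp ht
  rwa [clamp_eq (by rwa [abs_zero])] at h

section Mix

variable {f g χ : X → ℝ} {e : ℝ}

/-- Interpolation of `f` with `g`, truncated where these functions are far apart. -/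
def mix (χ f g : X → ℝ) (e : ℝ) (x : X) : ℝ := f x + χ x * clamp e (g x - f x)

theorem lipBd_mix (hf : LipBd f) (hg : LipBd g) (hχ : LipBd χ) (hχ01 : ∀ x, χ x ∈ Set.Icc 0 1)
    (he : 0 ≤ e) : LipBd (mix χ f g e) := by
  have h1 : LipBd (fun x => clamp e (1 * g x + (-1) * f x)) :=
    (hg.combo hf 1 (-1)).comp (lipschitzWith_clamp e)
  have h2 := hχ.mul_of_bounded (a := 1) h1
    (fun x => abs_le.2 ⟨by linarith [(hχ01 x).1], (hχ01 x).2⟩) (fun x => abs_clamp_le he _)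
  have h3 := hf.combo h2 1 1
  convert h3 using 2 with x
  simp only [mix]
  rw [show 1 * g x + -1 * f x = g x - f x by ring]
  ring

/-- A crude bound that is valid where `f` and `g` are far apart: `clamp` is 1-Lipschitz, so the
correction adds one copy each of the constants of `f` and `g`. The factor `2` is harmless, since it
is used only on sets that disappear in the limit. -/
theorem lipR_mix_le (hf : LipBd f) (hg : LipBd g)
    (hχ01 : ∀ x, χ x ∈ Set.Icc 0 1) (he : 0 < e) {x : X} {c : ℝ} (hc : 0 ≤ c)
    (hχc : LipNear χ x c) :
    lipR (mix χ f g e) x ≤ 2 * lipR f x + lipR g x + c * e := by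
  have hlim := tendsto_nhdsGT_shift
    (Φ := fun δ => 2 * (lipR f x + δ) + (lipR g x + δ) + c * e) (by fun_prop)
  simp only [add_zero] at hlim
  refine ge_of_tendsto hlim ?_
  filter_upwards [self_mem_nhdsWithin] with δ hδ
  have hδ' : 0 < δ := hδ
  have h1 := lipR_nonneg f x
  have h2 := lipR_nonneg g x
  refine LipNear.lipR_le ?_ (by positivity)
  filter_upwards [hf.lipNear (lt_add_of_pos_right (lipR f x) hδ'),
    hg.lipNear (lt_add_of_pos_right (lipR g x) hδ'), hχc] with p h3 h4 h5
  set y := p.1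
  set z := p.2
  have h6 : |clamp e (g y - f y) - clamp e (g z - f z)| ≤ |g y - g z| + |f y - f z| := by
    have := (lipschitzWith_clamp e).dist_le_mul (g y - f y) (g z - f z)
    rw [Real.dist_eq, Real.dist_eq, NNReal.coe_one, one_mul] at this
    refine this.trans ?_
    rw [show g y - f y - (g z - f z) = (g y - g z) - (f y - f z) by ring]
    exact abs_sub _ _
  have h7 := abs_clamp_le he.le (g z - f z)
  have h8 := hχ01 y
  calc |mix χ f g e y - mix χ f g e z|
      = |(f y - f z) + χ y * (clamp e (g y - f y) - clamp e (g z - f z))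
          + (χ y - χ z) * clamp e (g z - f z)| := by
        simp only [mix]; congr 1; ring
    _ ≤ |f y - f z| + |χ y * (clamp e (g y - f y) - clamp e (g z - f z))|
          + |(χ y - χ z) * clamp e (g z - f z)| := abs_add_three _ _ _
    _ ≤ |f y - f z| + 1 * (|g y - g z| + |f y - f z|) + (c * dist y z) * e := by
        rw [abs_mul, abs_mul, abs_of_nonneg h8.1]
        gcongr
        exact h8.2
    _ ≤ (lipR f x + δ) * dist y z + 1 * ((lipR g x + δ) * dist y z + (lipR f x + δ) * dist y z)
          + (c * dist y z) * e := by gcongr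
    _ = _ := by ring

/-- Near such a point the truncation is inactive and `mix` is the honest interpolation `(1 - χ) f +
χ g`. The derivative of the cutoff multiplies `g - f`, which has size less than `e`. -/
theorem lipR_mix_le_of_close (hf : LipBd f) (hg : LipBd g) (hχ : Continuous χ)
    (hχ01 : ∀ x, χ x ∈ Set.Icc 0 1) (he : 0 < e) {x : X} {c : ℝ} (hc : 0 ≤ c)
    (hχc : LipNear χ x c) (hx : |g x - f x| < e) :
    lipR (mix χ f g e) x ≤ (1 - χ x) * lipR f x + χ x * lipR g x + c * e := by
  have hlim := tendsto_nhdsGT_shift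
    (Φ := fun δ => (1 - χ x + δ) * (lipR f x + δ) + (χ x + δ) * (lipR g x + δ) + c * e)
    (by fun_prop)
  simp only [add_zero] at hlim
  refine ge_of_tendsto hlim ?_
  filter_upwards [self_mem_nhdsWithin] with δ hδ
  have hδ' : 0 < δ := hδ
  have h1 := lipR_nonneg f x
  have h2 := lipR_nonneg g x
  have h01 := hχ01 x
  have h02 : 0 ≤ 1 - χ x := by linarith [h01.2]
  have h03 : 0 ≤ χ x := h01.1
  refine LipNear.lipR_le ?_ (by positivity)
  have hclose : ∀ᶠ y in 𝓝 x, |g y - f y| < e :=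
    (hg.continuous.sub hf.continuous).abs.tendsto x |>.eventually_lt_const hx
  have hχx : ∀ᶠ y in 𝓝 x, |χ y - χ x| < δ := by
    have : Tendsto (fun y => |χ y - χ x|) (𝓝 x) (𝓝 |χ x - χ x|) :=
      ((hχ.sub continuous_const).abs).tendsto x
    rw [sub_self, abs_zero] at this
    exact this.eventually_lt_const hδ'
  filter_upwards [hf.lipNear (lt_add_of_pos_right (lipR f x) hδ'),
    hg.lipNear (lt_add_of_pos_right (lipR g x) hδ'), hχc,
    (continuous_fst.tendsto (x, x)).eventually hclose,
    (continuous_snd.tendsto (x, x)).eventually hclose,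
    (continuous_fst.tendsto (x, x)).eventually hχx] with p h3 h4 h5 h6 h7 h8
  set y := p.1
  set z := p.2
  have h9 := hχ01 y
  rw [abs_lt] at h8
  calc |mix χ f g e y - mix χ f g e z|
      = |(1 - χ y) * (f y - f z) + χ y * (g y - g z) + (χ y - χ z) * (g z - f z)| := by
        simp only [mix]; rw [clamp_eq h6, clamp_eq h7]; congr 1; ring
    _ ≤ |(1 - χ y) * (f y - f z)| + |χ y * (g y - g z)| + |(χ y - χ z) * (g z - f z)| :=
        abs_add_three _ _ _
    _ ≤ (1 - χ x + δ) * ((lipR f x + δ) * dist y z) + (χ x + δ) * ((lipR g x + δ) * dist y z)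
          + (c * dist y z) * e := by
        rw [abs_mul, abs_mul, abs_mul, abs_of_nonneg h9.1,
          abs_of_nonneg (show 0 ≤ 1 - χ y by linarith [h9.2])]
        gcongr
        · linarith
        · linarith
    _ = _ := by ring

end Mix

/-- Lipschitz constant of a product with a cutoff function. -/
theorem lipR_mul_cutoff_le {h χ : X → ℝ} (hh : LipBd h) (hχ01 : ∀ x, χ x ∈ Set.Icc 0 1) {L : ℝ≥0}
    (hχ : LipschitzWith L χ) {M : ℝ} (hM : ∀ x, |h x| ≤ M) (x : X) :
    lipR (fun y => χ y * h y) x ≤ lipR h x + L * M := by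
  have hM0 : 0 ≤ M := (abs_nonneg _).trans (hM x)
  refine le_of_forall_pos_le_add fun δ hδ => ?_
  have h1 := lipR_nonneg h x
  refine LipNear.lipR_le ?_ (by positivity)
  filter_upwards [hh.lipNear (lt_add_of_pos_right (lipR h x) hδ), hχ.lipNear x] with p h3 h4
  have h5 := hχ01 p.1
  have h6 := hM p.2
  calc |χ p.1 * h p.1 - χ p.2 * h p.2|
      = |χ p.1 * (h p.1 - h p.2) + (χ p.1 - χ p.2) * h p.2| := by congr 1; ring
    _ ≤ |χ p.1 * (h p.1 - h p.2)| + |(χ p.1 - χ p.2) * h p.2| := abs_add_le _ _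
    _ ≤ 1 * ((lipR h x + δ) * dist p.1 p.2) + (L * dist p.1 p.2) * M := by
        rw [abs_mul, abs_mul, abs_of_nonneg h5.1]
        gcongr
        exact h5.2
    _ = _ := by ring

/-- A bound for the quotients in a neighbourhood of `(x, x)` is also one near `(y, y)` for all `y`
close to `x`. This is what makes `lipR` measurable for an arbitrary function. -/
theorem upperSemicontinuous_lipa (f : X → ℝ) : UpperSemicontinuous (lipa f) := by
  intro x c hc
  obtain ⟨d, hd, hdc⟩ := exists_between hc
  have h := (eventually_of_lipa_lt hd).eventually_nhds
  have hdiag : Tendsto (fun y : X => (y, y)) (𝓝 x) (𝓝 (x, x)) :=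
    (continuous_id.prodMk continuous_id).tendsto x
  filter_upwards [hdiag.eventually h] with y hy
  refine (limsup_le_of_le (by isBoundedDefault) ?_).trans_lt hdc
  filter_upwards [hy] with p hp
  exact hp.le

theorem measurable_lipR [MeasurableSpace X] [OpensMeasurableSpace X] (f : X → ℝ) :
    Measurable (lipR f) :=
  (upperSemicontinuous_lipa f).measurable.ennreal_toReal

end Lip

section LTwo

variable {X : Type u} [MeasurableSpace X] {m : Measure X}

/-- Dominated convergence in `L²`. -/
theorem tendsto_eLpNorm_of_dominated {F : ℕ → X → ℝ} {G : X → ℝ} (hG : MemLp G 2 m)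
    (hF : ∀ n, AEStronglyMeasurable (F n) m) (hle : ∀ n, ∀ᵐ x ∂m, |F n x| ≤ G x)
    (hlim : ∀ᵐ x ∂m, Tendsto (fun n => F n x) atTop (𝓝 0)) :
    Tendsto (fun n => eLpNorm (F n) 2 m) atTop (𝓝 0) := by
  have hpow : ∀ f : X → ℝ, eLpNorm f 2 m ^ (2 : ℝ) = ∫⁻ x, ‖f x‖ₑ ^ (2 : ℝ) ∂m := fun f => by
    have := eLpNorm_nnreal_pow_eq_lintegral (f := f) (μ := m) (p := 2) two_ne_zero
    simpa using this
  have h1 : Tendsto (fun n => ∫⁻ x, ‖F n x‖ₑ ^ (2 : ℝ) ∂m) atTop (𝓝 (∫⁻ _, 0 ∂m)) := by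
    refine tendsto_lintegral_of_dominated_convergence' (fun x => ‖G x‖ₑ ^ (2 : ℝ))
      (fun n => (hF n).enorm.pow_const _) (fun n => ?_) ?_ ?_
    · filter_upwards [hle n] with x hx
      gcongr
      rw [← ofReal_norm, ← ofReal_norm, Real.norm_eq_abs, Real.norm_eq_abs]
      exact ENNReal.ofReal_le_ofReal (hx.trans (le_abs_self _))
    · rw [← hpow]
      exact ENNReal.rpow_ne_top_of_nonneg (by norm_num) hG.2.ne
    · filter_upwards [hlim] with x hx
      have h2 := tendsto_zero_iff_enorm_tendsto_zero.1 hx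
      have h3 := (ENNReal.continuous_rpow_const (y := 2)).tendsto 0 |>.comp h2
      rwa [ENNReal.zero_rpow_of_pos two_pos] at h3
  rw [lintegral_zero] at h1
  simp only [← hpow] at h1
  have h4 := (ENNReal.continuous_rpow_const (y := 2⁻¹)).tendsto 0 |>.comp h1
  rw [ENNReal.zero_rpow_of_pos (by norm_num)] at h4
  refine h4.congr fun n => ?_
  rw [Function.comp_apply, ENNReal.rpow_rpow_inv two_ne_zero]

end LTwo


/-! ## Upper bounds for weak gradients -/

section WeakBound

/-! ### Limits in the `L²` seminorm. -/

section LTwoLimits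

variable {X : Type u} [MeasurableSpace X] {m : Measure X}

theorem tendsto_eLpNorm_of_le {ι : Type*} {l : Filter ι} {F A : ι → X → ℝ}
    (h : ∀ i, ∀ᵐ x ∂m, |F i x| ≤ A i x)
    (hA : Tendsto (fun i => eLpNorm (A i) 2 m) l (𝓝 0)) :
    Tendsto (fun i => eLpNorm (F i) 2 m) l (𝓝 0) :=
  tendsto_of_tendsto_of_tendsto_of_le_of_le tendsto_const_nhds hA (fun _ => zero_le)
    fun i => eLpNorm_mono_ae_real (h i)

theorem tendsto_eLpNorm_add {ι : Type*} {l : Filter ι} {A B : ι → X → ℝ}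
    (hAm : ∀ i, AEStronglyMeasurable (A i) m) (hBm : ∀ i, AEStronglyMeasurable (B i) m)
    (hA : Tendsto (fun i => eLpNorm (A i) 2 m) l (𝓝 0))
    (hB : Tendsto (fun i => eLpNorm (B i) 2 m) l (𝓝 0)) :
    Tendsto (fun i => eLpNorm (fun x => A i x + B i x) 2 m) l (𝓝 0) := by
  have h := hA.add hB
  rw [add_zero] at h
  exact tendsto_of_tendsto_of_tendsto_of_le_of_le tendsto_const_nhds h (fun _ => zero_le)
    fun i => eLpNorm_add_le (hAm i) (hBm i) one_le_two

theorem tendsto_eLpNorm_const_mul_abs {ι : Type*} {l : Filter ι} {A : ι → X → ℝ} (c : ℝ)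
    (hA : Tendsto (fun i => eLpNorm (A i) 2 m) l (𝓝 0)) :
    Tendsto (fun i => eLpNorm (fun x => c * |A i x|) 2 m) l (𝓝 0) := by
  have h := ENNReal.Tendsto.const_mul (a := ‖c‖ₑ) hA (Or.inr enorm_ne_top)
  rw [mul_zero] at h
  refine h.congr fun i => ?_
  have h1 := eLpNorm_const_smul c (fun x => |A i x|) 2 m
  have h2 : eLpNorm (fun x => |A i x|) 2 m = eLpNorm (A i) 2 m := eLpNorm_norm (A i)
  rw [← h2, ← h1]
  rfl

theorem exists_seq_rho_eLpNorm [SFinite m] {f G : X → ℝ} {P : (X → ℝ) → (X → ℝ) → Prop}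
    (hf : AEStronglyMeasurable f m)
    (hP : ∀ h g, P h g → AEStronglyMeasurable h m)
    (happ : ∀ ε : ℝ≥0∞, 0 < ε → ∃ h g : X → ℝ, P h g ∧ rho m (fun x => h x - f x) < ε ∧
      eLpNorm (fun x => g x - G x) 2 m < ε) :
    ∃ h g : ℕ → X → ℝ, (∀ n, P (h n) (g n)) ∧
      (∀ᵐ x ∂m, Tendsto (fun n => h n x) atTop (𝓝 (f x))) ∧
      Tendsto (fun n => eLpNorm (fun x => g n x - G x) 2 m) atTop (𝓝 0) := by
  have hinv : Tendsto (fun n : ℕ => ((n : ℝ≥0∞) + 1)⁻¹) atTop (𝓝 0) := by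
    have := (tendsto_add_atTop_iff_nat 1).2 ENNReal.tendsto_inv_nat_nhds_zero
    simpa using this
  choose h g hPn hrho hL using fun n : ℕ => happ ((n : ℝ≥0∞) + 1)⁻¹ (ENNReal.inv_pos.2 (by finiteness))
  have h1 : Tendsto (fun n => rho m (fun x => h n x - f x)) atTop (𝓝 0) :=
    tendsto_of_tendsto_of_tendsto_of_le_of_le tendsto_const_nhds hinv (fun _ => zero_le)
      fun n => (hrho n).le
  have h2 : Tendsto (fun n => eLpNorm (fun x => g n x - G x) 2 m) atTop (𝓝 0) :=
    tendsto_of_tendsto_of_tendsto_of_le_of_le tendsto_const_nhds hinv (fun _ => zero_le)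
      fun n => (hL n).le
  obtain ⟨φ, hφ, hlim⟩ := exists_subseq_ae_of_rho (f := fun n x => h n x - f x)
    (fun n => (hP _ _ (hPn n)).sub hf) h1
  refine ⟨fun n => h (φ n), fun n => g (φ n), fun n => hPn _, ?_, h2.comp hφ.tendsto_atTop⟩
  filter_upwards [hlim] with x hx
  exact tendsto_sub_nhds_zero_iff.1 hx

/-- Products of a convergent bounded sequence with a fixed `L²` function, plus an `L²` error. -/
theorem tendsto_eLpNorm_mul {θ : ℕ → X → ℝ} {θ₀ : X → ℝ} {g : ℕ → X → ℝ} {G : X → ℝ} {K : ℝ}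
    (hθm : ∀ n, AEStronglyMeasurable (θ n) m) (hθ : ∀ n, ∀ᵐ x ∂m, |θ n x| ≤ K)
    (hlim : ∀ᵐ x ∂m, Tendsto (fun n => θ n x) atTop (𝓝 (θ₀ x)))
    (hg : ∀ n, MemLp (g n) 2 m) (hG : MemLp G 2 m)
    (hgG : Tendsto (fun n => eLpNorm (fun x => g n x - G x) 2 m) atTop (𝓝 0)) :
    MemLp (fun x => θ₀ x * G x) 2 m ∧
    Tendsto (fun n => eLpNorm (fun x => θ n x * g n x - θ₀ x * G x) 2 m) atTop (𝓝 0) := by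
  have hθ₀m : AEStronglyMeasurable θ₀ m := aestronglyMeasurable_of_tendsto_ae atTop hθm hlim
  have hθ₀ : ∀ᵐ x ∂m, |θ₀ x| ≤ K := by
    filter_upwards [hlim, ae_all_iff.2 hθ] with x h1 h2
    exact le_of_tendsto' h1.abs h2
  have hd : ∀ n, MemLp (fun x => g n x - G x) 2 m := fun n => (hg n).sub hG
  refine ⟨(hG.norm.const_mul K).mono' (hθ₀m.mul hG.1) ?_, ?_⟩
  · filter_upwards [hθ₀] with x hx
    rw [norm_mul]
    exact mul_le_mul_of_nonneg_right hx (norm_nonneg _)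
  · refine tendsto_eLpNorm_of_le (A := fun n x => K * |g n x - G x| + |(θ n x - θ₀ x) * G x|)
      (fun n => ?_) (tendsto_eLpNorm_add (fun n => (hd n).1.norm.const_mul K)
        (fun n => (((hθm n).sub hθ₀m).mul hG.1).norm) (tendsto_eLpNorm_const_mul_abs K hgG) ?_)
    · filter_upwards [hθ n] with x hx
      rw [show θ n x * g n x - θ₀ x * G x = θ n x * (g n x - G x) + (θ n x - θ₀ x) * G x by ring]
      refine (abs_add_le _ _).trans (add_le_add_left ?_ _)
      rw [abs_mul]
      exact mul_le_mul_of_nonneg_right hx (abs_nonneg _)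
    · refine tendsto_eLpNorm_of_dominated (G := fun x => (2 * K) * ‖G x‖) (hG.norm.const_mul _)
        (fun n => (((hθm n).sub hθ₀m).mul hG.1).norm) (fun n => ?_) ?_
      · filter_upwards [hθ n, hθ₀] with x h1 h2
        rw [abs_abs, abs_mul]
        refine mul_le_mul_of_nonneg_right ?_ (abs_nonneg _)
        exact (abs_sub _ _).trans (by linarith)
      · filter_upwards [hlim] with x hx
        have h1 := ((tendsto_sub_nhds_zero_iff.2 hx).mul_const (G x)).abs
        rwa [zero_mul, abs_zero] at h1

end LTwoLimits

variable {X : Type u} [MetricSpace X] [MeasurableSpace X] {m : Measure X}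

/-- `G` is an upper bound for the minimal weak upper gradient of `f`: there are functions `h`,
Lipschitz on bounded sets, which are close to `f`, with `lip_a h ≤ g` for some `g` which is
close to `G` in `L²`. -/
structure IsWeakBound (m : Measure X) [SFinite m] (f G : X → ℝ) : Prop where
  aestronglyMeasurable : AEStronglyMeasurable f m
  memLp : MemLp G 2 m
  approx : ∀ ε : ℝ≥0∞, 0 < ε → ∃ h g : X → ℝ, LipBd h ∧ MemLp g 2 m ∧
    (∀ᵐ x ∂m, lipR h x ≤ g x) ∧ rho m (fun x => h x - f x) < ε ∧
    eLpNorm (fun x => g x - G x) 2 m < ε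

namespace IsWeakBound

variable [SFinite m]

theorem of_approx {f G : X → ℝ} (hf : AEStronglyMeasurable f m) (hG : MemLp G 2 m)
    (h : ∀ ε : ℝ≥0∞, 0 < ε → ∃ f' G' : X → ℝ, IsWeakBound m f' G' ∧
      rho m (fun x => f' x - f x) < ε ∧ eLpNorm (fun x => G' x - G x) 2 m < ε) :
    IsWeakBound m f G := by
  refine ⟨hf, hG, fun ε hε => ?_⟩
  have hε2 : 0 < ε / 2 := ENNReal.half_pos hε.ne'
  obtain ⟨f', G', hw, h1, h2⟩ := h _ hε2
  obtain ⟨k, g, hk, hg, hkg, h3, h4⟩ := hw.approx _ hε2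
  refine ⟨k, g, hk, hg, hkg, ?_, ?_⟩
  · rw [← ENNReal.add_halves ε, add_comm]
    refine lt_of_le_of_lt ?_ (ENNReal.add_lt_add h1 h3)
    refine le_trans (le_of_eq ?_) (rho_add_le (hw.aestronglyMeasurable.sub hf))
    congr 1
    ext x
    simp
  · rw [← ENNReal.add_halves ε, add_comm]
    refine lt_of_le_of_lt ?_ (ENNReal.add_lt_add h2 h4)
    refine le_trans (le_of_eq ?_) (eLpNorm_add_le (hw.memLp.sub hG).1 (hg.sub hw.memLp).1
      one_le_two)
    congr 1
    ext x
    simp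

/-- Stability under limits. -/
theorem of_tendsto {f G : X → ℝ} {F g : ℕ → X → ℝ} (hw : ∀ n, IsWeakBound m (F n) (g n))
    (hG : MemLp G 2 m)
    (hF : ∀ᵐ x ∂m, Tendsto (fun n => F n x) atTop (𝓝 (f x)))
    (hg : Tendsto (fun n => eLpNorm (fun x => g n x - G x) 2 m) atTop (𝓝 0)) :
    IsWeakBound m f G := by
  have hf : AEStronglyMeasurable f m :=
    aestronglyMeasurable_of_tendsto_ae atTop (fun n => (hw n).aestronglyMeasurable) hF
  have hr : Tendsto (fun n => rho m (fun x => F n x - f x)) atTop (𝓝 0) := by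
    refine tendsto_rho_of_ae (fun n => (hw n).aestronglyMeasurable.sub hf) ?_
    filter_upwards [hF] with x hx
    exact tendsto_sub_nhds_zero_iff.2 hx
  refine of_approx hf hG fun ε hε => ?_
  obtain ⟨n, h1, h2⟩ := ((hr.eventually_lt_const hε).and (hg.eventually_lt_const hε)).exists
  exact ⟨_, _, hw n, h1, h2⟩

theorem tendsto_bound {f G : X → ℝ} {g : ℕ → X → ℝ} (hw : ∀ n, IsWeakBound m f (g n))
    (hG : MemLp G 2 m)
    (hg : Tendsto (fun n => eLpNorm (fun x => g n x - G x) 2 m) atTop (𝓝 0)) :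
    IsWeakBound m f G :=
  of_tendsto hw hG (Eventually.of_forall fun _ => tendsto_const_nhds) hg

theorem congr_fun {f f' G : X → ℝ} (h : IsWeakBound m f G) (hf : f =ᵐ[m] f') :
    IsWeakBound m f' G := by
  refine of_tendsto (F := fun _ => f) (g := fun _ => G) (fun _ => h) h.memLp ?_ ?_
  · filter_upwards [hf] with x hx
    rw [hx]
    exact tendsto_const_nhds
  · simp

theorem mono {f G G' : X → ℝ} (h : IsWeakBound m f G) (hG : ∀ᵐ x ∂m, G x ≤ G' x)
    (hG' : MemLp G' 2 m) : IsWeakBound m f G' := by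
  refine ⟨h.aestronglyMeasurable, hG', fun ε hε => ?_⟩
  obtain ⟨k, g, hk, hg, hkg, h3, h4⟩ := h.approx ε hε
  refine ⟨k, fun x => g x + (G' x - G x), hk, hg.add (hG'.sub h.memLp), ?_, h3, ?_⟩
  · filter_upwards [hkg, hG] with x h1 h2
    linarith
  · refine lt_of_le_of_lt (le_of_eq ?_) h4
    congr 1
    ext x
    ring

theorem congr_bound {f G G' : X → ℝ} (h : IsWeakBound m f G) (hG : G =ᵐ[m] G') :
    IsWeakBound m f G' :=
  h.mono hG.le ((memLp_congr_ae hG).1 h.memLp)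

variable [BorelSpace X]

theorem of_lipBd {h g : X → ℝ} (hh : LipBd h) (hg : MemLp g 2 m)
    (hle : ∀ᵐ x ∂m, lipR h x ≤ g x) : IsWeakBound m h g := by
  refine ⟨hh.continuous.measurable.aestronglyMeasurable, hg, fun ε hε =>
    ⟨h, g, hh, hg, hle, ?_, ?_⟩⟩
  · simpa using hε
  · simpa using hε

theorem exists_seq {f G : X → ℝ} (hw : IsWeakBound m f G) :
    ∃ h g : ℕ → X → ℝ, (∀ n, LipBd (h n)) ∧ (∀ n, MemLp (g n) 2 m) ∧
      (∀ n, ∀ᵐ x ∂m, lipR (h n) x ≤ g n x) ∧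
      (∀ᵐ x ∂m, Tendsto (fun n => h n x) atTop (𝓝 (f x))) ∧
      Tendsto (fun n => eLpNorm (fun x => g n x - G x) 2 m) atTop (𝓝 0) := by
  obtain ⟨h, g, hP, h1, h2⟩ := exists_seq_rho_eLpNorm (m := m) (f := f) (G := G)
    (P := fun h g => LipBd h ∧ MemLp g 2 m ∧ ∀ᵐ x ∂m, lipR h x ≤ g x)
    hw.aestronglyMeasurable (fun h g hP => hP.1.continuous.measurable.aestronglyMeasurable)
    (fun ε hε => by
      obtain ⟨h, g, h1, h2, h3, h4, h5⟩ := hw.approx ε hε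
      exact ⟨h, g, ⟨h1, h2, h3⟩, h4, h5⟩)
  exact ⟨h, g, fun n => (hP n).1, fun n => (hP n).2.1, fun n => (hP n).2.2, h1, h2⟩

theorem nonneg {f G : X → ℝ} (hw : IsWeakBound m f G) : ∀ᵐ x ∂m, 0 ≤ G x := by
  obtain ⟨h, g, -, hg, hle, -, hlim⟩ := hw.exists_seq
  have hneg : eLpNorm (fun x => max (-G x) 0) 2 m = 0 := by
    refine le_antisymm (ge_of_tendsto' hlim fun n => eLpNorm_mono_ae ?_) zero_le
    filter_upwards [hle n] with x hx
    have h0 := (lipR_nonneg (h n) x).trans hx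
    rw [Real.norm_eq_abs, Real.norm_eq_abs, abs_of_nonneg (le_max_right _ _)]
    refine max_le ?_ (abs_nonneg _)
    exact le_trans (by linarith) (le_abs_self _)
  have hm : AEStronglyMeasurable (fun x => max (-G x) 0) m :=
    (hw.memLp.1.neg.aemeasurable.max aemeasurable_const).aestronglyMeasurable
  rw [eLpNorm_eq_zero_iff hm two_ne_zero] at hneg
  filter_upwards [hneg] with x hx
  have : -G x ≤ 0 := (le_max_left _ _).trans hx.le
  linarith

theorem combo {f g F G : X → ℝ} (hf : IsWeakBound m f F) (hg : IsWeakBound m g G) (a b : ℝ) :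
    IsWeakBound m (fun x => a * f x + b * g x) (fun x => |a| * F x + |b| * G x) := by
  obtain ⟨h, k, h1, h2, h3, h4, h5⟩ := hf.exists_seq
  obtain ⟨h', k', h1', h2', h3', h4', h5'⟩ := hg.exists_seq
  refine of_tendsto (F := fun n x => a * h n x + b * h' n x)
    (g := fun n x => |a| * k n x + |b| * k' n x) (fun n => ?_) ?_ ?_ ?_
  · refine of_lipBd ((h1 n).combo (h1' n) a b) (((h2 n).const_mul _).add ((h2' n).const_mul _)) ?_
    filter_upwards [h3 n, h3' n] with x hx hx'
    refine (lipR_combo_le (h1 n) (h1' n) a b x).trans ?_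
    gcongr
  · exact (hf.memLp.const_mul _).add (hg.memLp.const_mul _)
  · filter_upwards [h4, h4'] with x hx hx'
    exact (hx.const_mul a).add (hx'.const_mul b)
  · have hm : ∀ n, AEStronglyMeasurable (fun x => k n x - F x) m := fun n =>
      ((h2 n).sub hf.memLp).1
    have hm' : ∀ n, AEStronglyMeasurable (fun x => k' n x - G x) m := fun n =>
      ((h2' n).sub hg.memLp).1
    refine tendsto_eLpNorm_of_le
      (A := fun n x => |a| * |k n x - F x| + |b| * |k' n x - G x|) (fun n => ?_)
      (tendsto_eLpNorm_add (fun n => (hm n).norm.const_mul _) (fun n => (hm' n).norm.const_mul _)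
        (tendsto_eLpNorm_const_mul_abs _ h5) (tendsto_eLpNorm_const_mul_abs _ h5'))
    refine Eventually.of_forall fun x => ?_
    rw [show |a| * k n x + |b| * k' n x - (|a| * F x + |b| * G x)
      = |a| * (k n x - F x) + |b| * (k' n x - G x) by ring]
    refine (abs_add_le _ _).trans (le_of_eq ?_)
    rw [abs_mul, abs_mul, abs_abs, abs_abs]

/-- Chain rule with `C¹` functions with bounded derivative. -/
theorem comp {f G : X → ℝ} (hf : IsWeakBound m f G) {F F' : ℝ → ℝ}
    (hF : ∀ t, HasStrictDerivAt F (F' t) t) (hF' : Continuous F') {K : ℝ≥0}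
    (hK : ∀ t, |F' t| ≤ K) : IsWeakBound m (fun x => F (f x)) (fun x => |F' (f x)| * G x) := by
  have hlip : LipschitzWith K F := lipschitzWith_of_nnnorm_deriv_le
    (fun t => (hF t).hasDerivAt.differentiableAt) fun t => by
      rw [(hF t).hasDerivAt.deriv, ← NNReal.coe_le_coe, coe_nnnorm]
      exact hK t
  obtain ⟨h, g, h1, h2, h3, h4, h5⟩ := hf.exists_seq
  have hθm : ∀ n, AEStronglyMeasurable (fun x => |F' (h n x)|) m := fun n =>
    ((hF'.comp (h1 n).continuous).abs).measurable.aestronglyMeasurable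
  have hθ : ∀ n, ∀ᵐ x ∂m, |(|F' (h n x)|)| ≤ K := fun n =>
    Eventually.of_forall fun x => by rw [abs_abs]; exact hK _
  have key := tendsto_eLpNorm_mul (θ₀ := fun x => |F' (f x)|) hθm hθ (by
    filter_upwards [h4] with x hx
    exact ((hF'.tendsto _).comp hx).abs) h2 hf.memLp h5
  refine of_tendsto (F := fun n x => F (h n x)) (g := fun n x => |F' (h n x)| * g n x)
    (fun n => ?_) key.1 ?_ key.2
  · refine of_lipBd ((h1 n).comp hlip) ?_ ?_
    · refine ((h2 n).norm.const_mul K).mono' ((hθm n).mul (h2 n).1) ?_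
      filter_upwards [hθ n] with x hx
      rw [norm_mul]
      exact mul_le_mul_of_nonneg_right hx (norm_nonneg _)
    · filter_upwards [h3 n] with x hx
      exact (lipR_comp_le (h1 n) (hF _)).trans (mul_le_mul_of_nonneg_left hx (abs_nonneg _))
  · filter_upwards [h4] with x hx
    exact (hlip.continuous.tendsto _).comp hx

/-- Locality: weak upper gradients can be taken to vanish where the function vanishes. -/
theorem locality {f G : X → ℝ} (hf : IsWeakBound m f G) :
    ∃ G₀ : X → ℝ, IsWeakBound m f G₀ ∧ ∀ᵐ x ∂m, f x = 0 → G₀ x = 0 := by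
  classical
  let s : ℕ → ℝ := fun n => (n : ℝ) + 1
  have hs : ∀ n, 0 < s n := fun n => by positivity
  have hslim : Tendsto s atTop atTop :=
    tendsto_atTop_add_const_right _ _ tendsto_natCast_atTop_atTop
  -- These functions tend to the identity, while their derivatives vanish at `0` and tend to `1`
  -- elsewhere. The chain rule bound thus converges to `G` restricted to `{f ≠ 0}`.
  let F : ℕ → ℝ → ℝ := fun n t => t - (s n)⁻¹ * Real.arctan (s n * t)
  let F' : ℕ → ℝ → ℝ := fun n t => 1 - 1 / (1 + (s n * t) ^ 2)
  have hF : ∀ n t, HasStrictDerivAt (F n) (F' n t) t := by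
    intro n t
    have h1 : HasStrictDerivAt (fun t => s n * t) (s n) t := by
      simpa using (hasStrictDerivAt_id t).const_mul (s n)
    have h2 := (hasStrictDerivAt_id t).sub ((h1.arctan).const_mul (s n)⁻¹)
    have h3 : F' n t = 1 - (s n)⁻¹ * (1 / (1 + (s n * t) ^ 2) * s n) := by
      have := (hs n).ne'
      change 1 - 1 / (1 + (s n * t) ^ 2) = _
      field_simp
    rw [h3]
    exact h2
  have hF'c : ∀ n, Continuous (F' n) := by
    intro n
    have : ∀ t, 1 + (s n * t) ^ 2 ≠ 0 := fun t => by positivity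
    fun_prop (disch := exact this _)
  have hF'b : ∀ n t, 0 ≤ F' n t ∧ F' n t ≤ 1 := by
    intro n t
    have h1 : 0 < 1 + (s n * t) ^ 2 := by positivity
    have h2 : 1 / (1 + (s n * t) ^ 2) ≤ 1 := by
      rw [div_le_one h1]
      nlinarith [sq_nonneg (s n * t)]
    have h3 : 0 ≤ 1 / (1 + (s n * t) ^ 2) := by positivity
    simp only [F']
    constructor <;> linarith
  have hF'abs : ∀ n t, |F' n t| ≤ ((1 : ℝ≥0) : ℝ) := fun n t => by
    rw [abs_of_nonneg (hF'b n t).1]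
    exact (hF'b n t).2
  let θ₀ : X → ℝ := fun x => if f x = 0 then 0 else 1
  have hθlim : ∀ x, Tendsto (fun n => |F' n (f x)|) atTop (𝓝 (θ₀ x)) := by
    intro x
    have habs : ∀ n, |F' n (f x)| = F' n (f x) := fun n => abs_of_nonneg (hF'b n _).1
    refine Tendsto.congr (fun n => (habs n).symm) ?_
    by_cases hx : f x = 0
    · simp [F', θ₀, hx]
    · simp only [F', θ₀, hx, if_false]
      have h1 : Tendsto (fun n => (s n * f x) ^ 2) atTop atTop := by
        have : ∀ n, (s n * f x) ^ 2 = s n ^ 2 * (f x) ^ 2 := fun n => mul_pow _ _ _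
        simp only [this]
        exact ((tendsto_pow_atTop two_ne_zero).comp hslim).atTop_mul_const (by positivity)
      have h2 := (tendsto_atTop_add_const_left _ 1 h1).inv_tendsto_atTop
      have h3 := h2.const_sub 1
      simpa using h3
  have hFlim : ∀ x, Tendsto (fun n => F n (f x)) atTop (𝓝 (f x)) := by
    intro x
    have h1 : Tendsto (fun n => (s n)⁻¹ * Real.arctan (s n * f x)) atTop (𝓝 0) := by
      refine squeeze_zero_norm (a := fun n => (s n)⁻¹ * (Real.pi / 2)) (fun n => ?_) ?_
      · rw [norm_mul, Real.norm_eq_abs, Real.norm_eq_abs, abs_of_pos (inv_pos.2 (hs n))]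
        refine mul_le_mul_of_nonneg_left ?_ (inv_pos.2 (hs n)).le
        rw [abs_le]
        exact ⟨(Real.neg_pi_div_two_lt_arctan _).le, (Real.arctan_lt_pi_div_two _).le⟩
      · simpa using (tendsto_inv_atTop_zero.comp hslim).mul_const (Real.pi / 2)
    simpa using h1.const_sub (f x)
  have hw : ∀ n, IsWeakBound m (fun x => F n (f x)) (fun x => |F' n (f x)| * G x) := fun n =>
    hf.comp (hF n) (hF'c n) (hF'abs n)
  have key := tendsto_eLpNorm_mul (m := m) (θ := fun n x => |F' n (f x)|) (θ₀ := θ₀) (K := 1)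
    (g := fun _ => G) (G := G)
    (fun n => (hF'c n).abs.comp_aestronglyMeasurable hf.aestronglyMeasurable)
    (fun n => Eventually.of_forall fun x => by rw [abs_abs]; exact hF'abs n _)
    (Eventually.of_forall hθlim) (fun _ => hf.memLp) hf.memLp (by simp)
  refine ⟨fun x => θ₀ x * G x, of_tendsto hw key.1 (Eventually.of_forall hFlim) key.2,
    Eventually.of_forall fun x hx => by simp [θ₀, hx]⟩

/-- Interpolation between two bounds along a Lipschitz cutoff. -/
theorem mix_cutoff {f G₁ G₂ : X → ℝ} (h₁ : IsWeakBound m f G₁) (h₂ : IsWeakBound m f G₂)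
    {χ : X → ℝ} {L : ℝ≥0} (hχ : LipschitzWith L χ) (hχ01 : ∀ x, χ x ∈ Set.Icc 0 1) {C : Set X}
    (hC : IsClosed C) (hmC : m C < ∞) (hχC : ∀ x, x ∉ C → χ x = 0) :
    IsWeakBound m f (fun x => (1 - χ x) * G₁ x + χ x * G₂ x) := by
  classical
  obtain ⟨h, g, hh, hg, hhg, hhf, hgG⟩ := h₁.exists_seq
  obtain ⟨k, l, hk, hl, hkl, hkf, hlG⟩ := h₂.exists_seq
  have hχm : AEStronglyMeasurable χ m := hχ.continuous.measurable.aestronglyMeasurable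
  -- Since `χ` vanishes on the open complement of `C`, its local Lipschitz constant is `0` there.
  -- Finiteness of `m C` puts `c` into `L²`.
  set c : X → ℝ := C.indicator fun _ => (L : ℝ)
  have hc0 : ∀ x, 0 ≤ c x := fun x => Set.indicator_nonneg (fun _ _ => L.2) x
  have hcL : MemLp c 2 m := memLp_indicator_const 2 hC.measurableSet _ (Or.inr hmC.ne)
  have hχc : ∀ x, LipNear χ x (c x) := by
    intro x
    by_cases hx : x ∈ C
    · rw [show c x = L from Set.indicator_of_mem hx _]
      exact hχ.lipNear x
    · rw [show c x = 0 from Set.indicator_of_notMem hx _]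
      have h0 : ∀ᶠ y in 𝓝 x, χ y = 0 := by
        filter_upwards [hC.isOpen_compl.mem_nhds hx] with y hy
        exact hχC y hy
      filter_upwards [(continuous_fst.tendsto (x, x)).eventually h0,
        (continuous_snd.tendsto (x, x)).eventually h0] with p h1 h2
      simp [h1, h2]
  have hG0 : MemLp (fun x => (1 - χ x) * G₁ x + χ x * G₂ x) 2 m := by
    refine (h₁.memLp.norm.add h₂.memLp.norm).mono'
      (((aestronglyMeasurable_const.sub hχm).mul h₁.memLp.1).add (hχm.mul h₂.memLp.1)) ?_
    refine Eventually.of_forall fun x => ?_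
    obtain ⟨h01, h02⟩ := hχ01 x
    refine (norm_add_le _ _).trans (add_le_add ?_ ?_)
    · rw [norm_mul, Real.norm_of_nonneg (by linarith : 0 ≤ 1 - χ x)]
      exact mul_le_of_le_one_left (norm_nonneg _) (by linarith)
    · rw [norm_mul, Real.norm_of_nonneg h01]
      exact mul_le_of_le_one_left (norm_nonneg _) h02
  -- The level `e` is fixed while `n` tends to infinity. Off `B n` the approximants differ by less
  -- than `e` and the sharp estimate applies. On `B n` the crude one costs an extra `2 g + l`, whose
  -- contribution vanishes in `L²` because the indicators of `B n` tend to `0` a.e. The remaining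
  -- error `c e` disappears at the end, with `e = 1 / (n + 1)`.
  have step : ∀ e : ℝ, 0 < e →
      IsWeakBound m f (fun x => (1 - χ x) * G₁ x + χ x * G₂ x + c x * e) := by
    intro e he
    set B : ℕ → Set X := fun n => {x | e ≤ |k n x - h n x|}
    have hBm : ∀ n, MeasurableSet (B n) := fun n =>
      measurableSet_le measurable_const
        (((hk n).continuous.sub (hh n).continuous).abs).measurable
    set θ : ℕ → X → ℝ := fun n => (B n).indicator fun _ => 1
    have hθm : ∀ n, Measurable (θ n) := fun n => measurable_const.indicator (hBm n)
    have hθ01 : ∀ n x, 0 ≤ θ n x ∧ θ n x ≤ 1 := fun n x => by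
      by_cases hx : x ∈ B n
      · simp [θ, hx]
      · simp [θ, hx]
    have hθlim : ∀ᵐ x ∂m, Tendsto (fun n => θ n x) atTop (𝓝 0) := by
      filter_upwards [hhf, hkf] with x h1 h2
      have h3 : Tendsto (fun n => |k n x - h n x|) atTop (𝓝 0) := by
        have := (h2.sub h1).abs
        rwa [sub_self, abs_zero] at this
      refine tendsto_const_nhds.congr' ?_
      filter_upwards [h3.eventually_lt_const he] with n hn
      have hx : x ∉ B n := not_le.2 hn
      simp [θ, hx]
    have hdg : ∀ n, AEStronglyMeasurable (fun x => g n x - G₁ x) m := fun n =>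
      ((hg n).sub h₁.memLp).1
    have hdl : ∀ n, AEStronglyMeasurable (fun x => l n x - G₂ x) m := fun n =>
      ((hl n).sub h₂.memLp).1
    have hb : ∀ n, MemLp (fun x => (1 - χ x) * g n x + χ x * l n x + θ n x * (2 * g n x + l n x)
        + c x * e) 2 m := by
      intro n
      have hcomb : MemLp (fun x => 3 * ‖g n x‖ + 2 * ‖l n x‖ + c x * e) 2 m :=
        (((hg n).norm.const_mul 3).add ((hl n).norm.const_mul 2)).add (hcL.mul_const e)
      refine hcomb.mono' (((((aestronglyMeasurable_const.sub hχm).mul (hg n).1).add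
        (hχm.mul (hl n).1)).add ((hθm n).aestronglyMeasurable.mul
          (((hg n).1.const_mul 2).add (hl n).1))).add (hcL.1.mul_const e)) ?_
      refine Eventually.of_forall fun x => ?_
      obtain ⟨h01, h02⟩ := hχ01 x
      obtain ⟨h03, h04⟩ := hθ01 n x
      have e1 : |(1 - χ x) * g n x| ≤ |g n x| := by
        rw [abs_mul, abs_of_nonneg (by linarith : 0 ≤ 1 - χ x)]
        exact mul_le_of_le_one_left (abs_nonneg _) (by linarith)
      have e2 : |χ x * l n x| ≤ |l n x| := by
        rw [abs_mul, abs_of_nonneg h01]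
        exact mul_le_of_le_one_left (abs_nonneg _) h02
      have e3 : |θ n x * (2 * g n x + l n x)| ≤ 2 * |g n x| + |l n x| := by
        rw [abs_mul, abs_of_nonneg h03]
        refine (mul_le_of_le_one_left (abs_nonneg _) h04).trans ((abs_add_le _ _).trans ?_)
        rw [abs_mul, abs_two]
      have e4 : |c x * e| = c x * e := abs_of_nonneg (mul_nonneg (hc0 x) he.le)
      rw [Real.norm_eq_abs, Real.norm_eq_abs, Real.norm_eq_abs]
      refine (abs_add_le _ _).trans ?_
      have := abs_add_three ((1 - χ x) * g n x) (χ x * l n x) (θ n x * (2 * g n x + l n x))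
      linarith
    refine of_tendsto (F := fun n => mix χ (h n) (k n) e)
      (g := fun n x => (1 - χ x) * g n x + χ x * l n x + θ n x * (2 * g n x + l n x) + c x * e)
      (fun n => of_lipBd (lipBd_mix (hh n) (hk n) hχ.lipBd hχ01 he.le) (hb n) ?_)
      (hG0.add (hcL.mul_const e)) ?_ ?_
    · filter_upwards [hhg n, hkl n] with x h1 h2
      have h3 := lipR_nonneg (h n) x
      have h4 := lipR_nonneg (k n) x
      obtain ⟨h01, h02⟩ := hχ01 x
      by_cases hx : x ∈ B n
      · have hθx : θ n x = 1 := by simp [θ, hx]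
        rw [hθx]
        refine (lipR_mix_le (hh n) (hk n) hχ01 he (hc0 x) (hχc x)).trans ?_
        have e1 : 0 ≤ (1 - χ x) * g n x := mul_nonneg (by linarith) (by linarith)
        have e2 : 0 ≤ χ x * l n x := mul_nonneg h01 (by linarith)
        linarith
      · have hθx : θ n x = 0 := by simp [θ, hx]
        rw [hθx]
        refine (lipR_mix_le_of_close (hh n) (hk n) hχ.continuous hχ01 he (hc0 x) (hχc x)
          (not_le.1 hx)).trans ?_
        have e1 : (1 - χ x) * lipR (h n) x ≤ (1 - χ x) * g n x :=
          mul_le_mul_of_nonneg_left h1 (by linarith)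
        have e2 : χ x * lipR (k n) x ≤ χ x * l n x := mul_le_mul_of_nonneg_left h2 h01
        linarith
    · filter_upwards [hhf, hkf] with x h1 h2
      have h3 : Tendsto (fun n => k n x - h n x) atTop (𝓝 0) := by
        have := h2.sub h1
        rwa [sub_self] at this
      have h4 := h1.add ((tendsto_clamp he h3).const_mul (χ x))
      rwa [mul_zero, add_zero] at h4
    · have hA3 := tendsto_eLpNorm_mul (m := m) (K := 1) (θ₀ := fun _ => 0)
        (g := fun _ x => 2 * G₁ x + G₂ x) (G := fun x => 2 * G₁ x + G₂ x)
        (fun n => (hθm n).aestronglyMeasurable)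
        (fun n => Eventually.of_forall fun x => by
          rw [abs_of_nonneg (hθ01 n x).1]; exact (hθ01 n x).2) hθlim
        (fun _ => (h₁.memLp.const_mul 2).add h₂.memLp) ((h₁.memLp.const_mul 2).add h₂.memLp)
        (by simp)
      have hA3' := tendsto_eLpNorm_const_mul_abs 1 hA3.2
      refine tendsto_eLpNorm_of_le (A := fun n x => (3 * |g n x - G₁ x| + 2 * |l n x - G₂ x|)
          + 1 * |θ n x * (2 * G₁ x + G₂ x) - 0 * (2 * G₁ x + G₂ x)|) (fun n => ?_)
        (tendsto_eLpNorm_add (fun n => ((hdg n).norm.const_mul _).add ((hdl n).norm.const_mul _))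
          (fun n => ?_)
          (tendsto_eLpNorm_add (fun n => (hdg n).norm.const_mul _)
            (fun n => (hdl n).norm.const_mul _) (tendsto_eLpNorm_const_mul_abs 3 hgG)
            (tendsto_eLpNorm_const_mul_abs 2 hlG)) hA3')
      · refine Eventually.of_forall fun x => ?_
        obtain ⟨h01, h02⟩ := hχ01 x
        obtain ⟨h03, h04⟩ := hθ01 n x
        set d₁ := g n x - G₁ x with hd₁
        set d₂ := l n x - G₂ x with hd₂
        have e0 : (1 - χ x) * g n x + χ x * l n x + θ n x * (2 * g n x + l n x) + c x * e
            - ((1 - χ x) * G₁ x + χ x * G₂ x + c x * e)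
            = (1 - χ x + 2 * θ n x) * d₁ + (χ x + θ n x) * d₂
              + (θ n x * (2 * G₁ x + G₂ x) - 0 * (2 * G₁ x + G₂ x)) := by
          rw [hd₁, hd₂]; ring
        rw [e0]
        have e1 : |(1 - χ x + 2 * θ n x) * d₁| ≤ 3 * |d₁| := by
          rw [abs_mul, abs_of_nonneg (by linarith : 0 ≤ 1 - χ x + 2 * θ n x)]
          exact mul_le_mul_of_nonneg_right (by linarith) (abs_nonneg _)
        have e2 : |(χ x + θ n x) * d₂| ≤ 2 * |d₂| := by
          rw [abs_mul, abs_of_nonneg (by linarith : 0 ≤ χ x + θ n x)]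
          exact mul_le_mul_of_nonneg_right (by linarith) (abs_nonneg _)
        refine (abs_add_three _ _ _).trans ?_
        linarith
      · have hm3 : AEStronglyMeasurable (fun x => 2 * G₁ x + G₂ x) m :=
          ((h₁.memLp.const_mul 2).add h₂.memLp).1
        exact ((((hθm n).aestronglyMeasurable.mul hm3).sub
          (aestronglyMeasurable_const.mul hm3)).norm).const_mul 1
  refine tendsto_bound (fun n : ℕ => step (1 / ((n : ℝ) + 1)) (by positivity)) hG0 ?_
  have h0 := tendsto_one_div_add_atTop_nhds_zero_nat (𝕜 := ℝ)
  refine tendsto_eLpNorm_of_dominated hcL (fun n => ?_) (fun n => ?_) ?_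
  · exact ((hG0.add (hcL.mul_const _)).sub hG0).1
  · refine Eventually.of_forall fun x => ?_
    rw [add_sub_cancel_left, abs_of_nonneg (mul_nonneg (hc0 x) (by positivity))]
    refine mul_le_of_le_one_right (hc0 x) ?_
    rw [div_le_one (by positivity)]
    have : (0 : ℝ) ≤ n := Nat.cast_nonneg n
    linarith
  · refine Eventually.of_forall fun x => ?_
    simp only [add_sub_cancel_left]
    simpa using h0.const_mul (c x)

end IsWeakBound

end WeakBound


/-! ## Minimal weak bounds -/

section Minimal

variable {X : Type u} [MetricSpace X] [MeasurableSpace X] {m : Measure X}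

theorem sigmaFinite_of_bounded (hm : ∀ B : Set X, Bornology.IsBounded B → m B < ∞) :
    SigmaFinite m := by
  rcases isEmpty_or_nonempty X with h | ⟨⟨x₀⟩⟩
  · have : m = 0 := Measure.eq_zero_of_isEmpty m
    rw [this]
    infer_instance
  · exact ⟨⟨{ set := fun n => Metric.ball x₀ n
              set_mem := fun _ => trivial
              finite := fun n => hm _ Metric.isBounded_ball
              spanning := Metric.iUnion_ball_nat x₀ }⟩⟩

namespace IsWeakBound

variable [SFinite m]

theorem piecewise_of_tendsto {f G₁ G₂ : X → ℝ} (h₁ : IsWeakBound m f G₁)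
    (h₂ : IsWeakBound m f G₂) {A : Set X} [∀ x, Decidable (x ∈ A)] {θ : ℕ → X → ℝ}
    (hθm : ∀ n, Measurable (θ n)) (hθ : ∀ n x, |θ n x| ≤ 1)
    (hlim : ∀ x, Tendsto (fun n => θ n x) atTop (𝓝 (A.indicator 1 x)))
    (hw : ∀ n, IsWeakBound m f (fun x => (1 - θ n x) * G₁ x + θ n x * G₂ x)) :
    IsWeakBound m f (A.piecewise G₂ G₁) := by
  have hD : MemLp (fun x => G₂ x - G₁ x) 2 m := h₂.memLp.sub h₁.memLp
  obtain ⟨k1, k2⟩ := tendsto_eLpNorm_mul (m := m) (θ := θ) (θ₀ := A.indicator 1) (K := 1)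
    (g := fun _ x => G₂ x - G₁ x) (G := fun x => G₂ x - G₁ x)
    (fun n => (hθm n).aestronglyMeasurable) (fun n => Eventually.of_forall (hθ n))
    (Eventually.of_forall hlim) (fun _ => hD) hD (by simp)
  have he : A.piecewise G₂ G₁ = fun x => G₁ x + A.indicator 1 x * (G₂ x - G₁ x) := by
    ext x
    by_cases hx : x ∈ A <;> simp [hx]
  rw [he]
  refine tendsto_bound hw (h₁.memLp.add k1) (k2.congr fun n => ?_)
  congr 1
  ext x
  ring

variable [BorelSpace X]

open Classical in
/-- Weak bounds can be interchanged on Borel sets. -/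
theorem piecewise (hm : ∀ B : Set X, Bornology.IsBounded B → m B < ∞) {f : X → ℝ} {A : Set X}
    (hA : MeasurableSet A) : ∀ ⦃G₁ G₂ : X → ℝ⦄, IsWeakBound m f G₁ → IsWeakBound m f G₂ →
    IsWeakBound m f (A.piecewise G₂ G₁) := by
  -- Disjointness plays no role: `G₂` is put in successively on `B 0`, `B 1`, and so on, and the
  -- indicators of the finite unions converge pointwise.
  have hunion : ∀ B : ℕ → Set X, (∀ i, MeasurableSet (B i)) →
      (∀ i ⦃G₁ G₂ : X → ℝ⦄, IsWeakBound m f G₁ → IsWeakBound m f G₂ →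
        IsWeakBound m f ((B i).piecewise G₂ G₁)) →
      ∀ ⦃G₁ G₂ : X → ℝ⦄, IsWeakBound m f G₁ → IsWeakBound m f G₂ →
        IsWeakBound m f ((⋃ i, B i).piecewise G₂ G₁) := by
    intro B hB ih G₁ G₂ h₁ h₂
    set C : ℕ → Set X := fun n => ⋃ i ∈ Finset.range n, B i
    have hC : ∀ n, IsWeakBound m f ((C n).piecewise G₂ G₁) := by
      intro n
      induction n with
      | zero =>
        have : C 0 = ∅ := by simp [C]
        rw [this, Set.piecewise_empty]
        exact h₁
      | succ n ihn =>
        have : (C (n + 1)).piecewise G₂ G₁ = (B n).piecewise G₂ ((C n).piecewise G₂ G₁) := by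
          ext x
          have hx : x ∈ C (n + 1) ↔ x ∈ B n ∨ x ∈ C n := by
            simp only [C, Finset.range_add_one, Finset.set_biUnion_insert]
            rfl
          by_cases h1 : x ∈ B n <;> by_cases h2 : x ∈ C n <;> simp [Set.piecewise, hx, h1, h2]
        rw [this]
        exact ih n ihn h₂
    have hCm : ∀ n, MeasurableSet (C n) := fun n =>
      Finset.measurableSet_biUnion _ fun i _ => hB i
    refine piecewise_of_tendsto h₁ h₂ (θ := fun n => (C n).indicator 1)
      (fun n => measurable_one.indicator (hCm n)) (fun n x => ?_) (fun x => ?_) (fun n => ?_)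
    · by_cases hx : x ∈ C n <;> simp [hx]
    · refine tendsto_const_nhds.congr' ?_
      by_cases hx : x ∈ ⋃ i, B i
      · obtain ⟨i, hi⟩ := Set.mem_iUnion.1 hx
        filter_upwards [eventually_gt_atTop i] with n hn
        have : x ∈ C n := Set.mem_biUnion (Finset.mem_coe.2 (Finset.mem_range.2 hn)) hi
        simp [hx, this]
      · filter_upwards with n
        have : x ∉ C n := fun h => by
          obtain ⟨i, -, hi⟩ := Set.mem_iUnion₂.1 h
          exact hx (Set.mem_iUnion.2 ⟨i, hi⟩)
        rw [Set.indicator_of_notMem hx, Set.indicator_of_notMem this]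
    · convert hC n using 1
      ext x
      by_cases hx : x ∈ C n <;> simp [hx]
  -- The cutoffs `min 1 (n * dist(x, Uᶜ))` increase to the indicator of `U`. They are supported in
  -- the closure of `U`, which has finite measure because `U` is bounded.
  have hopen : ∀ U : Set X, IsOpen U → Bornology.IsBounded U → ∀ ⦃G₁ G₂ : X → ℝ⦄,
      IsWeakBound m f G₁ → IsWeakBound m f G₂ → IsWeakBound m f (U.piecewise G₂ G₁) := by
    intro U hU hUb G₁ G₂ h₁ h₂
    -- The distance to the empty set is `0` by convention, so the whole space is treated apart.
    by_cases hne : (Uᶜ).Nonempty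
    · set χ : ℕ → X → ℝ := fun n x => min 1 (n * Metric.infDist x Uᶜ)
      have hχL : ∀ n : ℕ, LipschitzWith n (χ n) := by
        intro n
        have h1 : LipschitzWith (n : ℝ≥0) (fun t : ℝ => (n : ℝ) * t) := by
          refine LipschitzWith.of_dist_le_mul fun a b => ?_
          rw [Real.dist_eq, Real.dist_eq, ← mul_sub, abs_mul, Nat.abs_cast]
          simp
        have h2 := (h1.comp (Metric.lipschitz_infDist_pt Uᶜ)).const_min 1
        rw [mul_one] at h2
        exact h2
      have h01 : ∀ n x, χ n x ∈ Set.Icc 0 1 := fun n x =>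
        ⟨le_min zero_le_one (mul_nonneg (Nat.cast_nonneg n) Metric.infDist_nonneg), min_le_left _ _⟩
      have hoff : ∀ n x, x ∉ U → χ n x = 0 := fun n x hx => by
        simp [χ, Metric.infDist_zero_of_mem (show x ∈ Uᶜ from hx)]
      refine piecewise_of_tendsto h₁ h₂ (θ := χ) (fun n => (hχL n).continuous.measurable)
        (fun n x => ?_) (fun x => ?_) (fun n => ?_)
      · rw [abs_of_nonneg (h01 n x).1]
        exact (h01 n x).2
      · by_cases hx : x ∈ U
        · have hpos : 0 < Metric.infDist x Uᶜ :=
            (hU.isClosed_compl.notMem_iff_infDist_pos hne).1 (fun h => h hx)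
          refine tendsto_const_nhds.congr' ?_
          have : Tendsto (fun n : ℕ => (n : ℝ) * Metric.infDist x Uᶜ) atTop atTop :=
            tendsto_natCast_atTop_atTop.atTop_mul_const hpos
          filter_upwards [this.eventually_ge_atTop 1] with n hn
          simp [χ, hx, min_eq_left hn]
        · simp only [hoff _ x hx, Set.indicator_of_notMem hx]
          exact tendsto_const_nhds
      · refine mix_cutoff h₁ h₂ (hχL n) (h01 n) (isClosed_closure (s := U)) (hm _ hUb.closure) ?_
        exact fun x hx => hoff n x fun h => hx (subset_closure h)
    · have hU' : U = Set.univ := by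
        rw [Set.not_nonempty_iff_eq_empty, Set.compl_empty_iff] at hne
        exact hne
      subst hU'
      simpa using h₂
  refine MeasurableSet.induction_on_open (C := fun A _ => ∀ ⦃G₁ G₂ : X → ℝ⦄,
      IsWeakBound m f G₁ → IsWeakBound m f G₂ → IsWeakBound m f (A.piecewise G₂ G₁))
    ?_ ?_ ?_ A hA
  · intro U hU G₁ G₂ h₁ h₂
    rcases isEmpty_or_nonempty X with h | ⟨⟨x₀⟩⟩
    · convert h₁
    · have := hunion (fun n => U ∩ Metric.ball x₀ n)
        (fun n => (hU.inter Metric.isOpen_ball).measurableSet)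
        (fun n => hopen _ (hU.inter Metric.isOpen_ball)
          (Metric.isBounded_ball.subset Set.inter_subset_right)) h₁ h₂
      rw [← Set.inter_iUnion, Metric.iUnion_ball_nat, Set.inter_univ] at this
      exact this
  · intro B hB ih G₁ G₂ h₁ h₂
    rw [Set.piecewise_compl]
    exact ih h₂ h₁
  · intro B _ hB ih
    exact hunion B hB ih

/-- Gluing two bounds along `{a ≤ b}` shows that the class is closed under `⊓`. Its infimum is then
the limit of a decreasing sequence of bounds; dominated by the first of them, the convergence holds
in `L²`, so the limit is itself a bound. -/
theorem exists_isLeast (hm : ∀ B : Set X, Bornology.IsBounded B → m B < ∞) {f : X → ℝ}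
    (hne : ∃ G, IsWeakBound m f G) : ∃ G₀, IsLeast {G : L0 m | IsWeakBound m f G} G₀ := by
  classical
  obtain ⟨G, hG⟩ := hne
  have h1 : {G : L0 m | IsWeakBound m f G}.Nonempty :=
    ⟨AEEqFun.mk G hG.memLp.1, hG.congr_bound (AEEqFun.coeFn_mk _ _).symm⟩
  have h2 : 0 ∈ lowerBounds {G : L0 m | IsWeakBound m f G} := fun G hG =>
    L0.nonneg_iff.2 (IsWeakBound.nonneg hG)
  have h3 : InfClosed {G : L0 m | IsWeakBound m f G} := by
    intro a ha b hb
    have h := piecewise hm (measurableSet_le a.measurable b.measurable) hb ha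
    refine IsWeakBound.congr_bound h ?_
    filter_upwards [AEEqFun.coeFn_inf a b] with x hx
    rw [hx]
    by_cases hab : a x ≤ b x
    · rw [Set.piecewise_eq_of_mem _ _ _ (show x ∈ {x | a x ≤ b x} from hab), inf_eq_left.2 hab]
    · rw [Set.piecewise_eq_of_notMem _ _ _ (show x ∉ {x | a x ≤ b x} from hab),
        inf_eq_right.2 (not_le.1 hab).le]
  obtain ⟨g, F, hg, hF, hmono, hlim⟩ := L0.exists_isGLB_of_infClosed h1 ⟨0, h2⟩ h3
  refine ⟨g, ?_, hg.1⟩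
  have hF0 : ∀ n, IsWeakBound m f (F n) := hF
  have hb : ∀ᵐ x ∂m, ∀ n, 0 ≤ F n x ∧ F n x ≤ F 0 x := ae_all_iff.2 fun n => by
    filter_upwards [(hF0 n).nonneg, L0.le_iff.1 (hmono (Nat.zero_le n))] with x h1 h2
    exact ⟨h1, h2⟩
  have hgb : ∀ᵐ x ∂m, 0 ≤ g x ∧ g x ≤ F 0 x := by
    filter_upwards [hb, hlim] with x h1 h2
    exact ⟨ge_of_tendsto' h2 fun n => (h1 n).1, le_of_tendsto' h2 fun n => (h1 n).2⟩
  have hgm : MemLp g 2 m := by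
    refine (hF0 0).memLp.mono g.aestronglyMeasurable ?_
    filter_upwards [hgb] with x hx
    rw [Real.norm_of_nonneg hx.1, Real.norm_of_nonneg (hx.1.trans hx.2)]
    exact hx.2
  refine tendsto_bound hF0 hgm (tendsto_eLpNorm_of_dominated (hF0 0).memLp
    (fun n => ((hF0 n).memLp.sub hgm).1) (fun n => ?_) ?_)
  · filter_upwards [hb, hgb] with x h1 h2
    rw [abs_le]
    constructor <;> linarith [h1 n]
  · filter_upwards [hlim] with x hx
    exact tendsto_sub_nhds_zero_iff.2 hx

end IsWeakBound

end Minimal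

/-! ## Convex combinations of tails of sequences -/

section Tails

theorem tendsto_of_mem_convexHull_tail {E : Type*} [SeminormedAddCommGroup E] [NormedSpace ℝ E]
    {a p : ℕ → E} {y : E} (ha : Tendsto a atTop (𝓝 y))
    (hp : ∀ n, p n ∈ convexHull ℝ (a '' Set.Ici n)) : Tendsto p atTop (𝓝 y) := by
  rw [Metric.tendsto_atTop] at ha ⊢
  intro ε hε
  obtain ⟨N, hN⟩ := ha ε hε
  refine ⟨N, fun n hn => ?_⟩
  have hsub : convexHull ℝ (a '' Set.Ici n) ⊆ Metric.ball y ε :=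
    convexHull_min (Set.image_subset_iff.2 fun k hk => hN k (hn.trans hk)) (convex_ball y ε)
  exact hsub (hp n)

/-- Mazur's lemma for tails: a functional strictly separating `y` from the closed hull would
contradict weak convergence. -/
theorem mem_closure_convexHull_of_weak {E : Type*} [NormedAddCommGroup E] [NormedSpace ℝ E]
    {a : ℕ → E} {y : E} (ha : ∀ f : E →L[ℝ] ℝ, Tendsto (fun n => f (a n)) atTop (𝓝 (f y)))
    (n : ℕ) : y ∈ closure (convexHull ℝ (a '' Set.Ici n)) := by
  by_contra h
  obtain ⟨f, c, h1, h2⟩ := geometric_hahn_banach_closed_point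
    ((convex_convexHull ℝ (a '' Set.Ici n)).closure) isClosed_closure h
  refine absurd (le_of_tendsto (ha f) ?_) (not_le.2 h2)
  filter_upwards [eventually_ge_atTop n] with k hk
  exact (h1 _ (subset_closure (subset_convexHull ℝ _ ⟨k, hk, rfl⟩))).le

variable {H : Type*} [NormedAddCommGroup H] [InnerProductSpace ℝ H]

/-- Midpoints of late terms stay in a convex set on which the norm is nearly at least `D`, while the
terms have norm nearly at most `D`. By the parallelogram law their differences are small. -/
theorem cauchySeq_of_tendsto_norm {K : ℕ → Set H} (hK : Antitone K) (hc : ∀ n, Convex ℝ (K n))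
    {p : ℕ → H} (hp : ∀ n, p n ∈ K n) {D : ℝ} (hD0 : 0 ≤ D)
    (hD : ∀ ε > 0, ∀ᶠ n in atTop, ‖p n‖ ≤ D + ε)
    (hlow : ∀ ε > 0, ∃ N, ∀ x ∈ K N, D - ε ≤ ‖x‖) : CauchySeq p := by
  rw [Metric.cauchySeq_iff]
  intro ε hε
  -- The parallelogram law gives the squared distance at most `4 (D + δ)² - 4 (D² - 2 D δ) = 16 D δ
  -- + 4 δ²`. As `δ ≤ 1`, this is less than `δ (16 D + 8) ≤ ε²`.
  set δ := min 1 (ε ^ 2 / (16 * D + 8)) with hδ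
  have hδ0 : 0 < δ := lt_min one_pos (by positivity)
  have hδ1 : δ ≤ 1 := min_le_left _ _
  have hδ2 : δ * (16 * D + 8) ≤ ε ^ 2 := by
    rw [← le_div_iff₀ (by positivity)]
    exact min_le_right _ _
  obtain ⟨N₁, h1⟩ := eventually_atTop.1 (hD δ hδ0)
  obtain ⟨N₂, h2⟩ := hlow δ hδ0
  refine ⟨max N₁ N₂, fun i hi j hj => ?_⟩
  have hi1 := h1 i ((le_max_left _ _).trans hi)
  have hj1 := h1 j ((le_max_left _ _).trans hj)
  have hmid : (2⁻¹ : ℝ) • p i + (2⁻¹ : ℝ) • p j ∈ K N₂ :=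
    hc N₂ (hK ((le_max_right _ _).trans hi) (hp i)) (hK ((le_max_right _ _).trans hj) (hp j))
      (by norm_num) (by norm_num) (by norm_num)
  have h3 := h2 _ hmid
  rw [← smul_add, norm_smul, Real.norm_of_nonneg (by norm_num : (0 : ℝ) ≤ 2⁻¹)] at h3
  have h4 := parallelogram_law_with_norm ℝ (p i) (p j)
  rw [dist_eq_norm]
  have e1 : 4 * (D ^ 2 - 2 * D * δ) ≤ ‖p i + p j‖ ^ 2 := by
    have h5 := norm_nonneg (p i + p j)
    rcases le_total δ D with h | h
    · nlinarith
    · nlinarith [sq_nonneg ‖p i + p j‖]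
  have e2 : ‖p i‖ ^ 2 ≤ (D + δ) ^ 2 := pow_le_pow_left₀ (norm_nonneg _) hi1 2
  have e3 : ‖p j‖ ^ 2 ≤ (D + δ) ^ 2 := pow_le_pow_left₀ (norm_nonneg _) hj1 2
  refine lt_of_pow_lt_pow_left₀ 2 hε.le ?_
  nlinarith [sq_nonneg δ, mul_pos hδ0 hδ0]

/-- A decreasing sequence of convex sets meeting a fixed ball has a convergent selection. -/
theorem exists_cauchySeq_of_convex {K : ℕ → Set H} (hK : Antitone K) (hc : ∀ n, Convex ℝ (K n))
    {R : ℝ} (hne : ∀ n, ∃ x ∈ K n, ‖x‖ ≤ R) : ∃ p : ℕ → H, (∀ n, p n ∈ K n) ∧ CauchySeq p := by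
  set d : ℕ → ℝ := fun n => Metric.infDist 0 (K n)
  have hKne : ∀ n, (K n).Nonempty := fun n => let ⟨x, hx, _⟩ := hne n; ⟨x, hx⟩
  have hd : ∀ n, ∀ x ∈ K n, d n ≤ ‖x‖ := fun n x hx => by
    rw [← dist_zero_left]
    exact Metric.infDist_le_dist_of_mem hx
  have hmono : Monotone d := fun i j hij => Metric.infDist_le_infDist_of_subset (hK hij) (hKne j)
  have hbdd : BddAbove (Set.range d) := by
    refine ⟨R, ?_⟩
    rintro _ ⟨n, rfl⟩
    obtain ⟨x, hx, hxR⟩ := hne n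
    exact (hd n x hx).trans hxR
  set D := ⨆ n, d n
  have hdD : ∀ n, d n ≤ D := le_ciSup hbdd
  have h1 : ∀ n : ℕ, ∃ x ∈ K n, ‖x‖ < d n + 1 / ((n : ℝ) + 1) := by
    intro n
    obtain ⟨x, hx, hlt⟩ := (Metric.infDist_lt_iff (hKne n)).1
      (lt_add_of_pos_right (d n) (by positivity : 0 < 1 / ((n : ℝ) + 1)))
    exact ⟨x, hx, by rwa [dist_zero_left] at hlt⟩
  choose p hp hpn using h1
  refine ⟨p, hp, cauchySeq_of_tendsto_norm hK hc hp (D := D)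
    (Metric.infDist_nonneg.trans (hdD 0)) (fun ε hε => ?_) (fun ε hε => ?_)⟩
  · filter_upwards [tendsto_one_div_add_atTop_nhds_zero_nat (𝕜 := ℝ) |>.eventually_lt_const hε]
      with n hn
    linarith [hpn n, hdD n]
  · obtain ⟨N, hN⟩ := exists_lt_of_lt_ciSup (show D - ε < D by linarith)
    exact ⟨N, fun x hx => hN.le.trans (hd N x hx)⟩

theorem antitone_convexHull_tail {E : Type*} [AddCommGroup E] [Module ℝ E] (a : ℕ → E) :
    Antitone fun n => convexHull ℝ (a '' Set.Ici n) := fun _ _ h =>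
  convexHull_mono (Set.image_mono (Set.Ici_subset_Ici.2 h))

theorem mem_convexHull_tail {E : Type*} [AddCommGroup E] [Module ℝ E] (a : ℕ → E) (n : ℕ) :
    a n ∈ convexHull ℝ (a '' Set.Ici n) :=
  subset_convexHull ℝ _ ⟨n, Set.mem_Ici.2 le_rfl, rfl⟩

/-- Serves to apply the coefficients of one convex combination to a second sequence simultaneously.
-/
theorem exists_lift_convexHull {E F : Type*} [AddCommGroup E] [Module ℝ E] [AddCommGroup F]
    [Module ℝ F] (b : ℕ → E) (a : ℕ → F) {S : Set ℕ} {x : F} (hx : x ∈ convexHull ℝ (a '' S)) :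
    ∃ h, (h, x) ∈ convexHull ℝ ((fun k => (b k, a k)) '' S) := by
  have h1 := (LinearMap.snd ℝ E F).image_convexHull ((fun k => (b k, a k)) '' S)
  rw [Set.image_image] at h1
  have h2 : x ∈ (LinearMap.snd ℝ E F) '' convexHull ℝ ((fun k => (b k, a k)) '' S) := by
    rw [h1]
    exact hx
  obtain ⟨⟨h, y⟩, hy, rfl⟩ := h2
  exact ⟨h, hy⟩

theorem mem_of_mem_convexHull_image {E : Type*} [AddCommGroup E] [Module ℝ E] {P : Set E}
    (hP : Convex ℝ P) {a : ℕ → E} {S : Set ℕ} (h : ∀ k ∈ S, a k ∈ P) {x : E}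
    (hx : x ∈ convexHull ℝ (a '' S)) : x ∈ P :=
  convexHull_min (Set.image_subset_iff.2 h) hP hx

theorem map_mem_convexHull {E F : Type*} [AddCommGroup E] [Module ℝ E] [AddCommGroup F]
    [Module ℝ F] (T : E →ₗ[ℝ] F) (a : ℕ → E) {S : Set ℕ} {x : E}
    (hx : x ∈ convexHull ℝ (a '' S)) : T x ∈ convexHull ℝ ((fun k => T (a k)) '' S) := by
  have h1 := T.image_convexHull (a '' S)
  rw [Set.image_image] at h1
  rw [← h1]
  exact ⟨x, hx, rfl⟩

end Tails

/-! ### Weak limits and bounded sequences of weak bounds. -/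

section WeakLimits

variable {X : Type u} [MetricSpace X] [MeasurableSpace X] {m : Measure X}

theorem _root_.MeasureTheory.Lp.tendsto_eLpNorm {X : Type u} [MeasurableSpace X] {m : Measure X}
    {a : ℕ → Lp ℝ 2 m} {b : Lp ℝ 2 m} (h : Tendsto a atTop (𝓝 b)) :
    Tendsto (fun n => eLpNorm (fun x => a n x - b x) 2 m) atTop (𝓝 0) :=
  (Lp.tendsto_Lp_iff_tendsto_eLpNorm' _ _).1 h

namespace IsWeakBound

variable [SFinite m] [BorelSpace X]

theorem convex_pairs :
    Convex ℝ {p : (X → ℝ) × Lp ℝ 2 m | IsWeakBound m p.1 p.2} := by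
  rintro ⟨f, F⟩ hf ⟨g, G⟩ hg a b ha hb -
  refine IsWeakBound.congr_bound (IsWeakBound.combo hf hg a b) ?_
  filter_upwards [Lp.coeFn_add (a • F) (b • G), Lp.coeFn_smul a F, Lp.coeFn_smul b G]
    with x h1 h2 h3
  change _ = (a • F + b • G : Lp ℝ 2 m) x
  rw [h1, Pi.add_apply, h2, h3, abs_of_nonneg ha, abs_of_nonneg hb]
  rfl

variable {f : X → ℝ} {F : ℕ → X → ℝ}

/-- Convex combinations of tails preserve weak bounds and a.e. limits. -/
theorem exists_of_mem_convexHull {g : ℕ → Lp ℝ 2 m} (hw : ∀ n, IsWeakBound m (F n) (g n))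
    (hF : ∀ᵐ x ∂m, Tendsto (fun n => F n x) atTop (𝓝 (f x))) {p : ℕ → Lp ℝ 2 m}
    (hp : ∀ n, p n ∈ convexHull ℝ (g '' Set.Ici n)) :
    ∃ h : ℕ → X → ℝ, (∀ n, IsWeakBound m (h n) (p n)) ∧
      ∀ᵐ x ∂m, Tendsto (fun n => h n x) atTop (𝓝 (f x)) := by
  choose h hh using fun n => exists_lift_convexHull F g (hp n)
  refine ⟨h, fun n => ?_, ?_⟩
  · have hmem : (h n, p n) ∈ {p : (X → ℝ) × Lp ℝ 2 m | IsWeakBound m p.1 p.2} :=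
      mem_of_mem_convexHull_image convex_pairs (fun k _ => hw k) (hh n)
    exact hmem
  · filter_upwards [hF] with x hx
    refine tendsto_of_mem_convexHull_tail hx fun n => ?_
    exact map_mem_convexHull ((LinearMap.proj x).comp (LinearMap.fst ℝ (X → ℝ) (Lp ℝ 2 m))) _
      (hh n)

/-- Convex combinations of the tails converge strongly to `G` by Mazur's lemma. The same
combinations of the functions keep the a.e. limit `f`. -/
theorem of_weak_limit {g : ℕ → Lp ℝ 2 m} {G : Lp ℝ 2 m} (hw : ∀ n, IsWeakBound m (F n) (g n))
    (hF : ∀ᵐ x ∂m, Tendsto (fun n => F n x) atTop (𝓝 (f x)))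
    (hg : ∀ φ : Lp ℝ 2 m →L[ℝ] ℝ, Tendsto (fun n => φ (g n)) atTop (𝓝 (φ G))) :
    IsWeakBound m f G := by
  have h1 : ∀ n : ℕ, ∃ p ∈ convexHull ℝ (g '' Set.Ici n), dist G p < 1 / ((n : ℝ) + 1) :=
    fun n => Metric.mem_closure_iff.1 (mem_closure_convexHull_of_weak hg n) _ (by positivity)
  choose p hp hpG using h1
  obtain ⟨h, hh, hlim⟩ := exists_of_mem_convexHull hw hF hp
  refine of_tendsto hh (Lp.memLp G) hlim (Lp.tendsto_eLpNorm ?_)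
  rw [tendsto_iff_dist_tendsto_zero]
  refine squeeze_zero (fun _ => dist_nonneg) (fun n => ?_)
    (tendsto_one_div_add_atTop_nhds_zero_nat (𝕜 := ℝ))
  rw [dist_comm]
  exact (hpG n).le

/-- Weak compactness is avoided: elements of nearly minimal norm in the hulls of the tails form a
Cauchy sequence, and its limit inherits both the bound property and the norm estimate. -/
theorem of_bounded {g : ℕ → Lp ℝ 2 m} (hw : ∀ n, IsWeakBound m (F n) (g n))
    (hF : ∀ᵐ x ∂m, Tendsto (fun n => F n x) atTop (𝓝 (f x))) {R : ℝ} (hg : ∀ n, ‖g n‖ ≤ R) :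
    ∃ G : Lp ℝ 2 m, IsWeakBound m f G ∧ ‖G‖ ≤ R := by
  obtain ⟨p, hp, hcau⟩ := exists_cauchySeq_of_convex (antitone_convexHull_tail g)
    (fun n => convex_convexHull ℝ _) (fun n => ⟨g n, mem_convexHull_tail g n, hg n⟩)
  obtain ⟨G, hG⟩ := cauchySeq_tendsto_of_complete hcau
  obtain ⟨h, hh, hlim⟩ := exists_of_mem_convexHull hw hF hp
  refine ⟨G, of_tendsto hh (Lp.memLp G) hlim (Lp.tendsto_eLpNorm hG), ?_⟩
  refine le_of_tendsto' hG.norm fun n => ?_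
  have hsub : convexHull ℝ (g '' Set.Ici n) ⊆ Metric.closedBall 0 R :=
    convexHull_min (Set.image_subset_iff.2 fun k _ => by simpa using hg k)
      (convex_closedBall 0 R)
  simpa using hsub (hp n)

/-- Uniformly bounded functions with convergent weak bounds: the limit of a sequence of convex
combinations. -/
theorem exists_of_bounded_functions {b : ℕ → X → ℝ} {B : X → ℝ} {K : ℝ}
    (hw : ∀ n, IsWeakBound m (F n) (b n)) (hK : ∀ n x, |F n x| ≤ K) (hB : MemLp B 2 m)
    (hb : Tendsto (fun n => eLpNorm (fun x => b n x - B x) 2 m) atTop (𝓝 0)) :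
    ∃ θ : X → ℝ, IsWeakBound m θ B ∧
      ∀ᵐ x ∂m, ∀ t, Tendsto (fun n => F n x) atTop (𝓝 t) → θ x = t := by
  have hFm : ∀ n, AEStronglyMeasurable (F n) m.toFinite := fun n =>
    (hw n).aestronglyMeasurable.mono_ac (toFinite_absolutelyContinuous m)
  have hFL : ∀ n, MemLp (F n) 2 m.toFinite := fun n =>
    MemLp.of_bound (hFm n) K (Eventually.of_forall (hK n))
  -- The functions need not converge, but they are bounded, hence bounded in `L²` of a finite
  -- measure equivalent to `m`. Convex combinations converging there are formed, and their
  -- coefficients are shared with the bounds `b n`. Wherever `F n x` does converge, the combinations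
  -- converge to the same value.
  set a : ℕ → Lp ℝ 2 m.toFinite := fun n => (hFL n).toLp (F n)
  set β : ℕ → Lp ℝ 2 m := fun n => (hw n).memLp.toLp (b n)
  have hβ : Tendsto β atTop (𝓝 (hB.toLp B)) :=
    (Lp.tendsto_Lp_iff_tendsto_eLpNorm'' _ _ _ _).2 hb
  have ha : ∀ n, ‖a n‖ ≤ ‖(memLp_const K : MemLp (fun _ => K) 2 m.toFinite).toLp‖ := by
    intro n
    refine Lp.norm_le_norm_of_ae_le ?_
    filter_upwards [MemLp.coeFn_toLp (hFL n),
      MemLp.coeFn_toLp (memLp_const K : MemLp (fun _ => K) 2 m.toFinite)] with x h1 h2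
    rw [h1, h2]
    exact (hK n x).trans (le_abs_self K)
  obtain ⟨p, hp, hcau⟩ := exists_cauchySeq_of_convex (antitone_convexHull_tail a)
    (fun n => convex_convexHull ℝ _) (fun n => ⟨a n, mem_convexHull_tail a n, ha n⟩)
  obtain ⟨θ, hθ⟩ := cauchySeq_tendsto_of_complete hcau
  choose q hq using fun n => exists_lift_convexHull (fun k => (F k, β k)) a (hp n)
  have hqw : ∀ n, IsWeakBound m (q n).1 (q n).2 := fun n => by
    have h1 := map_mem_convexHull (LinearMap.fst ℝ ((X → ℝ) × Lp ℝ 2 m) (Lp ℝ 2 m.toFinite)) _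
      (hq n)
    have hmem : q n ∈ {p : (X → ℝ) × Lp ℝ 2 m | IsWeakBound m p.1 p.2} :=
      mem_of_mem_convexHull_image convex_pairs
        (fun k _ => (hw k).congr_bound (MemLp.coeFn_toLp (hw k).memLp).symm) h1
    exact hmem
  have hq2 : Tendsto (fun n => (q n).2) atTop (𝓝 (hB.toLp B)) :=
    tendsto_of_mem_convexHull_tail hβ fun n => map_mem_convexHull
      ((LinearMap.snd ℝ (X → ℝ) (Lp ℝ 2 m)).comp
        (LinearMap.fst ℝ ((X → ℝ) × Lp ℝ 2 m) (Lp ℝ 2 m.toFinite))) _ (hq n)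
  have hqp : ∀ n, (q n).1 =ᵐ[m.toFinite] p n := by
    intro n
    have hconv : Convex ℝ {z : ((X → ℝ) × Lp ℝ 2 m) × Lp ℝ 2 m.toFinite |
        z.1.1 =ᵐ[m.toFinite] z.2} := by
      rintro ⟨⟨f₁, B₁⟩, a₁⟩ h₁ ⟨⟨f₂, B₂⟩, a₂⟩ h₂ s t - - -
      have h₁' : f₁ =ᵐ[m.toFinite] a₁ := h₁
      have h₂' : f₂ =ᵐ[m.toFinite] a₂ := h₂
      change s • f₁ + t • f₂ =ᵐ[m.toFinite] (s • a₁ + t • a₂ : Lp ℝ 2 m.toFinite)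
      filter_upwards [h₁', h₂', Lp.coeFn_add (s • a₁) (t • a₂), Lp.coeFn_smul s a₁,
        Lp.coeFn_smul t a₂] with x e1 e2 e3 e4 e5
      rw [e3, Pi.add_apply, Pi.add_apply, e4, e5, Pi.smul_apply, Pi.smul_apply, Pi.smul_apply,
        Pi.smul_apply, e1, e2]
    exact mem_of_mem_convexHull_image hconv
      (fun k _ => (MemLp.coeFn_toLp (hFL k)).symm) (hq n)
  obtain ⟨φ, hφ, hlim⟩ := (tendstoInMeasure_of_tendsto_Lp hθ).exists_seq_tendsto_ae
  have hqp' := ae_all_iff.2 hqp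
  have hlim' : ∀ᵐ x ∂m, Tendsto (fun n => (q (φ n)).1 x) atTop (𝓝 (θ x)) := by
    rw [← ae_toFinite (μ := m)]
    filter_upwards [hlim, hqp'] with x h1 h2
    simpa only [h2] using h1
  refine ⟨θ, of_tendsto (fun n => hqw (φ n)) hB hlim' ?_, ?_⟩
  · have h1 := (Lp.tendsto_eLpNorm hq2).comp hφ.tendsto_atTop
    refine h1.congr fun n => eLpNorm_congr_ae ?_
    filter_upwards [MemLp.coeFn_toLp hB] with x hx
    rw [hx]
  · filter_upwards [hlim'] with x hx t ht
    refine tendsto_nhds_unique hx ?_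
    have h1 : Tendsto (fun n => (q n).1 x) atTop (𝓝 t) := by
      refine tendsto_of_mem_convexHull_tail ht fun n => ?_
      exact map_mem_convexHull ((LinearMap.proj x).comp
        ((LinearMap.fst ℝ (X → ℝ) (Lp ℝ 2 m)).comp
        (LinearMap.fst ℝ ((X → ℝ) × Lp ℝ 2 m) (Lp ℝ 2 m.toFinite)))) _ (hq n)
    exact h1.comp hφ.tendsto_atTop

end IsWeakBound

end WeakLimits

/-! ## The Sobolev class and minimal weak upper gradients -/

section SobolevClass

variable {X : Type u} [MetricSpace X] [MeasurableSpace X] [BorelSpace X] {m : Measure X}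

theorem integral_mul_eq_inner {X : Type u} [MeasurableSpace X] {m : Measure X} {f φ : X → ℝ}
    (hf : MemLp f 2 m) (hφ : MemLp φ 2 m) :
    ∫ x, f x * φ x ∂m = inner ℝ (hφ.toLp φ) (hf.toLp f) := by
  rw [L2.inner_def]
  refine integral_congr_ae ?_
  filter_upwards [hf.coeFn_toLp, hφ.coeFn_toLp] with x h1 h2
  rw [h1, h2]
  simp

/-- Weak convergence is tested against `L²` functions, which by Riesz represent all functionals, so
`of_weak_limit` applies. -/
theorem IsRelaxedGradient.isWeakBound [SigmaFinite m] {f G : L0 m} (h : IsRelaxedGradient f G) :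
    IsWeakBound m f G := by
  obtain ⟨hG, fn, hL, hlim, hmem, hweak⟩ := h
  have hm : ∀ n, AEStronglyMeasurable (fn n) m := fun n =>
    (hL n).continuous.measurable.aestronglyMeasurable
  rw [tendstoL0_iff hm f.aestronglyMeasurable] at hlim
  obtain ⟨φ, hφ, hae⟩ := exists_subseq_ae_of_rho (fun n => (hm n).sub f.aestronglyMeasurable) hlim
  have hmem' : ∀ n, MemLp (lipR (fn n)) 2 m := hmem
  refine (IsWeakBound.of_weak_limit (F := fun n => fn (φ n))
    (g := fun n => (hmem' (φ n)).toLp (lipR (fn (φ n)))) (G := hG.toLp G)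
    (fun n => ?_) ?_ fun ℓ => ?_).congr_bound hG.coeFn_toLp
  · refine IsWeakBound.of_lipBd (hL _) (Lp.memLp _) ?_
    filter_upwards [(hmem' (φ n)).coeFn_toLp] with x hx
    rw [hx]
  · filter_upwards [hae] with x hx
    exact tendsto_sub_nhds_zero_iff.1 hx
  · set y := (InnerProductSpace.toDual ℝ (Lp ℝ 2 m)).symm ℓ
    have hy : ∀ z, ℓ z = inner ℝ y z := fun z =>
      (InnerProductSpace.toDual_symm_apply (𝕜 := ℝ) (x := z) (y := ℓ)).symm
    have h1 : ∀ {k : X → ℝ} (hk : MemLp k 2 m), ℓ (hk.toLp k) = ∫ x, k x * y x ∂m := by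
      intro k hk
      rw [integral_mul_eq_inner hk (Lp.memLp y), hy, Lp.toLp_coeFn]
    rw [h1]
    simp only [h1]
    exact (hweak y (Lp.memLp y)).comp hφ.tendsto_atTop

/-- A relaxed gradient asks for convergence of `lip_a` of the approximants themselves, not of upper
bounds. Minimality forces it: from above `lip_a (k n) ≤ g n → G`, and no convex combinations of the
tails can have norm staying below that of `G`. Hence `lip_a (k n)` is Cauchy in `L²`, and its limit,
a weak bound dominated by `G`, equals `G`. -/
theorem isRelaxedGradient_of_isLeast [SigmaFinite m] {f G : L0 m}
    (h : IsLeast {G : L0 m | IsWeakBound m f G} G) : IsRelaxedGradient f G := by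
  have hw : IsWeakBound m f G := h.1
  obtain ⟨k, g, hk, hg, hkg, hlim, hgG⟩ := hw.exists_seq
  have hmem : ∀ n, MemLp (lipR (k n)) 2 m := fun n => by
    refine (hg n).mono (measurable_lipR _).aestronglyMeasurable ?_
    filter_upwards [hkg n] with x hx
    rw [Real.norm_of_nonneg (lipR_nonneg _ _)]
    exact hx.trans (le_abs_self _)
  set a : ℕ → Lp ℝ 2 m := fun n => (hmem n).toLp (lipR (k n))
  set b : ℕ → Lp ℝ 2 m := fun n => (hg n).toLp (g n)
  set G' : Lp ℝ 2 m := hw.memLp.toLp G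
  have hb : Tendsto b atTop (𝓝 G') := (Lp.tendsto_Lp_iff_tendsto_eLpNorm'' _ _ _ _).2 hgG
  have hab : ∀ n, a n ≤ b n := fun n => by
    rw [← Lp.coeFn_le]
    filter_upwards [(hmem n).coeFn_toLp, (hg n).coeFn_toLp, hkg n] with x h1 h2 h3
    rwa [h1, h2]
  have ha0 : ∀ n, 0 ≤ a n := fun n => by
    rw [← Lp.coeFn_nonneg]
    filter_upwards [(hmem n).coeFn_toLp] with x h1
    rw [h1]
    exact lipR_nonneg _ _
  have haw : ∀ n, IsWeakBound m (k n) (a n) := fun n => by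
    refine IsWeakBound.of_lipBd (hk n) (Lp.memLp _) ?_
    filter_upwards [(hmem n).coeFn_toLp] with x hx
    rw [hx]
  have hleast : ∀ b : Lp ℝ 2 m, IsWeakBound m f b → G' ≤ b := by
    intro b hb
    have h1 : G ≤ (b : L0 m) := h.2 hb
    rw [← Lp.coeFn_le]
    filter_upwards [hw.memLp.coeFn_toLp, L0.le_iff.1 h1] with x h2 h3
    rwa [h2]
  have hG0 : 0 ≤ G' := by
    rw [← Lp.coeFn_nonneg]
    filter_upwards [hw.memLp.coeFn_toLp, hw.nonneg] with x h2 h3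
    rwa [h2]
  have hnorm : ∀ {x y : Lp ℝ 2 m}, 0 ≤ x → x ≤ y → ‖x‖ ≤ ‖y‖ := fun {x y} hx hxy =>
    norm_le_norm_of_abs_le_abs (by rwa [abs_of_nonneg hx, abs_of_nonneg (hx.trans hxy)])
  have hcau : CauchySeq a := by
    refine cauchySeq_of_tendsto_norm (antitone_convexHull_tail a)
      (fun n => convex_convexHull ℝ _) (mem_convexHull_tail a) (D := ‖G'‖) (norm_nonneg _)
      (fun ε hε => ?_) (fun ε hε => ?_)
    · filter_upwards [hb.norm.eventually_lt_const (lt_add_of_pos_right ‖G'‖ hε)] with n hn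
      exact (hnorm (ha0 n) (hab n)).trans hn.le
    · by_contra! hcon
      choose p hp hplt using hcon
      obtain ⟨q, hq, hqlim⟩ := IsWeakBound.exists_of_mem_convexHull haw hlim hp
      obtain ⟨B, hB, hBle⟩ := IsWeakBound.of_bounded hq hqlim fun n => (hplt n).le
      have := hnorm hG0 (hleast B hB)
      linarith
  obtain ⟨a', ha'⟩ := cauchySeq_tendsto_of_complete hcau
  have haG : a' = G' := by
    refine le_antisymm (le_of_tendsto_of_tendsto' ha' hb hab) (hleast a' ?_)
    exact IsWeakBound.of_tendsto haw (Lp.memLp _) hlim (Lp.tendsto_eLpNorm ha')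
  rw [haG] at ha'
  have hkm : ∀ n, AEStronglyMeasurable (k n) m := fun n =>
    (hk n).continuous.measurable.aestronglyMeasurable
  refine ⟨hw.memLp, k, hk, ?_, hmem, fun φ hφ => ?_⟩
  · rw [tendstoL0_iff hkm f.aestronglyMeasurable]
    refine tendsto_rho_of_ae (fun n => (hkm n).sub f.aestronglyMeasurable) ?_
    filter_upwards [hlim] with x hx
    exact tendsto_sub_nhds_zero_iff.2 hx
  · have h1 : ∀ n, ∫ x, (lipa (k n) x).toReal * φ x ∂m = inner ℝ (hφ.toLp φ) (a n) := fun n =>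
      integral_mul_eq_inner (hmem n) hφ
    simp only [h1]
    rw [integral_mul_eq_inner hw.memLp hφ]
    exact tendsto_const_nhds.inner ha'

variable [SigmaFinite m]

/-- The relaxed gradients are among the weak bounds, and the least weak bound is a relaxed gradient,
so the two classes share their least element. -/
theorem isLeast_wug (hm : ∀ B : Set X, Bornology.IsBounded B → m B < ∞) {f : L0 m}
    (hf : ∃ G, IsWeakBound m f G) : IsLeast {G : L0 m | IsWeakBound m f G} (wug f) := by
  obtain ⟨G, hG⟩ := IsWeakBound.exists_isLeast hm hf
  have h1 : wug f = G := leastOf_eq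
    ⟨isRelaxedGradient_of_isLeast hG, fun G' hG' => hG.2 (IsRelaxedGradient.isWeakBound hG')⟩
  rwa [h1]

theorem mem_S2_iff (hm : ∀ B : Set X, Bornology.IsBounded B → m B < ∞) {f : L0 m} :
    f ∈ S2 m ↔ ∃ G, IsWeakBound m f G :=
  ⟨fun ⟨G, hG⟩ => ⟨G, hG.isWeakBound⟩, fun h =>
    ⟨_, isRelaxedGradient_of_isLeast (isLeast_wug hm h)⟩⟩

theorem isWeakBound_wug (hm : ∀ B : Set X, Bornology.IsBounded B → m B < ∞) {f : L0 m}
    (hf : f ∈ S2 m) : IsWeakBound m f (wug f) :=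
  (isLeast_wug hm ((mem_S2_iff hm).1 hf)).1

theorem IsWeakBound.mem_S2 (hm : ∀ B : Set X, Bornology.IsBounded B → m B < ∞) {f : L0 m}
    {G : X → ℝ} (h : IsWeakBound m f G) : f ∈ S2 m := (mem_S2_iff hm).2 ⟨G, h⟩

theorem IsWeakBound.wug_le (hm : ∀ B : Set X, Bornology.IsBounded B → m B < ∞) {f : L0 m}
    {G : X → ℝ} (h : IsWeakBound m f G) : ∀ᵐ x ∂m, wug f x ≤ G x := by
  have h1 := (isLeast_wug hm ⟨G, h⟩).2
    (show AEEqFun.mk G h.memLp.1 ∈ {G : L0 m | IsWeakBound m f G} from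
      h.congr_bound (AEEqFun.coeFn_mk _ _).symm)
  filter_upwards [L0.le_iff.1 h1, AEEqFun.coeFn_mk G h.memLp.1] with x h2 h3
  rwa [h3] at h2

theorem wug_nonneg (hm : ∀ B : Set X, Bornology.IsBounded B → m B < ∞) {f : L0 m}
    (hf : f ∈ S2 m) : 0 ≤ wug f :=
  L0.nonneg_iff.2 (isWeakBound_wug hm hf).nonneg

theorem isWeakBound_combo (hm : ∀ B : Set X, Bornology.IsBounded B → m B < ∞) {f g : L0 m}
    (hf : f ∈ S2 m) (hg : g ∈ S2 m) (a b : ℝ) :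
    IsWeakBound m (a • f + b • g : L0 m) (|a| • wug f + |b| • wug g : L0 m) := by
  refine (((isWeakBound_wug hm hf).combo (isWeakBound_wug hm hg) a b).congr_fun ?_).congr_bound ?_
  · filter_upwards [AEEqFun.coeFn_add (a • f) (b • g), AEEqFun.coeFn_smul a f,
      AEEqFun.coeFn_smul b g] with x h1 h2 h3
    rw [h1, Pi.add_apply, h2, h3]
    rfl
  · filter_upwards [AEEqFun.coeFn_add (|a| • wug f) (|b| • wug g), AEEqFun.coeFn_smul |a| (wug f),
      AEEqFun.coeFn_smul |b| (wug g)] with x h1 h2 h3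
    rw [h1, Pi.add_apply, h2, h3]
    rfl

theorem S2_combo (hm : ∀ B : Set X, Bornology.IsBounded B → m B < ∞) {f g : L0 m}
    (hf : f ∈ S2 m) (hg : g ∈ S2 m) (a b : ℝ) : a • f + b • g ∈ S2 m :=
  (isWeakBound_combo hm hf hg a b).mem_S2 hm

theorem wug_combo_le (hm : ∀ B : Set X, Bornology.IsBounded B → m B < ∞) {f g : L0 m}
    (hf : f ∈ S2 m) (hg : g ∈ S2 m) (a b : ℝ) :
    wug (a • f + b • g) ≤ |a| • wug f + |b| • wug g :=
  (isLeast_wug hm ⟨_, isWeakBound_combo hm hf hg a b⟩).2 (isWeakBound_combo hm hf hg a b)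

theorem zero_mem_S2 (hm : ∀ B : Set X, Bornology.IsBounded B → m B < ∞) : (0 : L0 m) ∈ S2 m := by
  refine IsWeakBound.mem_S2 hm (G := fun _ => 0) ?_
  refine (IsWeakBound.of_lipBd (h := fun _ => 0) (LipBd.const 0) MemLp.zero' ?_).congr_fun
    (AEEqFun.coeFn_zero (β := ℝ)).symm
  exact Eventually.of_forall fun x => (LipNear.const 0 x).lipR_le le_rfl

/-- The vector space `S²(X)`. -/
def S2Submodule (hm : ∀ B : Set X, Bornology.IsBounded B → m B < ∞) : Submodule ℝ (L0 m) where
  carrier := S2 m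
  zero_mem' := zero_mem_S2 hm
  add_mem' {f g} hf hg := by
    have := S2_combo hm hf hg 1 1
    rwa [one_smul, one_smul] at this
  smul_mem' c f hf := by
    have := S2_combo hm hf hf c 0
    rwa [zero_smul, add_zero] at this

theorem wug_add_le (hm : ∀ B : Set X, Bornology.IsBounded B → m B < ∞) {f g : L0 m}
    (hf : f ∈ S2 m) (hg : g ∈ S2 m) : wug (f + g) ≤ wug f + wug g := by
  have := wug_combo_le hm hf hg 1 1
  rwa [one_smul, one_smul, abs_one, one_smul, one_smul] at this

theorem wug_smul (hm : ∀ B : Set X, Bornology.IsBounded B → m B < ∞) {f : L0 m}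
    (hf : f ∈ S2 m) (c : ℝ) : wug (c • f) = |c| • wug f := by
  have hle : ∀ (c : ℝ) {f : L0 m}, f ∈ S2 m → wug (c • f) ≤ |c| • wug f := fun c f hf => by
    have := wug_combo_le hm hf hf c 0
    rwa [zero_smul, add_zero, abs_zero, zero_smul, add_zero] at this
  have hcf : c • f ∈ S2 m := (S2Submodule hm).smul_mem c hf
  refine le_antisymm (hle c hf) ?_
  rcases eq_or_ne c 0 with rfl | hc
  · rw [abs_zero, zero_smul]
    exact wug_nonneg hm hcf
  · have h1 := smul_le_smul_of_nonneg_left (hle c⁻¹ hcf) (abs_nonneg c)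
    rwa [smul_smul, inv_mul_cancel₀ hc, one_smul, smul_smul, abs_inv,
      mul_inv_cancel₀ (abs_ne_zero.2 hc), one_smul] at h1

theorem wug_eq_zero_of_eq_zero (hm : ∀ B : Set X, Bornology.IsBounded B → m B < ∞) {f : L0 m}
    (hf : f ∈ S2 m) : ∀ᵐ x ∂m, f x = 0 → wug f x = 0 := by
  obtain ⟨G₀, hG₀, h0⟩ := (isWeakBound_wug hm hf).locality
  filter_upwards [hG₀.wug_le hm, h0, L0.nonneg_iff.1 (wug_nonneg hm hf)] with x h1 h2 h3 h4
  exact le_antisymm (h1.trans (h2 h4).le) h3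

theorem wug_sub_eq_zero (hm : ∀ B : Set X, Bornology.IsBounded B → m B < ∞) {f g : L0 m}
    (hf : f ∈ S2 m) (hg : g ∈ S2 m) : ∀ᵐ x ∂m, f x = g x → wug (f - g) x = 0 := by
  filter_upwards [wug_eq_zero_of_eq_zero hm ((S2Submodule hm).sub_mem hf hg),
    AEEqFun.coeFn_sub f g] with x h1 h2 h3
  refine h1 ?_
  rw [h2, Pi.sub_apply, h3, sub_self]

/-- Locality of minimal weak upper gradients. -/
theorem wug_le_of_eq (hm : ∀ B : Set X, Bornology.IsBounded B → m B < ∞) {f g : L0 m}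
    (hf : f ∈ S2 m) (hg : g ∈ S2 m) : ∀ᵐ x ∂m, f x = g x → wug f x ≤ wug g x := by
  have h0 : f - g ∈ S2 m := (S2Submodule hm).sub_mem hf hg
  have h1 := wug_add_le hm h0 hg
  rw [sub_add_cancel] at h1
  filter_upwards [wug_sub_eq_zero hm hf hg, L0.le_iff.1 h1,
    AEEqFun.coeFn_add (wug (f - g)) (wug g)] with x h2 h3 h4 h5
  rwa [h4, Pi.add_apply, h2 h5, zero_add] at h3

theorem nonempty_cotangentModule (hm : ∀ B : Set X, Bornology.IsBounded B → m B < ∞) :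
    Nonempty (CotangentModule.{u, u} m) := by
  obtain ⟨M, T, hM, hadd, hsmul, hnorm, hgen⟩ := PNModule.exists_generated
    (V := S2Submodule hm) (fun f => wug (f : L0 m))
    (fun f g => wug_add_le hm f.2 g.2) (fun c f => wug_smul hm f.2 c)
  refine ⟨⟨M, hM, fun f => T ⟨f, f.2⟩, ?_, fun f => hnorm _, hgen⟩⟩
  intro a b f g h hh
  rw [← hsmul, ← hsmul, ← hadd]
  congr 1
  exact Subtype.ext hh

end SobolevClass

/-! ## Metric-valued Sobolev maps -/

section Cutoff

variable {Y : Type v} [MetricSpace Y]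

/-- Products of bounded functions, Lipschitz on bounded sets, with compactly supported cutoffs. -/
theorem LipBd.exists_lipschitzWith_mul {h χ : Y → ℝ} (hh : LipBd h) {L : ℝ≥0}
    (hχ : LipschitzWith L χ) (hχ01 : ∀ y, χ y ∈ Set.Icc 0 1) {B : Set Y}
    (hB : Bornology.IsBounded B) (hχB : ∀ y ∉ B, χ y = 0) {M : ℝ} (hM : ∀ y, |h y| ≤ M) :
    ∃ K, LipschitzWith K fun y => χ y * h y := by
  obtain ⟨K, hK0, hK⟩ := lipBd_iff.1 hh B hB
  have hL : ∀ y z, |χ y - χ z| ≤ L * dist y z := fun y z => by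
    rw [← Real.dist_eq]
    exact hχ.dist_le_mul y z
  have key : ∀ y z, z ∉ B ∨ (y ∈ B ∧ z ∈ B) →
      |χ y * h y - χ z * h z| ≤ (K + L * |M|) * dist y z := by
    rintro y z (hz | ⟨hy, hz⟩)
    · have h1 : |χ y * h y - χ z * h z| = |χ y - χ z| * |h y| := by
        rw [hχB z hz, zero_mul, sub_zero, sub_zero, abs_mul]
      rw [h1]
      calc |χ y - χ z| * |h y| ≤ (L * dist y z) * |M| :=
            mul_le_mul (hL y z) ((hM y).trans (le_abs_self M)) (abs_nonneg _) (by positivity)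
        _ ≤ (K + L * |M|) * dist y z := by nlinarith [mul_nonneg hK0 (dist_nonneg (x := y) (y := z))]
    · have h1 : χ y * h y - χ z * h z = χ y * (h y - h z) + (χ y - χ z) * h z := by ring
      rw [h1]
      refine (abs_add_le _ _).trans ?_
      rw [abs_mul, abs_mul, abs_of_nonneg (hχ01 y).1, add_mul]
      refine add_le_add ?_ ?_
      · exact (mul_le_of_le_one_left (abs_nonneg _) (hχ01 y).2).trans (hK y hy z hz)
      · calc |χ y - χ z| * |h z| ≤ (L * dist y z) * |M| :=
              mul_le_mul (hL y z) ((hM z).trans (le_abs_self M)) (abs_nonneg _) (by positivity)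
          _ = L * |M| * dist y z := by ring
  refine ⟨⟨K + L * |M|, by positivity⟩, LipschitzWith.of_dist_le_mul fun y z => ?_⟩
  rw [Real.dist_eq]
  change _ ≤ (K + L * |M|) * dist y z
  by_cases hz : z ∈ B
  · by_cases hy : y ∈ B
    · exact key y z (Or.inr ⟨hy, hz⟩)
    · rw [abs_sub_comm, dist_comm]
      exact key z y (Or.inl hy)
  · exact key y z (Or.inl hz)

/-- Cutoff functions with small Lipschitz constants. -/
theorem exists_cutoff (y₀ : Y) (n : ℕ) : ∃ (χ : Y → ℝ) (L : ℝ≥0), (L : ℝ) = 1 / ((n : ℝ) + 1) ∧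
    LipschitzWith L χ ∧ (∀ y, χ y ∈ Set.Icc 0 1) ∧
    (∀ y ∉ Metric.ball y₀ (2 * ((n : ℝ) + 1)), χ y = 0) ∧
    ∀ y, dist y y₀ ≤ n → χ y = 1 := by
  have hn : (0 : ℝ) < (n : ℝ) + 1 := by positivity
  refine ⟨fun y => max 0 (min 1 (2 - 1 / ((n : ℝ) + 1) * dist y y₀)),
    ⟨1 / ((n : ℝ) + 1), by positivity⟩, rfl, ?_, fun y => ⟨le_max_left _ _,
      max_le zero_le_one (min_le_left _ _)⟩, fun y hy => ?_, fun y hy => ?_⟩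
  · have h1 : LipschitzWith ⟨1 / ((n : ℝ) + 1), by positivity⟩
        fun y => 2 - 1 / ((n : ℝ) + 1) * dist y y₀ := by
      refine LipschitzWith.of_dist_le_mul fun y z => ?_
      change _ ≤ (1 / ((n : ℝ) + 1)) * dist y z
      rw [Real.dist_eq, sub_sub_sub_cancel_left, ← mul_sub, abs_mul,
        abs_of_pos (by positivity : 0 < 1 / ((n : ℝ) + 1))]
      refine mul_le_mul_of_nonneg_left ?_ (by positivity)
      rw [abs_sub_comm]
      exact abs_dist_sub_le y z y₀
    exact (h1.const_min 1).const_max 0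
  · rw [Metric.mem_ball, not_lt] at hy
    refine max_eq_left ((min_le_right _ _).trans ?_)
    have : 2 ≤ 1 / ((n : ℝ) + 1) * dist y y₀ := by
      rw [one_div, le_inv_mul_iff₀ hn]
      linarith
    linarith
  · have h1 : 1 / ((n : ℝ) + 1) * dist y y₀ ≤ 1 := by
      rw [one_div, inv_mul_le_iff₀ hn]
      linarith
    change max 0 (min 1 (2 - 1 / ((n : ℝ) + 1) * dist y y₀)) = 1
    rw [min_eq_left (by linarith), max_eq_right zero_le_one]

end Cutoff

/-! ### The target measure and composition with Lipschitz functions. -/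

section SobolevMaps

variable {X : Type u} {Y : Type v} [MetricSpace X] [MeasurableSpace X]
  [MetricSpace Y] [MeasurableSpace Y] [BorelSpace Y] {m : Measure X} {u : X → Y}

/-- For `K > 0` the constraint says that `G` lies above the fixed element `K⁻¹ |D(f ∘ u)|`, which
passes to the infimum of all admissible `G`. For `K = 0` the constraint does not involve `G`. -/
theorem isLeast_mapGrad [SFinite m] (hu : (upperGradients m u).Nonempty) :
    IsLeast (upperGradients m u) (mapGrad m u) := by
  refine leastOf_isLeast ?_
  obtain ⟨g, hg⟩ := L0.exists_isGLB hu ⟨0, fun G hG => hG.2.1⟩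
  obtain ⟨G, hG⟩ := hu
  have hg0 : 0 ≤ g := hg.2 fun G hG => hG.2.1
  refine ⟨g, ⟨?_, hg0, hG.2.2.1, fun f K hf => ⟨(hG.2.2.2 f K hf).1, ?_⟩⟩, hg.1⟩
  · refine hG.1.mono g.aestronglyMeasurable ?_
    filter_upwards [L0.le_iff.1 (hg.1 hG), L0.nonneg_iff.1 hg0] with x h1 h2
    rw [Real.norm_of_nonneg h2, Real.norm_of_nonneg (h2.trans h1)]
    exact h1
  · rcases eq_or_ne K 0 with rfl | hK
    · have := (hG.2.2.2 f 0 hf).2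
      rwa [NNReal.coe_zero, zero_smul] at this ⊢
    · have hK0 : (0 : ℝ) < K := NNReal.coe_pos.2 (pos_iff_ne_zero.2 hK)
      have h1 : (K : ℝ)⁻¹ • wug (compLip m hG.2.2.1 hf) ≤ g := hg.2 fun G' hG' => by
        have := smul_le_smul_of_nonneg_left (hG'.2.2.2 f K hf).2 (inv_nonneg.2 hK0.le)
        rwa [smul_smul, inv_mul_cancel₀ hK0.ne', one_smul] at this
      have := smul_le_smul_of_nonneg_left h1 hK0.le
      rwa [smul_smul, mul_inv_cancel₀ hK0.ne', one_smul] at this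

namespace IsSobolevMap

theorem ae_of_target (hu : IsSobolevMap m u) {p : Y → Prop} (h : ∀ᵐ y ∂targetMeasure m u, p y) :
    ∀ᵐ x ∂m, 0 < mapGrad m u x → p (u x) :=
  (ae_restrict_iff' (measurableSet_posSet m u)).1
    ((quasiMeasurePreserving_posSet m hu.measurable).ae h)

section Target

variable [SFinite m]

theorem isLeast (hu : IsSobolevMap m u) : IsLeast (upperGradients m u) (mapGrad m u) :=
  isLeast_mapGrad hu.exists_upperGradient

theorem memLp_mapGrad (hu : IsSobolevMap m u) : MemLp (mapGrad m u) 2 m := hu.isLeast.1.1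

theorem mapGrad_nonneg (hu : IsSobolevMap m u) : ∀ᵐ x ∂m, 0 ≤ mapGrad m u x := L0.nonneg_iff.1 hu.isLeast.1.2.1

theorem isFiniteMeasure_targetMeasure (hu : IsSobolevMap m u) : IsFiniteMeasure (targetMeasure m u) := by
  have h1 : IsFiniteMeasure (m.withDensity fun x => ENNReal.ofReal (mapGrad m u x ^ 2)) :=
    isFiniteMeasure_withDensity_ofReal hu.memLp_mapGrad.integrable_sq.2
  exact Measure.isFiniteMeasure_map _ _

theorem targetMeasure_lt_top (hu : IsSobolevMap m u) (B : Set Y) : targetMeasure m u B < ∞ := by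
  have := hu.isFiniteMeasure_targetMeasure
  exact measure_lt_top _ _

/-- Null sets of the target measure pull back to null sets only inside `{|Du| > 0}`. The factor
`|Du|` reduces the statement elsewhere to `p 0 0`. -/
theorem ae_mul_of_target (hu : IsSobolevMap m u) {g g' : Y → ℝ} {p : ℝ → ℝ → Prop} (hp : p 0 0)
    (h : ∀ᵐ y ∂targetMeasure m u, ∀ t : ℝ, 0 ≤ t → p (g y * t) (g' y * t)) :
    ∀ᵐ x ∂m, p (g (u x) * mapGrad m u x) (g' (u x) * mapGrad m u x) := by
  filter_upwards [hu.ae_of_target h, hu.mapGrad_nonneg] with x h1 h2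
  rcases h2.eq_or_lt with h3 | h3
  · rw [← h3, mul_zero, mul_zero]
    exact hp
  · exact h1 h3 _ h2

theorem aestronglyMeasurable_comp_mul (hu : IsSobolevMap m u) {g : Y → ℝ}
    (hg : AEStronglyMeasurable g (targetMeasure m u)) :
    AEStronglyMeasurable (fun x => g (u x) * mapGrad m u x) m := by
  have h1 : AEStronglyMeasurable (fun x => hg.mk g (u x) * mapGrad m u x) m :=
    ((hg.stronglyMeasurable_mk.measurable.comp hu.measurable).mul
      (mapGrad m u).measurable).aestronglyMeasurable
  refine h1.congr ?_
  refine hu.ae_mul_of_target (g := hg.mk g) (g' := g) (p := fun a b => a = b) rfl ?_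
  filter_upwards [hg.ae_eq_mk] with y hy t _
  rw [hy]

/-- The change of variables for `u_*(|Du|² m)`: the weight is exactly the square of the factor
`|Du|`. -/
theorem eLpNorm_comp_mul (hu : IsSobolevMap m u) {g : Y → ℝ} (hg : AEStronglyMeasurable g (targetMeasure m u)) :
    eLpNorm (fun x => g (u x) * mapGrad m u x) 2 m = eLpNorm g 2 (targetMeasure m u) := by
  have h1 : ∀ {g : Y → ℝ}, Measurable g →
      eLpNorm (fun x => g (u x) * mapGrad m u x) 2 m = eLpNorm g 2 (targetMeasure m u) := by
    intro g hg
    rw [eLpNorm_eq_lintegral_rpow_enorm_toReal two_ne_zero ENNReal.ofNat_ne_top,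
      eLpNorm_eq_lintegral_rpow_enorm_toReal two_ne_zero ENNReal.ofNat_ne_top]
    congr 1
    simp only [ENNReal.toReal_ofNat, ENNReal.rpow_ofNat]
    have hg2 : Measurable fun y => ‖g y‖ₑ ^ 2 := hg.enorm.pow_const 2
    have hD : Measurable fun x => ENNReal.ofReal (mapGrad m u x ^ 2) := by fun_prop
    have h2 := lintegral_withDensity_eq_lintegral_mul m hD (hg2.comp hu.measurable)
    simp only [Function.comp_apply] at h2
    rw [targetMeasure, lintegral_map hg2 hu.measurable, h2]
    refine lintegral_congr fun x => ?_
    rw [enorm_mul, mul_pow, mul_comm]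
    congr 1
    rw [← enorm_pow, Real.enorm_of_nonneg (sq_nonneg _)]
  rw [eLpNorm_congr_ae hg.ae_eq_mk, ← h1 hg.stronglyMeasurable_mk.measurable]
  refine eLpNorm_congr_ae ?_
  refine hu.ae_mul_of_target (g := g) (g' := hg.mk g) (p := fun a b => a = b) rfl ?_
  filter_upwards [hg.ae_eq_mk] with y hy t _
  rw [hy]

theorem memLp_comp_mul (hu : IsSobolevMap m u) {g : Y → ℝ} (hg : MemLp g 2 (targetMeasure m u)) :
    MemLp (fun x => g (u x) * mapGrad m u x) 2 m :=
  ⟨hu.aestronglyMeasurable_comp_mul hg.1, by rw [hu.eLpNorm_comp_mul hg.1]; exact hg.2⟩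

end Target

variable [BorelSpace X] [SigmaFinite m]

/-- The chain rule for compositions with Lipschitz functions. -/
theorem isWeakBound_comp_lipschitz (hu : IsSobolevMap m u)
    (hm : ∀ B : Set X, Bornology.IsBounded B → m B < ∞)
    {h : Y → ℝ} {K : ℝ≥0} (hh : LipschitzWith K h) :
    IsWeakBound m (h ∘ u) (fun x => lipR h (u x) * mapGrad m u x) := by
  have := hu.isFiniteMeasure_targetMeasure
  obtain ⟨-, -, hmeas, hup⟩ := hu.isLeast.1
  have hcoe : ∀ {f : Y → ℝ} {K : ℝ≥0} (hf : LipschitzWith K f),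
      compLip m hmeas hf =ᵐ[m] f ∘ u := fun hf => AEEqFun.coeFn_mk _ _
  have hmem := (hup h K hh).1
  refine ((isWeakBound_wug hm hmem).congr_fun (hcoe hh)).mono ?_ (hu.memLp_comp_mul ?_)
  · obtain ⟨N, hN, C, hC, hNC⟩ := hu.essSeparable
    -- Where `h` is `q`-Lipschitz on a ball, it agrees there with a globally `q`-Lipschitz
    -- extension, and locality compares the two compositions on the preimage of the ball. Centres in
    -- `C`, radii `1 / (n + 1)` and rational `q` leave only countably many exceptional sets.
    have hkey : ∀ c ∈ C, ∀ (n : ℕ) (q : ℚ),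
        LipschitzOnWith (Real.toNNReal q) h (Metric.ball c (1 / ((n : ℝ) + 1))) →
        ∀ᵐ x ∂m, u x ∈ Metric.ball c (1 / ((n : ℝ) + 1)) →
          wug (compLip m hmeas hh) x ≤ (Real.toNNReal q : ℝ) * mapGrad m u x := by
      intro c _ n q hq
      obtain ⟨h', hh', heq⟩ := hq.extend_real
      obtain ⟨h1, h2⟩ := hup h' _ hh'
      filter_upwards [wug_le_of_eq hm hmem h1, L0.le_iff.1 h2, hcoe hh, hcoe hh',
        AEEqFun.coeFn_smul (Real.toNNReal q : ℝ) (mapGrad m u)] with x h3 h4 h5 h6 h7 hx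
      rw [h7] at h4
      refine (h3 ?_).trans h4
      rw [h5, h6]
      exact heq hx
    have hall : ∀ᵐ x ∂m, ∀ c ∈ C, ∀ (n : ℕ) (q : ℚ),
        LipschitzOnWith (Real.toNNReal q) h (Metric.ball c (1 / ((n : ℝ) + 1))) →
        u x ∈ Metric.ball c (1 / ((n : ℝ) + 1)) →
          wug (compLip m hmeas hh) x ≤ (Real.toNNReal q : ℝ) * mapGrad m u x := by
      rw [ae_ball_iff hC]
      intro c hc
      rw [ae_all_iff]
      intro n
      rw [ae_all_iff]
      intro q
      by_cases hq : LipschitzOnWith (Real.toNNReal q) h (Metric.ball c (1 / ((n : ℝ) + 1)))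
      · filter_upwards [hkey c hc n q hq] with x hx _
        exact hx
      · exact Eventually.of_forall fun x h => absurd h hq
    have hNae : ∀ᵐ x ∂m, x ∉ N := measure_eq_zero_iff_ae_notMem.1 hN
    filter_upwards [hall, hNae, hu.mapGrad_nonneg] with x h1 h2 h3
    have hcl : u x ∈ closure C := hNC ⟨x, h2, rfl⟩
    have hle : ∀ t : ℝ, lipR h (u x) < t → wug (compLip m hmeas hh) x ≤ t * mapGrad m u x := by
      intro t ht
      obtain ⟨q, hq1, hq2⟩ := exists_rat_btwn ht
      have hq0 : (0 : ℝ) ≤ q := (lipR_nonneg h (u x)).trans hq1.le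
      have hnear := hh.lipBd.lipNear hq1
      rw [LipNear, nhds_prod_eq, Filter.eventually_prod_self_iff
        (r := fun y z => |h y - h z| ≤ q * dist y z)] at hnear
      obtain ⟨S, hS, hSq⟩ := hnear
      obtain ⟨δ, hδ, hδS⟩ := Metric.mem_nhds_iff.1 hS
      obtain ⟨n, hn⟩ := exists_nat_one_div_lt (half_pos hδ)
      have hr : (0 : ℝ) < 1 / ((n : ℝ) + 1) := by positivity
      obtain ⟨c, hc, hcd⟩ := Metric.mem_closure_iff.1 hcl _ hr
      refine (h1 c hc n q ?_ hcd).trans ?_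
      · refine LipschitzOnWith.of_dist_le_mul fun y hy z hz => ?_
        have hsub : ∀ y ∈ Metric.ball c (1 / ((n : ℝ) + 1)), y ∈ S := fun y hy => by
          refine hδS ?_
          rw [Metric.mem_ball] at hy ⊢
          calc dist y (u x) ≤ dist y c + dist c (u x) := dist_triangle _ _ _
            _ < δ / 2 + δ / 2 := by
              rw [dist_comm c]
              exact add_lt_add (hy.trans hn) (hcd.trans hn)
            _ = δ := add_halves δ
        rw [Real.dist_eq, Real.coe_toNNReal _ hq0]
        exact hSq y (hsub y hy) z (hsub z hz)
      · rw [Real.coe_toNNReal _ hq0]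
        exact mul_le_mul_of_nonneg_right hq2.le h3
    have hcont : Tendsto (fun t : ℝ => t * mapGrad m u x) (𝓝[>] lipR h (u x))
        (𝓝 (lipR h (u x) * mapGrad m u x)) :=
      ((continuous_id.mul continuous_const).tendsto _).mono_left nhdsWithin_le_nhds
    refine ge_of_tendsto hcont ?_
    filter_upwards [self_mem_nhdsWithin] with t ht
    exact hle t ht
  · refine MemLp.of_bound (measurable_lipR h).aestronglyMeasurable K
      (Eventually.of_forall fun y => ?_)
    rw [Real.norm_of_nonneg (lipR_nonneg h y)]
    exact (hh.lipNear y).lipR_le K.2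

/-- The chain rule for compositions with bounded functions, Lipschitz on bounded sets. -/
theorem isWeakBound_comp (hu : IsSobolevMap m u)
    (hm : ∀ B : Set X, Bornology.IsBounded B → m B < ∞)
    {h g : Y → ℝ} (hh : LipBd h) {M : ℝ} (hM : ∀ y, |h y| ≤ M)
    (hg : MemLp g 2 (targetMeasure m u)) (hle : ∀ᵐ y ∂targetMeasure m u, lipR h y ≤ g y) :
    IsWeakBound m (h ∘ u) (fun x => g (u x) * mapGrad m u x) := by
  have := hu.isFiniteMeasure_targetMeasure
  rcases isEmpty_or_nonempty X with hX | ⟨⟨x₀⟩⟩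
  · refine IsWeakBound.of_lipBd (fun B _ => ⟨0, fun x => isEmptyElim x⟩) (hu.memLp_comp_mul hg)
      (Eventually.of_forall fun x => isEmptyElim x)
  -- The products `χ n * h` are globally Lipschitz. The cutoff of slope `1 / (n + 1)` costs `M / (n
  -- + 1)` in the bound, which after multiplication by `|Du| ∈ L²` vanishes in the limit.
  choose χ L hL hχL hχ01 hχ0 hχ1 using exists_cutoff (u x₀)
  have hc : ∀ n : ℕ, MemLp (fun y => g y + (L n : ℝ) * M) 2 (targetMeasure m u) := fun n =>
    hg.add (memLp_const _)
  have hlim := tendsto_one_div_add_atTop_nhds_zero_nat (𝕜 := ℝ)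
  refine IsWeakBound.of_tendsto (F := fun n x => χ n (u x) * h (u x))
    (g := fun n x => (g (u x) + (L n : ℝ) * M) * mapGrad m u x) (fun n => ?_)
    (hu.memLp_comp_mul hg) (Eventually.of_forall fun x => ?_) ?_
  · obtain ⟨K, hK⟩ := hh.exists_lipschitzWith_mul (hχL n) (hχ01 n) Metric.isBounded_ball (hχ0 n) hM
    refine (hu.isWeakBound_comp_lipschitz hm hK).mono ?_ (hu.memLp_comp_mul (hc n))
    refine hu.ae_mul_of_target (g := lipR fun y => χ n y * h y)
      (g' := fun y => g y + (L n : ℝ) * M) (p := fun a b => a ≤ b) le_rfl ?_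
    filter_upwards [hle] with y hy t ht
    refine mul_le_mul_of_nonneg_right ?_ ht
    exact (lipR_mul_cutoff_le hh (hχ01 n) (hχL n) hM y).trans (add_le_add_left hy _)
  · refine tendsto_const_nhds.congr' ?_
    obtain ⟨N, hN⟩ := exists_nat_ge (dist (u x) (u x₀))
    filter_upwards [eventually_ge_atTop N] with n hn
    rw [hχ1 n (u x) (hN.trans (Nat.cast_le.2 hn)), one_mul]
    rfl
  · refine tendsto_eLpNorm_of_dominated (G := fun x => |M| * ‖mapGrad m u x‖)
      (hu.memLp_mapGrad.norm.const_mul _) (fun n => ?_) (fun n => ?_) ?_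
    · exact ((hu.memLp_comp_mul (hc n)).sub (hu.memLp_comp_mul hg)).1
    · refine Eventually.of_forall fun x => ?_
      rw [← sub_mul, add_sub_cancel_left, abs_mul, abs_mul, NNReal.abs_eq, hL n]
      refine mul_le_mul_of_nonneg_right ?_ (abs_nonneg _)
      refine mul_le_of_le_one_left (abs_nonneg _) ?_
      rw [div_le_one (by positivity)]
      have : (0 : ℝ) ≤ n := Nat.cast_nonneg n
      linarith
    · refine Eventually.of_forall fun x => ?_
      have := (hlim.mul_const M).mul_const (mapGrad m u x)
      rw [zero_mul, zero_mul] at this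
      refine this.congr fun n => ?_
      rw [← sub_mul, add_sub_cancel_left, hL n]

end IsSobolevMap

end SobolevMaps

/-! ## Compositions with Sobolev functions -/

section Compositions

/-- A regularized tangent, with derivative bounded by `1 / (cos² + e)`. -/
theorem hasStrictDerivAt_tan_approx {e : ℝ} (he : 0 < e) (s : ℝ) :
    HasStrictDerivAt (fun s => Real.sin s * Real.cos s / (Real.cos s ^ 2 + e))
      ((Real.cos s ^ 2 + e * (Real.cos s ^ 2 - Real.sin s ^ 2)) / (Real.cos s ^ 2 + e) ^ 2) s := by
  have h1 := (Real.hasStrictDerivAt_sin s).mul (Real.hasStrictDerivAt_cos s)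
  have h2 := ((Real.hasStrictDerivAt_cos s).pow 2).add_const e
  have h0 : Real.cos s ^ 2 + e ≠ 0 := by positivity
  have h3 := h1.div h2 h0
  have h4 : (Real.cos s ^ 2 + e * (Real.cos s ^ 2 - Real.sin s ^ 2)) / (Real.cos s ^ 2 + e) ^ 2
      = ((Real.cos s * Real.cos s + Real.sin s * -Real.sin s) * (Real.cos s ^ 2 + e)
        - Real.sin s * Real.cos s * (((2 : ℕ) : ℝ) * Real.cos s ^ (2 - 1) * -Real.sin s))
          / (Real.cos s ^ 2 + e) ^ 2 := by
    congr 1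
    have := Real.sin_sq_add_cos_sq s
    push_cast
    simp only [pow_one]
    linear_combination (-Real.cos s ^ 2) * this
  rw [h4]
  exact h3

theorem abs_deriv_tan_approx_le {e : ℝ} (he : 0 < e) (s : ℝ) :
    |(Real.cos s ^ 2 + e * (Real.cos s ^ 2 - Real.sin s ^ 2)) / (Real.cos s ^ 2 + e) ^ 2|
      ≤ (Real.cos s ^ 2 + e)⁻¹ := by
  have h0 : 0 < Real.cos s ^ 2 + e := by positivity
  have h1 := Real.sin_sq_add_cos_sq s
  have h2 := sq_nonneg (Real.sin s)
  have h3 := sq_nonneg (Real.cos s)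
  rw [abs_div, abs_of_pos (pow_pos h0 2), div_le_iff₀ (pow_pos h0 2), sq (Real.cos s ^ 2 + e),
    inv_mul_cancel_left₀ h0.ne', abs_le]
  constructor <;> nlinarith

theorem tendsto_tan_approx (s : ℝ) :
    Tendsto (fun n : ℕ => Real.sin s * Real.cos s / (Real.cos s ^ 2 + 1 / ((n : ℝ) + 1))) atTop
      (𝓝 (Real.tan s)) := by
  have h0 := (tendsto_one_div_add_atTop_nhds_zero_nat (𝕜 := ℝ)).const_add (Real.cos s ^ 2)
  rw [add_zero] at h0
  -- At its poles `Real.tan` takes the default value `0`, and the factor `cos s` gives the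
  -- approximants the same value.
  by_cases hc : Real.cos s = 0
  · have : Real.tan s = 0 := by rw [Real.tan_eq_sin_div_cos, hc, div_zero]
    rw [this]
    simp only [hc, mul_zero, zero_div]
    exact tendsto_const_nhds
  · have h1 := (tendsto_const_nhds (x := Real.sin s * Real.cos s)).div h0 (pow_ne_zero 2 hc)
    have h2 : Real.sin s * Real.cos s / Real.cos s ^ 2 = Real.tan s := by
      rw [Real.tan_eq_sin_div_cos]
      field_simp
    rwa [h2] at h1

variable {X : Type u} {Y : Type v} [MetricSpace X] [MeasurableSpace X]
  [MetricSpace Y] [MeasurableSpace Y] [BorelSpace Y] {m : Measure X} {u : X → Y} [SigmaFinite m]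

namespace IsSobolevMap

theorem lipschitz_mem_S2 (hu : IsSobolevMap m u) {f : Y → ℝ} {K : ℝ≥0} (hf : LipschitzWith K f) :
    (AEEqFun.mk f hf.continuous.measurable.aestronglyMeasurable : L0 (targetMeasure m u))
        ∈ S2 (targetMeasure m u) ∧
      ∀ᵐ y ∂targetMeasure m u, wug (AEEqFun.mk f
        hf.continuous.measurable.aestronglyMeasurable : L0 (targetMeasure m u)) y ≤ K := by
  have := hu.isFiniteMeasure_targetMeasure
  have hw : IsWeakBound (targetMeasure m u) (AEEqFun.mk f
      hf.continuous.measurable.aestronglyMeasurable : L0 (targetMeasure m u))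
      (fun _ => (K : ℝ)) :=
    (IsWeakBound.of_lipBd hf.lipBd (memLp_const _)
      (Eventually.of_forall fun y => (hf.lipNear y).lipR_le K.2)).congr_fun
        (AEEqFun.coeFn_mk _ _).symm
  exact ⟨hw.mem_S2 fun B _ => hu.targetMeasure_lt_top B,
    hw.wug_le fun B _ => hu.targetMeasure_lt_top B⟩

variable [BorelSpace X]

/-- Weak bounds are transported by Sobolev maps. -/
theorem exists_isWeakBound (hu : IsSobolevMap m u)
    (hm : ∀ B : Set X, Bornology.IsBounded B → m B < ∞) [SFinite (targetMeasure m u)] {f G : Y → ℝ}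
    (hf : IsWeakBound (targetMeasure m u) f G) :
    ∃ g : X → ℝ, IsWeakBound m g (fun x => G (u x) * mapGrad m u x) ∧
      ∀ᵐ x ∂m, 0 < mapGrad m u x → g x = f (u x) := by
  obtain ⟨h, k, hh, hk, hhk, hlim, hkG⟩ := hf.exists_seq
  have habs : ∀ t : ℝ, |1 / (1 + t ^ 2)| ≤ 1 := fun t => by
    rw [abs_of_pos (by positivity), div_le_one (by positivity)]
    linarith [sq_nonneg t]
  have hcont : Continuous fun t : ℝ => 1 / (1 + t ^ 2) := by
    have : ∀ t : ℝ, 1 + t ^ 2 ≠ 0 := fun t => by positivity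
    fun_prop (disch := exact this _)
  obtain ⟨key1, key2⟩ := tendsto_eLpNorm_mul (m := targetMeasure m u)
    (θ := fun n y => 1 / (1 + h n y ^ 2)) (θ₀ := fun y => 1 / (1 + f y ^ 2)) (K := 1)
    (fun n => (hcont.comp (hh n).continuous).measurable.aestronglyMeasurable)
    (fun n => Eventually.of_forall fun y => habs _)
    (hlim.mono fun y hy => (hcont.tendsto _).comp hy) hk hf.memLp hkG
  have hL : ∀ n, MemLp (fun y => 1 / (1 + h n y ^ 2) * k n y) 2 (targetMeasure m u) := by
    intro n
    refine (hk n).mono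
      ((hcont.comp (hh n).continuous).measurable.aestronglyMeasurable.mul (hk n).1) ?_
    refine Eventually.of_forall fun y => ?_
    rw [norm_mul]
    exact mul_le_of_le_one_left (norm_nonneg _) (habs _)
  have harc : ∀ t, |Real.arctan t| ≤ Real.pi / 2 := fun t =>
    abs_le.2 ⟨(Real.neg_pi_div_two_lt_arctan t).le, (Real.arctan_lt_pi_div_two t).le⟩
  have hlipa : LipschitzWith 1 Real.arctan := by
    refine lipschitzWith_of_nnnorm_deriv_le Real.differentiable_arctan fun t => ?_
    rw [Real.deriv_arctan, ← NNReal.coe_le_coe, coe_nnnorm]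
    exact habs t
  -- `arctan` makes the functions bounded, as the chain rule for functions Lipschitz on bounded sets
  -- requires. The factor `1 / (1 + h²)` is kept so that it can be cancelled later.
  have hw : ∀ n, IsWeakBound m (fun x => Real.arctan (h n (u x)))
      (fun x => (1 / (1 + h n (u x) ^ 2) * k n (u x)) * mapGrad m u x) := by
    intro n
    refine hu.isWeakBound_comp hm (h := fun y => Real.arctan (h n y))
      (g := fun y => 1 / (1 + h n y ^ 2) * k n y) ((hh n).comp hlipa)
      (fun y => harc _) (hL n) ?_
    filter_upwards [hhk n] with y hy
    refine (lipR_comp_le (hh n) (Real.hasStrictDerivAt_arctan _)).trans ?_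
    rw [abs_of_pos (by positivity)]
    exact mul_le_mul_of_nonneg_left hy (by positivity)
  set B : X → ℝ := fun x => (1 / (1 + f (u x) ^ 2) * G (u x)) * mapGrad m u x
  have hB : MemLp B 2 m := hu.memLp_comp_mul key1
  -- Off `{|Du| > 0}` nothing is known about `h n (u x)`, so the limit has to be selected by convex
  -- combinations; where `|Du| > 0` it is forced to be `arctan (f (u x))`.
  obtain ⟨θ, hθ, hθlim⟩ := IsWeakBound.exists_of_bounded_functions hw (fun n x => harc _) hB (by
    refine key2.congr fun n => ?_
    refine (hu.eLpNorm_comp_mul ((hL n).sub key1).1).symm.trans ?_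
    congr 1
    ext x
    simp only [B, Pi.sub_apply]
    ring)
  have hθf : ∀ᵐ x ∂m, 0 < mapGrad m u x → θ x = Real.arctan (f (u x)) := by
    filter_upwards [hθlim, hu.ae_of_target hlim] with x h1 h2 hx
    exact h1 _ ((Real.continuous_arctan.tendsto _).comp (h2 hx))
  -- The derivative of the regularized tangent is at most `1 / cos² θ = 1 + f²` where `|Du| > 0`,
  -- which cancels the factor `1 / (1 + f²)` in `B`. Elsewhere `B = 0`. The bound `G ∘ u |Du|` thus
  -- holds for every regularization parameter.
  refine ⟨fun x => Real.tan (θ x), ?_, ?_⟩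
  · have hpos : ∀ n : ℕ, (0 : ℝ) < 1 / ((n : ℝ) + 1) := fun n => by positivity
    refine IsWeakBound.of_tendsto (g := fun _ x => G (u x) * mapGrad m u x)
      (F := fun n x => Real.sin (θ x) * Real.cos (θ x) / (Real.cos (θ x) ^ 2 + 1 / ((n : ℝ) + 1)))
      (fun n => ?_) (hu.memLp_comp_mul hf.memLp)
      (Eventually.of_forall fun x => tendsto_tan_approx _) (by simp)
    have hc : Continuous fun s : ℝ => (Real.cos s ^ 2 + (1 / ((n : ℝ) + 1))
        * (Real.cos s ^ 2 - Real.sin s ^ 2)) / (Real.cos s ^ 2 + 1 / ((n : ℝ) + 1)) ^ 2 := by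
      have : ∀ s : ℝ, (Real.cos s ^ 2 + 1 / ((n : ℝ) + 1)) ^ 2 ≠ 0 := fun s => by positivity
      exact Continuous.div (by fun_prop) (by fun_prop) this
    refine (hθ.comp (fun s => hasStrictDerivAt_tan_approx (hpos n) s) hc
      (K := ⟨(1 / ((n : ℝ) + 1))⁻¹, by positivity⟩) (fun s => ?_)).mono ?_
      (hu.memLp_comp_mul hf.memLp)
    · refine (abs_deriv_tan_approx_le (hpos n) s).trans ?_
      exact inv_anti₀ (hpos n) (by linarith [sq_nonneg (Real.cos s)])
    · filter_upwards [hθf, hu.mapGrad_nonneg, hu.ae_of_target hf.nonneg] with x h1 h2 h3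
      rcases h2.eq_or_lt with h4 | h4
      · simp only [B]
        rw [← h4, mul_zero, mul_zero, mul_zero]
      · refine (mul_le_mul_of_nonneg_right (abs_deriv_tan_approx_le (hpos n) (θ x)) ?_).trans ?_
        · exact mul_nonneg (mul_nonneg (by positivity) (h3 h4)) h2
        · have h5 : Real.cos (θ x) ^ 2 = 1 / (1 + f (u x) ^ 2) := by
            rw [h1 h4, Real.cos_sq_arctan]
          have h6 : 0 < 1 / (1 + f (u x) ^ 2) := by positivity
          simp only [B]
          rw [h5, mul_assoc (1 / (1 + f (u x) ^ 2)), inv_mul_le_iff₀ (by positivity)]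
          refine mul_le_mul_of_nonneg_right ?_ (mul_nonneg (h3 h4) h2)
          linarith [hpos n]
  · filter_upwards [hθf] with x h1 hx
    rw [h1 hx, Real.tan_arctan]

theorem exists_isComposition (hu : IsSobolevMap m u)
    (hm : ∀ B : Set X, Bornology.IsBounded B → m B < ∞) (f : S2 (targetMeasure m u)) :
    ∃ g : S2 m, IsComposition m u f g := by
  have := hu.isFiniteMeasure_targetMeasure
  obtain ⟨g, hg, hgf⟩ := hu.exists_isWeakBound hm
    (isWeakBound_wug (fun B _ => hu.targetMeasure_lt_top B) f.2)
  have hg' : IsWeakBound m (AEEqFun.mk g hg.aestronglyMeasurable : L0 m) _ :=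
    hg.congr_fun (AEEqFun.coeFn_mk _ _).symm
  refine ⟨⟨_, hg'.mem_S2 hm⟩, ?_, hg'.wug_le hm⟩
  filter_upwards [hgf, AEEqFun.coeFn_mk g hg.aestronglyMeasurable] with x h1 h2 hx
  rw [h2, h1 hx]

end IsSobolevMap

end Compositions

/-! ## The differential -/

section Differential

/-! ### Restriction to a Borel set and extension by zero. -/

section Restriction

variable {X : Type u} [MeasurableSpace X] {m : Measure X} {E : Set X}

theorem coeFn_proj (f : L0 m) : ∀ᵐ x ∂m.restrict E, proj m E f x = f x :=
  coeFn_compHom (quasiMeasurePreserving_id_restrict m E) f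

theorem ae_coeFn_proj (hE : MeasurableSet E) (f : L0 m) : ∀ᵐ x ∂m, x ∈ E → proj m E f x = f x :=
  (ae_restrict_iff' hE).1 (coeFn_proj f)

theorem coeFn_extL0 (hE : MeasurableSet E) (f : L0 (m.restrict E)) :
    ∀ᵐ x ∂m, extL0 hE f x = E.indicator f x :=
  AEEqFun.coeFn_mk _ _

theorem extL0_mono (hE : MeasurableSet E) {f g : L0 (m.restrict E)} (h : f ≤ g) :
    extL0 hE f ≤ extL0 hE g := by
  rw [L0.le_iff] at *
  filter_upwards [coeFn_extL0 hE f, coeFn_extL0 hE g, (ae_restrict_iff' hE).1 h] with x h1 h2 h3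
  rw [h1, h2]
  by_cases hx : x ∈ E
  · simpa [hx] using h3 hx
  · simp [hx]

theorem extL0_nonneg (hE : MeasurableSet E) {f : L0 (m.restrict E)} (h : 0 ≤ f) :
    0 ≤ extL0 hE f := by
  rw [L0.nonneg_iff] at *
  filter_upwards [coeFn_extL0 hE f, (ae_restrict_iff' hE).1 h] with x h1 h3
  rw [h1]
  exact Set.indicator_apply_nonneg fun hx => h3 hx

theorem extL0_proj (hE : MeasurableSet E) {f : L0 m} (hf : ∀ᵐ x ∂m, x ∉ E → f x = 0) :
    extL0 hE (proj m E f) = f := by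
  refine AEEqFun.ext ?_
  filter_upwards [coeFn_extL0 hE (proj m E f), ae_coeFn_proj hE f, hf] with x h1 h2 h3
  rw [h1]
  by_cases hx : x ∈ E
  · rw [Set.indicator_of_mem hx, h2 hx]
  · rw [Set.indicator_of_notMem hx, h3 hx]

theorem extL0_proj_le (hE : MeasurableSet E) {f : L0 m} (hf : 0 ≤ f) :
    extL0 hE (proj m E f) ≤ f := by
  rw [L0.nonneg_iff] at hf
  rw [L0.le_iff]
  filter_upwards [coeFn_extL0 hE (proj m E f), ae_coeFn_proj hE f, hf] with x h1 h2 h3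
  rw [h1]
  by_cases hx : x ∈ E
  · rw [Set.indicator_of_mem hx, h2 hx]
  · rwa [Set.indicator_of_notMem hx]

theorem extL0_injective (hE : MeasurableSet E) :
    Function.Injective (extL0 hE : L0 (m.restrict E) → L0 m) := by
  intro f g h
  refine AEEqFun.ext ((ae_restrict_iff' hE).2 ?_)
  have h' : ∀ᵐ x ∂m, extL0 hE f x = extL0 hE g x := by rw [h]; exact Eventually.of_forall fun _ => rfl
  filter_upwards [coeFn_extL0 hE f, coeFn_extL0 hE g, h'] with x h1 h2 h3 hx
  rwa [h1, h2, Set.indicator_of_mem hx, Set.indicator_of_mem hx] at h3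

theorem extL0_add (hE : MeasurableSet E) (f g : L0 (m.restrict E)) :
    extL0 hE (f + g) = extL0 hE f + extL0 hE g := by
  refine AEEqFun.ext ?_
  filter_upwards [coeFn_extL0 hE f, coeFn_extL0 hE g, coeFn_extL0 hE (f + g),
    AEEqFun.coeFn_add (extL0 hE f) (extL0 hE g),
    (ae_restrict_iff' hE).1 (AEEqFun.coeFn_add f g)] with x h1 h2 h3 h4 h5
  rw [h3, h4, Pi.add_apply, h1, h2]
  by_cases hx : x ∈ E
  · simpa [hx] using h5 hx
  · simp [hx]

theorem extL0_proj_mul (hE : MeasurableSet E) (f : L0 m) (g : L0 (m.restrict E)) :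
    extL0 hE (proj m E f * g) = f * extL0 hE g := by
  refine AEEqFun.ext ?_
  filter_upwards [coeFn_extL0 hE g, coeFn_extL0 hE (proj m E f * g), ae_coeFn_proj hE f,
    AEEqFun.coeFn_mul f (extL0 hE g),
    (ae_restrict_iff' hE).1 (AEEqFun.coeFn_mul (proj m E f) g)] with x h1 h2 h3 h4 h5
  rw [h2, h4, Pi.mul_apply, h1]
  by_cases hx : x ∈ E
  · rw [Set.indicator_of_mem hx, Set.indicator_of_mem hx, h5 hx, Pi.mul_apply, h3 hx]
  · rw [Set.indicator_of_notMem hx, Set.indicator_of_notMem hx, mul_zero]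

end Restriction

/-! ### Functionals are determined by their values on generators. -/

section Density

variable {X : Type u} [MeasurableSpace X] {m : Measure X} [SigmaFinite m] {M : PNModule.{u, w} m}

theorem PNModule.IsL0Normed.apply_eq_zero_of_converges (hM : M.IsL0Normed) {L : M →ₗ[L0 m] L0 m}
    {k : L0 m} (hk : ∀ v, |L v| ≤ k * M.pnorm v) {s : ℕ → M} {v : M} (hs : M.Converges s v)
    (h0 : ∀ n, L (s n) = 0) : L v = 0 := by
  rw [PNModule.converges_iff] at hs
  have h1 := tendsto_rho_mul (fun n => AEEqFun.aestronglyMeasurable _) k.aestronglyMeasurable hs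
  have h2 : Tendsto (fun _ : ℕ => rho m (L v)) atTop (𝓝 0) := by
    refine tendsto_of_tendsto_of_tendsto_of_le_of_le tendsto_const_nhds h1 (fun _ => zero_le)
      fun n => rho_mono ?_
    have h3 := hk (v - s n)
    rw [map_sub, h0 n, sub_zero, hM.pnorm_sub_comm] at h3
    filter_upwards [L0.le_iff.1 h3, AEEqFun.coeFn_abs (L v),
      AEEqFun.coeFn_mul k (M.pnorm (s n - v))] with x h4 h5 h6
    rw [h5, h6, Pi.mul_apply] at h4
    exact h4.trans (le_abs_self _)
  obtain ⟨φ, -, hlim⟩ := exists_subseq_ae_of_rho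
    (fun _ => (L v).aestronglyMeasurable) h2
  refine AEEqFun.ext ?_
  filter_upwards [hlim, AEEqFun.coeFn_zero (β := ℝ)] with x h4 h5
  rw [h5]
  exact tendsto_nhds_unique tendsto_const_nhds h4

theorem PNModule.IsL0Normed.eq_zero_of_generates (hM : M.IsL0Normed) {L : M →ₗ[L0 m] L0 m}
    {k : L0 m} (hk : ∀ v, |L v| ≤ k * M.pnorm v) {S : Set M} (hS : M.Generates S)
    (h0 : ∀ v ∈ S, L v = 0) : L = 0 := by
  refine LinearMap.ext fun v => ?_
  obtain ⟨s, hs, hsv⟩ := hS v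
  have hle : Submodule.span (L0 m) S ≤ LinearMap.ker L := Submodule.span_le.2 h0
  exact hM.apply_eq_zero_of_converges hk hsv fun n => hle (hs n)

/-- A bounded functional on a pullback module vanishing on pullbacks of generators is zero. -/
theorem PullbackModule.eq_zero_of_generates {Y : Type v} [MeasurableSpace Y] {μ : Measure Y}
    {φ : X → Y} {hφ : Measure.QuasiMeasurePreserving φ m μ}
    {N : PNModule.{v, w₁} μ} (hN : N.IsL0Normed) (P : PullbackModule.{u, v, w₁, w₂} hφ N)
    {L : P.M →ₗ[L0 m] L0 m} {k : L0 m} (hk : ∀ v, |L v| ≤ k * P.M.pnorm v) {S : Set N}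
    (hS : N.Generates S) (h0 : ∀ a ∈ S, L (P.map a) = 0) : L = 0 := by
  -- The pullback map is only assumed real-linear; compatibility with multiplication by `L⁰(μ)`
  -- comes from the pointwise bound.
  have hsmul : ∀ (h : L0 μ) (a : N), L (P.map (h • a)) = compHom hφ h * L (P.map a) := by
    refine hN.map_smul_of_bound hφ (fun a => L (P.map a)) (fun a b => ?_) (fun c a => ?_) k
      fun a => ?_
    · rw [P.map_add, _root_.map_add]
    · rw [P.map_smul, _root_.map_smul, smul_eq_mul, L0.const_smul_eq]
    · rw [← P.pnorm_map]
      exact hk _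
  refine P.isL0Normed.eq_zero_of_generates hk P.generates ?_
  rintro _ ⟨a, rfl⟩
  obtain ⟨s, hs, hsa⟩ := hS a
  refine P.isL0Normed.apply_eq_zero_of_converges hk (P.continuous s a hsa) fun n => ?_
  have hspan : ∀ b ∈ Submodule.span (L0 μ) S, L (P.map b) = 0 := by
    intro b hb
    induction hb using Submodule.span_induction with
    | mem b hb => exact h0 b hb
    | zero =>
      have h := hsmul 0 0
      rwa [map_zero, zero_mul, zero_smul] at h
    | add b c _ _ h1 h2 => rw [P.map_add, _root_.map_add, h1, h2, add_zero]
    | smul h b _ h1 => rw [hsmul, h1, mul_zero]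
  exact hspan _ (hs n)

end Density

variable {X : Type u} {Y : Type v} [MetricSpace X] [MeasurableSpace X]
  [MetricSpace Y] [MeasurableSpace Y] [BorelSpace Y] {m : Measure X} {u : X → Y} [SigmaFinite m]

namespace IsSobolevMap

variable {C : CotangentModule.{u, w₁} m}

theorem abs_apply_d_le (V : C.M.dualSubmodule)
    {f : S2 (targetMeasure m u)} {g : S2 m} (hg : IsComposition m u f g) :
    ∀ᵐ x ∂m, |V.1 (C.d g) x| ≤
      C.M.dual.pnorm V x * (wug (f : L0 (targetMeasure m u)) (u x) * mapGrad m u x) := by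
  filter_upwards [L0.le_iff.1 (C.isL0Normed.abs_apply_le V (C.d g)), AEEqFun.coeFn_abs (V.1 (C.d g)),
    AEEqFun.coeFn_mul (C.M.dual.pnorm V) (C.M.pnorm (C.d g)), hg.2,
    L0.nonneg_iff.1 (C.isL0Normed.dual_pnorm_nonneg V)] with x h1 h2 h3 h4 h5
  rw [h2, h3, Pi.mul_apply, C.pnorm_d] at h1
  exact h1.trans (mul_le_mul_of_nonneg_left h4 h5)

theorem apply_d_eq_zero (hu : IsSobolevMap m u) (V : C.M.dualSubmodule)
    {f : S2 (targetMeasure m u)} {g : S2 m} (hg : IsComposition m u f g) :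
    ∀ᵐ x ∂m, x ∉ posSet m u → V.1 (C.d g) x = 0 := by
  filter_upwards [abs_apply_d_le V hg, hu.mapGrad_nonneg] with x h1 h2 hx
  have h3 : mapGrad m u x = 0 := le_antisymm (not_lt.1 hx) h2
  rw [h3, mul_zero, mul_zero] at h1
  exact abs_nonpos_iff.1 h1

end IsSobolevMap

variable [BorelSpace X]

theorem CotangentModule.pnorm_d_sub (C : CotangentModule.{u, w₁} m)
    (hm : ∀ B : Set X, Bornology.IsBounded B → m B < ∞) (g g' : S2 m) :
    C.M.pnorm (C.d g - C.d g') = wug ((g : L0 m) - (g' : L0 m)) := by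
  have h := C.map_comb 1 (-1) g g' ⟨_, (S2Submodule hm).sub_mem g.2 g'.2⟩
    (by rw [one_smul, neg_smul, one_smul, ← sub_eq_add_neg])
  rw [← C.pnorm_d ⟨_, (S2Submodule hm).sub_mem g.2 g'.2⟩, h]
  have h1 : (AEEqFun.const X (1 : ℝ) : L0 m) = 1 := rfl
  have h2 : (AEEqFun.const X (-1 : ℝ) : L0 m) = -1 := rfl
  rw [h1, h2, one_smul, neg_smul, one_smul, ← sub_eq_add_neg]

/-- `g` coincides with `f ∘ u` on `{|Du| > 0}` and has vanishing differential elsewhere. -/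
structure IsLift (m : Measure X) (u : X → Y) (f : L0 (targetMeasure m u)) (g : L0 m) : Prop where
  eq_comp : ∀ᵐ x ∂m, 0 < mapGrad m u x → g x = f (u x)
  wug_eq_zero : ∀ᵐ x ∂m, ¬ 0 < mapGrad m u x → wug g x = 0

namespace IsSobolevMap

theorem isLift (hu : IsSobolevMap m u) (hm : ∀ B : Set X, Bornology.IsBounded B → m B < ∞)
    {f : S2 (targetMeasure m u)} {g : S2 m} (h : IsComposition m u f g) :
    IsLift m u (f : L0 (targetMeasure m u)) (g : L0 m) := by
  refine ⟨h.1, ?_⟩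
  filter_upwards [h.2, hu.mapGrad_nonneg, L0.nonneg_iff.1 (wug_nonneg hm g.2)] with x h1 h2 h3 h4
  rw [le_antisymm (not_lt.1 h4) h2, mul_zero] at h1
  exact le_antisymm h1 h3

/-- The inequality `|Dg| ≤ |Df| ∘ u |Du|` is not visibly stable under linear combinations, since
`|D(a f + b f')|` may be smaller than the sum of the separate terms. The two conditions of `IsLift`
are stable, and they already determine `dg`. -/
theorem isLift_combo (hu : IsSobolevMap m u) (hm : ∀ B : Set X, Bornology.IsBounded B → m B < ∞)
    {f f' : L0 (targetMeasure m u)} {g g' : L0 m} (hg : g ∈ S2 m) (hg' : g' ∈ S2 m)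
    (h : IsLift m u f g) (h' : IsLift m u f' g') (a b : ℝ) :
    IsLift m u (a • f + b • f') (a • g + b • g') := by
  constructor
  · filter_upwards [h.eq_comp, h'.eq_comp, AEEqFun.coeFn_add (a • g) (b • g'),
      AEEqFun.coeFn_smul a g, AEEqFun.coeFn_smul b g',
      hu.ae_of_target (AEEqFun.coeFn_add (a • f) (b • f')),
      hu.ae_of_target (AEEqFun.coeFn_smul a f), hu.ae_of_target (AEEqFun.coeFn_smul b f')]
      with x e1 e2 e3 e4 e5 e6 e7 e8 hx
    rw [e3, Pi.add_apply, e4, e5, e6 hx, Pi.add_apply, e7 hx, e8 hx, Pi.smul_apply, Pi.smul_apply,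
      Pi.smul_apply, Pi.smul_apply, e1 hx, e2 hx]
  · filter_upwards [h.wug_eq_zero, h'.wug_eq_zero, L0.le_iff.1 (wug_combo_le hm hg hg' a b),
      AEEqFun.coeFn_add (|a| • wug g) (|b| • wug g'), AEEqFun.coeFn_smul |a| (wug g),
      AEEqFun.coeFn_smul |b| (wug g'), L0.nonneg_iff.1 (wug_nonneg hm (S2_combo hm hg hg' a b))]
      with x e1 e2 e3 e4 e5 e6 e7 hx
    rw [e4, Pi.add_apply, e5, e6, Pi.smul_apply, Pi.smul_apply, e1 hx, e2 hx, smul_zero,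
      smul_zero, add_zero] at e3
    exact le_antisymm e3 e7

/-- Where `|Du| > 0` the functions agree, so locality gives `|D(g - g')| = 0`; elsewhere `|D(g -
g')| ≤ |Dg| + |Dg'| = 0`. -/
theorem d_eq_of_isLift (hm : ∀ B : Set X, Bornology.IsBounded B → m B < ∞)
    (C : CotangentModule.{u, w₁} m) {f : L0 (targetMeasure m u)} {g g' : S2 m}
    (h : IsLift m u f g) (h' : IsLift m u f g') : C.d g = C.d g' := by
  rw [← sub_eq_zero, ← C.isL0Normed.pnorm_eq_zero, C.pnorm_d_sub hm]
  have hsub : (g : L0 m) - g' ∈ S2 m := (S2Submodule hm).sub_mem g.2 g'.2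
  have hle := wug_combo_le hm g.2 g'.2 1 (-1)
  rw [one_smul, neg_smul, one_smul, ← sub_eq_add_neg, abs_neg, abs_one, one_smul, one_smul] at hle
  refine AEEqFun.ext ?_
  filter_upwards [h.eq_comp, h'.eq_comp, h.wug_eq_zero, h'.wug_eq_zero,
    wug_sub_eq_zero hm g.2 g'.2, L0.le_iff.1 hle, AEEqFun.coeFn_add (wug (g : L0 m)) (wug g'),
    L0.nonneg_iff.1 (wug_nonneg hm hsub), AEEqFun.coeFn_zero (β := ℝ) (μ := m)]
    with x e1 e2 e3 e4 e5 e6 e7 e8 e9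
  rw [e9]
  by_cases hx : 0 < mapGrad m u x
  · exact e5 ((e1 hx).trans (e2 hx).symm)
  · rw [e7, Pi.add_apply, e3 hx, e4 hx, add_zero] at e6
    exact le_antisymm e6 e8

variable {C : CotangentModule.{u, w₁} m} {CY : CotangentModule.{v, w₂} (targetMeasure m u)}

/-- Composition with `u` followed by the differential, as a linear map on `S²(Y)`. -/
theorem exists_dComp (hu : IsSobolevMap m u) (hm : ∀ B : Set X, Bornology.IsBounded B → m B < ∞)
    (C : CotangentModule.{u, w₁} m) :
    ∃ δ : S2 (targetMeasure m u) → C.M,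
      (∀ f g, IsComposition m u f g → δ f = C.d g) ∧
      ∀ (a b : ℝ) (f f' h : S2 (targetMeasure m u)),
        (h : L0 (targetMeasure m u)) = a • (f : L0 (targetMeasure m u)) + b • (f' : L0 _) →
        δ h = (AEEqFun.const X a : L0 m) • δ f + (AEEqFun.const X b : L0 m) • δ f' := by
  choose R hR using hu.exists_isComposition hm
  refine ⟨fun f => C.d (R f), fun f g hg =>
    d_eq_of_isLift hm C (hu.isLift hm (hR f)) (hu.isLift hm hg), fun a b f f' h hh => ?_⟩
  have h1 := hu.isLift_combo hm (R f).2 (R f').2 (hu.isLift hm (hR f)) (hu.isLift hm (hR f')) a b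
  rw [← hh] at h1
  rw [← C.map_comb a b (R f) (R f') ⟨_, S2_combo hm (R f).2 (R f').2 a b⟩ rfl]
  exact d_eq_of_isLift hm C (hu.isLift hm (hR h)) h1

/-- Existence of the differential, with a bound for its pointwise norm. -/
theorem exists_isDifferentialAt (hu : IsSobolevMap m u)
    (hm : ∀ B : Set X, Bornology.IsBounded B → m B < ∞)
    (P : PullbackModule.{u, v, w₂, w₃} (quasiMeasurePreserving_posSet m hu.measurable) CY.M)
    (V : C.tangent) : ∃ W : diffTarget hu.measurable P, IsDifferentialAt hu.measurable C P V W ∧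
      (diffTarget hu.measurable P).pnorm W ≤ C.tangent.pnorm V * mapGrad m u := by
  have hfin := hu.isFiniteMeasure_targetMeasure
  have hmY : ∀ B : Set Y, Bornology.IsBounded B → targetMeasure m u B < ∞ := fun B _ =>
    hu.targetMeasure_lt_top B
  let V' : C.M.dualSubmodule := V
  have hE := measurableSet_posSet m u
  have hP := P.isL0Normed
  obtain ⟨δ, hδ, hδlin⟩ := hu.exists_dComp hm C
  set r : L0 m := C.M.dual.pnorm V' * mapGrad m u with hr
  have hr0 : 0 ≤ r :=
    mul_nonneg (C.isL0Normed.dual_pnorm_nonneg V') (L0.nonneg_iff.2 hu.mapGrad_nonneg)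
  have hk0 : 0 ≤ proj m (posSet m u) r := by
    have := compHom_mono (quasiMeasurePreserving_id_restrict m (posSet m u)) hr0
    rwa [map_zero] at this
  have hconst : ∀ c : ℝ, proj m (posSet m u) (AEEqFun.const X c : L0 m) = AEEqFun.const X c :=
    fun _ => rfl
  have hTcomb : ∀ (a b : ℝ) (f f' h : S2 (targetMeasure m u)),
      (h : L0 (targetMeasure m u)) = a • (f : L0 (targetMeasure m u)) + b • (f' : L0 _) →
      P.map (CY.d h) = (AEEqFun.const X a : L0 (m.restrict (posSet m u))) • P.map (CY.d f)
        + (AEEqFun.const X b : L0 (m.restrict (posSet m u))) • P.map (CY.d f') := by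
    intro a b f f' h hh
    rw [CY.map_comb a b f f' h hh, P.map_add, P.map_smul, P.map_smul]
  have hone : (AEEqFun.const X (1 : ℝ) : L0 (m.restrict (posSet m u))) = 1 := rfl
  have hzero : (AEEqFun.const X (0 : ℝ) : L0 (m.restrict (posSet m u))) = 0 := rfl
  let T : S2Submodule hmY →+ P.M := AddMonoidHom.mk' (fun f => P.map (CY.d ⟨f, f.2⟩)) fun f f' => by
    have := hTcomb 1 1 ⟨f, f.2⟩ ⟨f', f'.2⟩ ⟨(f + f' : S2Submodule hmY), (f + f').2⟩
      (by rw [one_smul, one_smul]; rfl)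
    rw [this, hone, one_smul, one_smul]
  have hT : ∀ (c : ℝ) f, T (c • f)
      = (AEEqFun.const X c : L0 (m.restrict (posSet m u))) • T f := by
    intro c f
    have := hTcomb c 0 ⟨f, f.2⟩ ⟨f, f.2⟩ ⟨(c • f : S2Submodule hmY), (c • f).2⟩
      (by rw [zero_smul, add_zero]; rfl)
    rw [hzero, zero_smul, add_zero] at this
    exact this
  have hScomb : ∀ (a b : ℝ) (f f' h : S2 (targetMeasure m u)),
      (h : L0 (targetMeasure m u)) = a • (f : L0 (targetMeasure m u)) + b • (f' : L0 _) →
      proj m (posSet m u) (V'.1 (δ h)) = a • proj m (posSet m u) (V'.1 (δ f))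
        + b • proj m (posSet m u) (V'.1 (δ f')) := by
    intro a b f f' h hh
    rw [hδlin a b f f' h hh, map_add, map_smul, map_smul, map_add, smul_eq_mul, smul_eq_mul,
      map_mul, map_mul, hconst, hconst, L0.const_smul_eq, L0.const_smul_eq]
  let S : S2Submodule hmY →ₗ[ℝ] L0 (m.restrict (posSet m u)) :=
    { toFun := fun f => proj m (posSet m u) (V'.1 (δ ⟨f, f.2⟩))
      map_add' := fun f f' => by
        have := hScomb 1 1 ⟨f, f.2⟩ ⟨f', f'.2⟩ ⟨(f + f' : S2Submodule hmY), (f + f').2⟩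
          (by rw [one_smul, one_smul]; rfl)
        rwa [one_smul, one_smul] at this
      map_smul' := fun c f => by
        have := hScomb c 0 ⟨f, f.2⟩ ⟨f, f.2⟩ ⟨(c • f : S2Submodule hmY), (c • f).2⟩
          (by rw [zero_smul, add_zero]; rfl)
        rwa [zero_smul, add_zero] at this }
  -- This domination carries the construction: it lets `S` factor through the pullback and supplies
  -- the norm bound for its extension.
  have hS : ∀ f, |S f| ≤ proj m (posSet m u) r * P.M.pnorm (T f) := by
    intro f
    obtain ⟨g, hg⟩ := hu.exists_isComposition hm ⟨f, f.2⟩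
    have hSf : S f = proj m (posSet m u) (V'.1 (C.d g)) := by
      rw [← hδ _ _ hg]
      rfl
    have hTf : P.M.pnorm (T f) = compHom (quasiMeasurePreserving_posSet m hu.measurable)
        (wug (f : L0 (targetMeasure m u))) := by
      have h1 := P.pnorm_map (CY.d ⟨f, f.2⟩)
      rw [CY.pnorm_d] at h1
      exact h1
    rw [hSf, hTf, L0.le_iff]
    have h1 := coeFn_compHom (quasiMeasurePreserving_posSet m hu.measurable)
      (wug (f : L0 (targetMeasure m u)))
    filter_upwards [h1, AEEqFun.coeFn_abs (proj m (posSet m u) (V'.1 (C.d g))),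
      coeFn_proj (E := posSet m u) (V'.1 (C.d g)), coeFn_proj (E := posSet m u) r,
      AEEqFun.coeFn_mul (proj m (posSet m u) r)
        (compHom (quasiMeasurePreserving_posSet m hu.measurable)
          (wug (f : L0 (targetMeasure m u)))), ae_restrict_of_ae (abs_apply_d_le V' hg),
      ae_restrict_of_ae (AEEqFun.coeFn_mul (C.M.dual.pnorm V') (mapGrad m u))]
      with x e1 e2 e3 e4 e5 e6 e7
    rw [e2, e3, e5, Pi.mul_apply, e4, e1, hr, e7, Pi.mul_apply]
    refine e6.trans (le_of_eq ?_)
    ring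
  obtain ⟨L, hL, hLT⟩ := hP.exists_functional_extension T hT S hk0 hS
  let W : P.M.dualSubmodule := ⟨L, _, hL⟩
  refine ⟨W, ?_, ?_⟩
  · intro f g hg
    change extL0 hE (L (P.map (CY.d f))) = V'.1 (C.d g)
    have h1 : L (P.map (CY.d f)) = proj m (posSet m u) (V'.1 (C.d g)) := by
      rw [← hδ f g hg]
      exact hLT ⟨f, f.2⟩
    rw [h1]
    -- Restricting and extending by zero loses nothing, because `V(dg)` vanishes where `|Du| = 0`.
    exact extL0_proj hE (hu.apply_d_eq_zero V' hg)
  · change extL0 hE (P.M.dual.pnorm W) ≤ r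
    exact (extL0_mono hE (hP.dual_pnorm_le W hk0 hL)).trans (extL0_proj_le hE hr0)

theorem isDifferentialAt_unique (hu : IsSobolevMap m u)
    (hm : ∀ B : Set X, Bornology.IsBounded B → m B < ∞)
    (P : PullbackModule.{u, v, w₂, w₃} (quasiMeasurePreserving_posSet m hu.measurable) CY.M)
    {V : C.tangent} {W W' : diffTarget hu.measurable P}
    (h : IsDifferentialAt hu.measurable C P V W) (h' : IsDifferentialAt hu.measurable C P V W') :
    W = W' := by
  have hfin := hu.isFiniteMeasure_targetMeasure
  let L : P.M.dualSubmodule := W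
  let L' : P.M.dualSubmodule := W'
  obtain ⟨k, hk⟩ := (L - L').2
  have h0 : (L - L').1 = 0 := by
    refine P.eq_zero_of_generates CY.isL0Normed hk CY.generates ?_
    rintro _ ⟨f, rfl⟩
    obtain ⟨g, hg⟩ := hu.exists_isComposition hm f
    have h1 : L.1 (P.map (CY.d f)) = L'.1 (P.map (CY.d f)) :=
      extL0_injective (measurableSet_posSet m u) ((h f g hg).trans (h' f g hg).symm)
    change L.1 (P.map (CY.d f)) - L'.1 (P.map (CY.d f)) = 0
    rw [h1, sub_self]
  have h1 : L - L' = 0 := Subtype.ext h0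
  exact sub_eq_zero.1 h1

end IsSobolevMap

end Differential

/-! ### Linearity, continuity and the pointwise operator norm of the differential. -/

section OperatorNorm

variable {X : Type u} {Y : Type v} [MetricSpace X] [MeasurableSpace X]
  [MetricSpace Y] [MeasurableSpace Y] [BorelSpace Y] {m : Measure X} {u : X → Y} [SigmaFinite m]

namespace IsSobolevMap

variable {C : CotangentModule.{u, w₁} m} {CY : CotangentModule.{v, w₂} (targetMeasure m u)}

theorem pnorm_diffTarget_nonneg (hu : IsSobolevMap m u)
    (P : PullbackModule.{u, v, w₂, w₃} (quasiMeasurePreserving_posSet m hu.measurable) CY.M)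
    (W : diffTarget hu.measurable P) : 0 ≤ (diffTarget hu.measurable P).pnorm W :=
  extL0_nonneg (measurableSet_posSet m u) (P.isL0Normed.dual_pnorm_nonneg W)

variable [BorelSpace X]

theorem pnorm_differential_le (hu : IsSobolevMap m u)
    (hm : ∀ B : Set X, Bornology.IsBounded B → m B < ∞)
    (P : PullbackModule.{u, v, w₂, w₃} (quasiMeasurePreserving_posSet m hu.measurable) CY.M)
    {du : C.tangent → diffTarget hu.measurable P}
    (hdu : ∀ V, IsDifferentialAt hu.measurable C P V (du V)) (V : C.tangent) :
    (diffTarget hu.measurable P).pnorm (du V) ≤ C.tangent.pnorm V * mapGrad m u := by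
  obtain ⟨W, hW, hle⟩ := hu.exists_isDifferentialAt hm P V
  rwa [hu.isDifferentialAt_unique hm P (hdu V) hW]

theorem isLinearMap_differential (hu : IsSobolevMap m u)
    (hm : ∀ B : Set X, Bornology.IsBounded B → m B < ∞)
    (P : PullbackModule.{u, v, w₂, w₃} (quasiMeasurePreserving_posSet m hu.measurable) CY.M)
    {du : C.tangent → diffTarget hu.measurable P}
    (hdu : ∀ V, IsDifferentialAt hu.measurable C P V (du V)) : IsLinearMap (L0 m) du := by
  constructor
  · intro V V'
    refine hu.isDifferentialAt_unique hm P (hdu (V + V')) ?_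
    intro f g hg
    have h1 := hdu V f g hg
    have h2 := hdu V' f g hg
    let L : P.M.dualSubmodule := du V
    let L' : P.M.dualSubmodule := du V'
    change extL0 _ (L.1 (P.map (CY.d f)) + L'.1 (P.map (CY.d f))) = _
    rw [extL0_add]
    exact congrArg₂ (· + ·) h1 h2
  · intro r V
    refine hu.isDifferentialAt_unique hm P (hdu (r • V)) ?_
    intro f g hg
    have h1 := hdu V f g hg
    let L : P.M.dualSubmodule := du V
    change extL0 _ (proj m (posSet m u) r * L.1 (P.map (CY.d f))) = _
    rw [extL0_proj_mul]
    exact congrArg (r * ·) h1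

theorem continuousMap_differential (hu : IsSobolevMap m u)
    (hm : ∀ B : Set X, Bornology.IsBounded B → m B < ∞)
    (P : PullbackModule.{u, v, w₂, w₃} (quasiMeasurePreserving_posSet m hu.measurable) CY.M)
    {du : C.tangent → diffTarget hu.measurable P}
    (hdu : ∀ V, IsDifferentialAt hu.measurable C P V (du V)) :
    PNModule.ContinuousMap C.tangent (diffTarget hu.measurable P) du := by
  intro V V₀ hV
  rw [PNModule.converges_iff] at hV ⊢
  have h1 := tendsto_rho_mul (fun n => AEEqFun.aestronglyMeasurable _)
    (mapGrad m u).aestronglyMeasurable hV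
  refine tendsto_of_tendsto_of_tendsto_of_le_of_le tendsto_const_nhds h1 (fun _ => zero_le)
    fun n => rho_mono ?_
  have hsub : du (V n) - du V₀ = du (V n - V₀) :=
    ((hu.isLinearMap_differential hm P hdu).map_sub _ _).symm
  rw [hsub]
  filter_upwards [L0.le_iff.1 (hu.pnorm_differential_le hm P hdu (V n - V₀)),
    L0.nonneg_iff.1 (hu.pnorm_diffTarget_nonneg P (du (V n - V₀))),
    AEEqFun.coeFn_mul (C.tangent.pnorm (V n - V₀)) (mapGrad m u)] with x e1 e2 e3
  rw [abs_of_nonneg e2]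
  rw [e3, Pi.mul_apply, mul_comm] at e1
  exact e1.trans (le_abs_self _)

/-- Upper bounds for the pointwise operator norm of the differential control `|D (f ∘ u)|`. -/
theorem wug_compLip_le (hu : IsSobolevMap m u)
    (hm : ∀ B : Set X, Bornology.IsBounded B → m B < ∞)
    (P : PullbackModule.{u, v, w₂, w₃} (quasiMeasurePreserving_posSet m hu.measurable) CY.M)
    {du : C.tangent → diffTarget hu.measurable P}
    (hdu : ∀ V, IsDifferentialAt hu.measurable C P V (du V)) {h : L0 m}
    (hh : h ∈ upperBounds (PNModule.unitBallValues C.tangent (diffTarget hu.measurable P) du))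
    {f : Y → ℝ} {K : ℝ≥0} (hf : LipschitzWith K f) :
    ∀ᵐ x ∂m, x ∈ posSet m u → wug (compLip m hu.measurable hf) x ≤ K * h x := by
  have hE := measurableSet_posSet m u
  obtain ⟨hfS, hfK⟩ := hu.lipschitz_mem_S2 hf
  set F : S2 (targetMeasure m u) := ⟨_, hfS⟩
  obtain ⟨g, hg⟩ := hu.exists_isComposition hm F
  obtain ⟨-, -, hmeas, hup⟩ := hu.isLeast.1
  -- Testing `du` on a vector field of norm at most `1` that norms `dg` gives `|Dg| = du(V)([u^* d
  -- f]) ≤ |du(V)| |Df| ∘ u ≤ K h`. Locality passes from `g` to `f ∘ u` on `{|Du| > 0}`.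
  obtain ⟨L, hL, hLg⟩ := C.isL0Normed.exists_norming (C.d g)
  let V : C.M.dualSubmodule := ⟨L, 1, fun v => by rw [one_mul]; exact hL v⟩
  have hV : C.tangent.pnorm V ≤ 1 :=
    C.isL0Normed.dual_pnorm_le V zero_le_one fun v => by rw [one_mul]; exact hL v
  have hle : (diffTarget hu.measurable P).pnorm (du V) ≤ h := hh ⟨V, hV, rfl⟩
  let W : P.M.dualSubmodule := du V
  have hW : extL0 hE (W.1 (P.map (CY.d F))) = wug (g : L0 m) := by
    have h1 := hdu V F g hg
    rw [← C.pnorm_d, ← hLg]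
    exact h1
  have hle' : extL0 hE (P.M.dual.pnorm W) ≤ h := hle
  have hWle := P.isL0Normed.abs_apply_le W (P.map (CY.d F))
  rw [P.pnorm_map, CY.pnorm_d] at hWle
  have hWext : ∀ᵐ x ∂m, extL0 hE (W.1 (P.map (CY.d F))) x = wug (g : L0 m) x := by
    rw [hW]
    exact Eventually.of_forall fun _ => rfl
  filter_upwards [hWext, coeFn_extL0 hE (W.1 (P.map (CY.d F))), coeFn_extL0 hE (P.M.dual.pnorm W),
    L0.le_iff.1 hle', (ae_restrict_iff' hE).1 (L0.le_iff.1 hWle),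
    (ae_restrict_iff' hE).1 (AEEqFun.coeFn_abs (W.1 (P.map (CY.d F)))),
    (ae_restrict_iff' hE).1 (AEEqFun.coeFn_mul (P.M.dual.pnorm W)
      (compHom (quasiMeasurePreserving_posSet m hu.measurable) (wug (F : L0 (targetMeasure m u))))),
    (ae_restrict_iff' hE).1 (coeFn_compHom (quasiMeasurePreserving_posSet m hu.measurable)
      (wug (F : L0 (targetMeasure m u)))), hu.ae_of_target hfK, hg.1,
    wug_le_of_eq hm (hup f K hf).1 g.2, hu.ae_of_target
      (AEEqFun.coeFn_mk f hf.continuous.measurable.aestronglyMeasurable),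
    AEEqFun.coeFn_mk (f ∘ u) (hf.continuous.measurable.comp hmeas).aestronglyMeasurable,
    (ae_restrict_iff' hE).1 (L0.nonneg_iff.1 (P.isL0Normed.dual_pnorm_nonneg W))]
    with x e1 e2 e3 e4 e5 e6 e7 e8 e9 e10 e11 e12 e13 e14 hx
  have hx' : 0 < mapGrad m u x := hx
  have h1 : wug (compLip m hmeas hf) x ≤ wug (g : L0 m) x := by
    refine e11 ?_
    rw [e10 hx', e12 hx']
    exact e13
  refine h1.trans ?_
  rw [← e1, e2, Set.indicator_of_mem hx]
  have h2 := e5 hx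
  rw [e6 hx, e7 hx, Pi.mul_apply, e8 hx] at h2
  rw [e3, Set.indicator_of_mem hx] at e4
  calc W.1 (P.map (CY.d F)) x ≤ |W.1 (P.map (CY.d F)) x| := le_abs_self _
    _ ≤ P.M.dual.pnorm W x * wug (F : L0 (targetMeasure m u)) (u x) := h2
    _ ≤ P.M.dual.pnorm W x * K := mul_le_mul_of_nonneg_left (e9 hx') (e14 hx)
    _ ≤ h x * K := mul_le_mul_of_nonneg_right e4 K.2
    _ = K * h x := mul_comm _ _

theorem isLUB_differential (hu : IsSobolevMap m u)
    (hm : ∀ B : Set X, Bornology.IsBounded B → m B < ∞)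
    (P : PullbackModule.{u, v, w₂, w₃} (quasiMeasurePreserving_posSet m hu.measurable) CY.M)
    {du : C.tangent → diffTarget hu.measurable P}
    (hdu : ∀ V, IsDifferentialAt hu.measurable C P V (du V)) :
    IsLUB (PNModule.unitBallValues C.tangent (diffTarget hu.measurable P) du) (mapGrad m u) := by
  have hD0 : 0 ≤ mapGrad m u := hu.isLeast.1.2.1
  constructor
  · rintro _ ⟨V, hV, rfl⟩
    refine (hu.pnorm_differential_le hm P hdu V).trans ?_
    have := mul_le_mul_of_nonneg_right hV hD0
    rwa [one_mul] at this
  · intro h hh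
    have hh0 : 0 ≤ h := by
      refine (hu.pnorm_diffTarget_nonneg P (du 0)).trans (hh ⟨0, ?_, rfl⟩)
      exact C.isL0Normed.dual_pnorm_le 0 zero_le_one fun v => by
        change |(0 : L0 m)| ≤ _
        rw [abs_zero, one_mul]
        exact C.isL0Normed.pnorm_nonneg v
    -- The upper bound `h` need not be in `L²` and is controlled only on `{|Du| > 0}`. Taking the
    -- minimum with `|Du|` settles both: outside that set the minimum is `|Du| = 0`, and `|D(f ∘
    -- u)|` vanishes there too.
    have hmin : h ⊓ mapGrad m u ∈ upperGradients m u := by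
      obtain ⟨hL2, -, hmeas, hup⟩ := hu.isLeast.1
      have h0 : 0 ≤ h ⊓ mapGrad m u := le_inf hh0 hD0
      refine ⟨?_, h0, hmeas, fun f K hf => ⟨(hup f K hf).1, ?_⟩⟩
      · refine hL2.mono (h ⊓ mapGrad m u).aestronglyMeasurable ?_
        filter_upwards [L0.nonneg_iff.1 h0, L0.nonneg_iff.1 hD0,
          L0.le_iff.1 (inf_le_right : h ⊓ mapGrad m u ≤ _)] with x e1 e2 e3
        rwa [Real.norm_of_nonneg e1, Real.norm_of_nonneg e2]
      · rw [L0.le_iff]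
        filter_upwards [hu.wug_compLip_le hm P hdu hh hf, L0.le_iff.1 (hup f K hf).2,
          AEEqFun.coeFn_smul (K : ℝ) (mapGrad m u), AEEqFun.coeFn_smul (K : ℝ) (h ⊓ mapGrad m u),
          AEEqFun.coeFn_inf h (mapGrad m u), L0.nonneg_iff.1 hh0, L0.nonneg_iff.1 hD0]
          with x e1 e2 e3 e4 e5 e6 e7
        rw [e3, Pi.smul_apply, smul_eq_mul] at e2
        rw [e4, Pi.smul_apply, smul_eq_mul, e5]
        by_cases hx : x ∈ posSet m u
        · rcases le_total (h x) (mapGrad m u x) with h1 | h1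
          · rw [inf_eq_left.2 h1]
            exact e1 hx
          · rwa [inf_eq_right.2 h1]
        · have h1 : mapGrad m u x = 0 := le_antisymm (not_lt.1 hx) e7
          have h2 : h x ⊓ mapGrad m u x = mapGrad m u x := inf_eq_right.2 (h1.trans_le e6)
          rwa [h2]
    exact (hu.isLeast.2 hmin).trans inf_le_left

end IsSobolevMap

end OperatorNorm

end MetricSobolev

end

theorem proposition3p5
    {X : Type u} [MetricSpace X] [CompleteSpace X] [TopologicalSpace.SeparableSpace X]
    [MeasurableSpace X] [BorelSpace X]
    {Y : Type v} [MetricSpace Y] [CompleteSpace Y] [MeasurableSpace Y] [BorelSpace Y]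
    (m : Measure X) (hm : ∀ B : Set X, Bornology.IsBounded B → m B < ∞)
    (u : X → Y) (hu : IsSobolevMap m u) :
    -- the cotangent modules and the pullback module exist
    Nonempty (CotangentModule.{u, u} m) ∧
    Nonempty (CotangentModule.{v, v} (targetMeasure m u)) ∧
    (∀ CY : CotangentModule.{v, w₂} (targetMeasure m u),
      Nonempty (PullbackModule.{u, v, w₂, max u w₂}
        (quasiMeasurePreserving_posSet m hu.measurable) CY.M)) ∧
    -- for any choice of these modules
    ∀ (C : CotangentModule.{u, w₁} m) (CY : CotangentModule.{v, w₂} (targetMeasure m u))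
      (P : PullbackModule.{u, v, w₂, w₃} (quasiMeasurePreserving_posSet m hu.measurable) CY.M),
      -- `dg` depends only on `f`
      (∀ (f : S2 (targetMeasure m u)) (g g' : S2 m),
        IsComposition m u f g → IsComposition m u f g' → C.d g = C.d g') ∧
      -- the relation determines one and only one element `du(V)`
      (∀ V : C.tangent, ∃! W : diffTarget hu.measurable P, IsDifferentialAt hu.measurable C P V W) ∧
      -- and the resulting map is `L⁰(m)`-linear, continuous, with `|du| = |Du|`
      ∀ du : C.tangent → diffTarget hu.measurable P, (∀ V, IsDifferentialAt hu.measurable C P V (du V)) →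
        IsLinearMap (L0 m) du ∧
        PNModule.ContinuousMap C.tangent (diffTarget hu.measurable P) du ∧
        IsLUB (PNModule.unitBallValues C.tangent (diffTarget hu.measurable P) du) (mapGrad m u) := by
  have := sigmaFinite_of_bounded hm
  have := hu.isFiniteMeasure_targetMeasure
  refine ⟨nonempty_cotangentModule hm,
    nonempty_cotangentModule fun B _ => hu.targetMeasure_lt_top B,
    fun CY => nonempty_pullbackModule _ _ CY.isL0Normed, fun C CY P => ⟨?_, ?_, ?_⟩⟩
  · exact fun f g g' hg hg' =>
      IsSobolevMap.d_eq_of_isLift hm C (hu.isLift hm hg) (hu.isLift hm hg')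
  · intro V
    obtain ⟨W, hW, -⟩ := hu.exists_isDifferentialAt hm P V
    exact ⟨W, hW, fun W' hW' => hu.isDifferentialAt_unique hm P hW' hW⟩
  · exact fun du hdu => ⟨hu.isLinearMap_differential hm P hdu,
      hu.continuousMap_differential hm P hdu, hu.isLUB_differential hm P hdu⟩
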